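/- Let $Q=\mathbb{R}^n$ and $X=T^*Q/T^*_{\mathbb{Z}}Q=Q\times(\mathbb{R}/\mathbb{Z})^n\cong(\mathbb{C}^*)^n$ with the symplectic form $\omega$ induced by the canonical one on $T^*Q$. Let $\phi(x)=\min_{v}(a_v+\langle v,x\rangle)$ be a tropical polynomial (a minimum over a finite nonempty set of exponents $v\in\mathbb{Z}^n$, with $a_v\in\mathbb{R}$), let $V(\phi)\subset Q$ be the set of points near which $\phi$ is not affine, and let $\Delta^{\mathbb{Z}}_\phi$ be the set of exponents $v$ for which $\phi=a_v+\langle v,\cdot\rangle$ on a nonempty open set. Assume that $V(\phi)$ has no self-intersections: for every $q\in V(\phi)$, the convex hull of the exponents of the monomials that achieve the minimum at $q$ has no lattice point in its relative interior. For $\epsilon>0$, a choice of data $\mathcal D_\epsilon=(\rho_\epsilon,r_\epsilon,s_\epsilon)$ consists of the following. (a) A smooth function $\rho_\epsilon\ge 0$ on $\mathbb{R}^n$ with $\rho_\epsilon(-x)=\rho_\epsilon(x)$, $\int\rho_\epsilon=1$ and support the closed ball of radius $\epsilon$ about $0$. Put $\tilde\phi=\rho_\epsilon*\phi$ and, for $v\in\Delta^{\mathbb{Z}}_\phi$,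 $U_v=\{x : d\tilde\phi(x)=v\}$ and $f_v(x)=a_v+\langle v,x\rangle-\tilde\phi(x)$. (b) A constant $c>0$ such that for all $v\in\Delta^{\mathbb{Z}}_\phi$, $f_v(x)<2c$ implies that $x$ lies in the open $\epsilon$-neighbourhood of $U_v$, and functions $r_\epsilon,s_\epsilon:[c,\infty)\to\mathbb{R}$, smooth on $(c,\infty)$, with $r_\epsilon$ convex, $s_\epsilon$ concave, $r_\epsilon(t)=t$ and $s_\epsilon(t)=0$ for $t\ge 2c$, $r_\epsilon'(c)=s_\epsilon'(c)=\tfrac12$, and such that the concatenation of the curves $(t,s_\epsilon'(t))$ and $(t,r_\epsilon'(t))$, $t\ge c$, is a smooth plane curve. The tropical Lagrangian $L^{\mathcal D_\epsilon}(\phi)\subset X$ is the surgery $\sigma_0\#_{\{U_v\}}\sigma_{-\phi}$. That is, over $\{x: f_v(x)\ge 2c\text{ for all }v\in\Delta^{\mathbb{Z}}_\phi\}$ it is the union of the graphs of $0$ and of $-d\tilde\phi$ modulo $T^*_{\mathbb{Z}}Q$, and over each $\{x : c\le f_v(x)\le 2c\}$, $v\in\Delta^{\mathbb{Z}}_\phi$,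 it is the union of the graphs of $d(r_\epsilon\circ f_v)=r_\epsilon'(f_v)\,df_v$ and $d(s_\epsilon\circ f_v)=s_\epsilon'(f_v)\,df_v$ modulo $T^*_{\mathbb{Z}}Q$. Then there is $\epsilon_0>0$, depending only on $\phi$, such that for all $\epsilon_1,\epsilon_2\in(0,\epsilon_0)$ and all choices of data $\mathcal D_{\epsilon_1}$ and $\mathcal D_{\epsilon_2}$, the tropical Lagrangians $L^{\mathcal D_{\epsilon_1}}(\phi)$ and $L^{\mathcal D_{\epsilon_2}}(\phi)$ are Hamiltonian isotopic in $X$: there is a smooth time-dependent Hamiltonian on $X$ (not required to have compact support) whose flow $\psi_t$ is defined for all $t\in[0,1]$ and consists of diffeomorphisms of $X$, such that $\psi_1(L^{\mathcal D_{\epsilon_1}}(\phi))=L^{\mathcal D_{\epsilon_2}}(\phi)$. -/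

import Mathlib

open scoped ContDiff

noncomputable section

namespace TropLag

/-- The base `Q = ℝⁿ` with its Euclidean structure. -/
abbrev Q (n : ℕ) : Type := EuclideanSpace ℝ (Fin n)

/-- `T^*Q = Q × ℝⁿ`; a covector `∑ pᵢ dxᵢ` is recorded by its coordinates `p`,
so that `df(x)` is recorded by `gradient f x`. -/
abbrev CotQ (n : ℕ) : Type := Q n × Q n

/-- An integer vector, seen in `ℝⁿ` (either as a point or as an integral covector). -/
def intVec {n : ℕ} (v : Fin n → ℤ) : Q n := WithLp.toLp 2 (fun i => (v i : ℝ))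

/-! ### Tropical polynomials -/

/-- A tropical (Laurent) polynomial `⨁_v a_v ⊙ x^v` with finitely many (and at least one)
monomials, with exponents in `ℤⁿ` and real coefficients. -/
structure TropicalPolynomial (n : ℕ) where
  monomials : Finset (Fin n → ℤ)
  nonempty : monomials.Nonempty
  coeff : (Fin n → ℤ) → ℝ

namespace TropicalPolynomial

variable {n : ℕ} (φ : TropicalPolynomial n)

/-- The tropical monomial `a_v ⊙ x^v`, that is the affine function `a_v + ⟨v, x⟩`. -/
def mono (v : Fin n → ℤ) (x : Q n) : ℝ := φ.coeff v + inner ℝ (intVec v) x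

/-- The function `φ : Q → ℝ`, the minimum of the monomials. -/
def eval (x : Q n) : ℝ := φ.monomials.inf' φ.nonempty (fun v => φ.mono v x)

/-- The set `Δ_φ^ℤ` of exponents whose monomial equals `φ` on a nonempty open set. -/
def vertexSet : Set (Fin n → ℤ) :=
  {v | v ∈ φ.monomials ∧ ∃ W : Set (Q n), IsOpen W ∧ W.Nonempty ∧ ∀ x ∈ W, φ.eval x = φ.mono v x}

/-- The tropical hypersurface `V(φ)`: the points near which `φ` is not affine. -/
def variety : Set (Q n) :=
  {q | ¬ ∃ A : Q n →ᵃ[ℝ] ℝ, ∀ᶠ x in nhds q, φ.eval x = A x}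

/-- The exponents of the monomials achieving the minimum at `q`. They label the linearity
stratum of `q`. -/
def active (q : Q n) : Set (Fin n → ℤ) := {v | v ∈ φ.monomials ∧ φ.mono v q = φ.eval q}

/-- The stratum of the Newton polytope dual to the linearity stratum through `q`. -/
def dualStratum (q : Q n) : Set (Q n) := convexHull ℝ (intVec '' φ.active q)

/-- The self-intersection number of the stratum through `q`: the number of lattice points in the
(relative) interior of the dual stratum. -/
def selfIntersectionNumber (q : Q n) : ℕ :=
  {w : Fin n → ℤ | intVec w ∈ intrinsicInterior ℝ (φ.dualStratum q)}.ncard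

/-- `V(φ)` has no self-intersections: every non-maximal linearity stratum has
self-intersection number `0`. -/
def HasNoSelfIntersections : Prop := ∀ q ∈ φ.variety, φ.selfIntersectionNumber q = 0

end TropicalPolynomial

/-! ### Smoothing kernels -/

/-- A symmetric non-negative smooth bump function of total integral one whose support is
the ball of radius `ε` about the origin. -/
structure SmoothingKernel (n : ℕ) (ε : ℝ) where
  toFun : Q n → ℝ
  smooth : ContDiff ℝ ∞ toFun
  nonneg : ∀ x, 0 ≤ toFun x
  symm : ∀ x, toFun (-x) = toFun x
  integral_eq_one : ∫ x, toFun x = 1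
  support_eq : tsupport toFun = Metric.closedBall 0 ε

namespace TropicalPolynomial

variable {n : ℕ} (φ : TropicalPolynomial n) {ε : ℝ} (ρ : SmoothingKernel n ε)

/-- The smoothing `φ̃ = ρ * φ`. -/
def smoothing : Q n → ℝ :=
  MeasureTheory.convolution ρ.toFun φ.eval (ContinuousLinearMap.lsmul ℝ ℝ) MeasureTheory.volume

/-- The region `U_v = {dφ̃ = v}`, where the graph of `-dφ̃` agrees with the zero section modulo
the lattice. -/
def region (v : Fin n → ℤ) : Set (Q n) := {x | gradient (φ.smoothing ρ) x = intVec v}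

/-- The convex primitive `f_v = a_v ⊙ x^v - φ̃`, whose differential is `-dφ̃` modulo the lattice
and which is normalized to vanish on `U_v`. -/
def primitive (v : Fin n → ℤ) (x : Q n) : ℝ := φ.mono v x - φ.smoothing ρ x

end TropicalPolynomial

/-! ### Surgery profiles -/

/-- A surgery profile: functions `r`, `s` on `[c, ∞)` (values below `c` are never used). -/
structure SurgeryProfile where
  c : ℝ
  c_pos : 0 < c
  r : ℝ → ℝ
  s : ℝ → ℝ
  r_smooth : ContDiffOn ℝ ∞ r (Set.Ioi c)
  s_smooth : ContDiffOn ℝ ∞ s (Set.Ioi c)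
  r_eq : ∀ t, 2 * c ≤ t → r t = t
  s_eq : ∀ t, 2 * c ≤ t → s t = 0
  r_deriv : HasDerivWithinAt r (1 / 2) (Set.Ici c) c
  s_deriv : HasDerivWithinAt s (1 / 2) (Set.Ici c) c
  r_convex : ConvexOn ℝ (Set.Ici c) r
  s_concave : ConcaveOn ℝ (Set.Ici c) s
  /-- The concatenation of the curves `(t, s'(t))` and `(t, r'(t))`, for `t ≥ c`, is a smooth
  plane curve. -/
  smooth_curve : ∃ γ : ℝ → ℝ × ℝ, ContDiff ℝ ∞ γ ∧ Function.Injective γ ∧ (∀ τ, deriv γ τ ≠ 0) ∧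
    γ '' Set.Ici 0 = (fun t => (t, derivWithin r (Set.Ici c) t)) '' Set.Ici c ∧
    γ '' Set.Iic 0 = (fun t => (t, derivWithin s (Set.Ici c) t)) '' Set.Ici c

/-- The data `𝒟_ε`: a smoothing kernel of radius `ε` and a surgery profile whose parameter `c` is
so small that `f_v(x) < 2c` forces `x` to lie in the `ε`-neighbourhood of `U_v`. -/
structure SurgeryData {n : ℕ} (φ : TropicalPolynomial n) (ε : ℝ) where
  kernel : SmoothingKernel n ε
  profile : SurgeryProfile
  neck : ∀ v ∈ φ.vertexSet, ∀ x, φ.primitive kernel v x < 2 * profile.c →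
    x ∈ Metric.thickening ε (φ.region kernel v)

/-! ### The symplectic manifold `X = T^*Q / T^*_ℤ Q` -/

/-- `X = (ℂ^*)ⁿ = T^*Q / T^*_ℤ Q = Q × (ℝ/ℤ)ⁿ`. -/
abbrev X (n : ℕ) : Type := Q n × (Fin n → UnitAddCircle)

/-- The covering `T^*Q → X`, which is the quotient by the lattice of integral covectors. The smooth
and the symplectic structure of `X` are the ones for which it is a local symplectomorphism. -/
def proj {n : ℕ} (z : CotQ n) : X n := (z.1, fun i => ((z.2 i : ℝ) : UnitAddCircle))

/-- The standard symplectic form `∑ dxᵢ ∧ dpᵢ` on `T^*Q`. -/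
def omega {n : ℕ} (V W : CotQ n) : ℝ := inner ℝ V.1 W.2 - inner ℝ V.2 W.1

/-- The section `Q → X` given by the differential of `g`, modulo the lattice. -/
def section_ {n : ℕ} (g : Q n → ℝ) (x : Q n) : X n := proj (x, gradient g x)

namespace TropicalPolynomial

variable {n : ℕ} (φ : TropicalPolynomial n) {ε : ℝ} (D : SurgeryData φ ε)

/-- The neck at `U_v`: the graphs of `d(r ∘ f_v) = r'(f_v) df_v` and `d(s ∘ f_v) = s'(f_v) df_v`
over `{c ≤ f_v ≤ 2c}`, modulo the lattice. -/
def neck (v : Fin n → ℤ) : Set (X n) :=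
  {z | ∃ x : Q n, D.profile.c ≤ φ.primitive D.kernel v x ∧
    φ.primitive D.kernel v x ≤ 2 * D.profile.c ∧
    (z = proj (x, derivWithin D.profile.r (Set.Ici D.profile.c) (φ.primitive D.kernel v x) •
          gradient (φ.primitive D.kernel v) x) ∨
     z = proj (x, derivWithin D.profile.s (Set.Ici D.profile.c) (φ.primitive D.kernel v x) •
          gradient (φ.primitive D.kernel v) x))}

/-- The tropical Lagrangian `L^𝒟(φ) = σ_0 #_{U_v} σ_{-φ}`, `v ∈ Δ_φ^ℤ`: the two sections
`σ_0` and `σ_{-φ}` away from the sets `{f_v < 2c}`, together with the necks. -/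
def lagrangian : Set (X n) :=
  {z | ∃ x : Q n, (∀ v ∈ φ.vertexSet, 2 * D.profile.c ≤ φ.primitive D.kernel v x) ∧
    (z = section_ (fun _ => 0) x ∨ z = section_ (fun y => - φ.smoothing D.kernel y) x)} ∪
  ⋃ v ∈ φ.vertexSet, φ.neck D v

end TropicalPolynomial

/-! ### Hamiltonian isotopies -/

/-- A Hamiltonian isotopy `ψ_t`, `t ∈ [0,1]`, of `X`: a smooth time-dependent Hamiltonian `H` (no
support condition) and its flow, which is required to be defined up to time one and to consist of
bijections of `X` (these are then diffeomorphisms, by smooth dependence on initial conditions).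
Trajectories are written through their lifts to the covering `T^*Q`. -/
structure HamiltonianIsotopy (n : ℕ) where
  H : ℝ → X n → ℝ
  smooth : ContDiff ℝ ∞ (fun z : ℝ × CotQ n => H z.1 (proj z.2))
  ψ : ℝ → X n → X n
  ψ_zero : ∀ z, ψ 0 z = z
  bijective : ∀ t ∈ Set.Icc (0 : ℝ) 1, Function.Bijective (ψ t)
  flow : ∀ z : X n, ∃ γ γ' : ℝ → CotQ n, ∀ t ∈ Set.Icc (0 : ℝ) 1,
    proj (γ t) = ψ t z ∧ HasDerivWithinAt γ (γ' t) (Set.Icc 0 1) t ∧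
    ∀ W : CotQ n, omega (γ' t) W = fderiv ℝ (fun y => H t (proj y)) (γ t) W

/-- Two subsets of `X` are Hamiltonian isotopic if the time-one map of some Hamiltonian isotopy of
`X` carries the first onto the second. -/
def HamiltonianIsotopic {n : ℕ} (L₁ L₂ : Set (X n)) : Prop :=
  ∃ Φ : HamiltonianIsotopy n, Φ.ψ 1 '' L₁ = L₂

end TropLag

end

/-! The gradient of a smoothing of `φ` at `x` is the mean of the exponents, each weighted by the
kernel mass near `x` of the cell where it is minimal (`gradient_mollify`). For a small radius all
these exponents are active at one common point (`exists_radius`), so the mean lies in a dual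
stratum, and the absence of self-intersections makes it a lattice point only if all the mass sits on
that exponent (`IsWeight.eq_one_of_mean_eq`). On the other hand, an exponent `w` of nonzero mass
satisfies `f_w ≤ C (1 - mass of w)` (`mono_sub_mollify_le`). Compactness turns this into a uniform
`δ` (`exists_lattice_separation`, `exists_separated`): where all `f_v ≥ m`, the sheets `0` and
`-dφ̃` stay `δ` apart modulo the lattice, and over a neck the multiples `l df_v`, `|l| ≤ 1`, stay
`δ` away from nonzero lattice points. Hence the segment from `0` to `df_v` has an embedded tube in
the fibre torus. The same holds for convex combinations of two smoothings.

Over a neck the Lagrangian consists of the covectors `θ df_v` with `(f_v, θ)` on the profile curve.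
The useful coordinate on that curve is `u = (θ - 1/2) f_v`: the curve becomes a graph `f_v = t(u)`,
and the two sheets are `t = 2|u|`. Let `τ` be the coordinate of `p` along `df_v`. The Hamiltonian
`-B((τ - 1/2) f_v)` preserves `u` and after time `σ` has multiplied `f_v` by `exp(-σ B'(u))`, so `B'
= log (t₀ / t₁)` carries the shape `t₀` to `t₁`. To pass from `ψ` to `ψ - g`, the Hamiltonian `-g τ`
fixes the zero section, moves the upper sheet by `dg`, and moves the base points of the neck so that
`f_v`, computed with the moving potential, and `θ` stay constant. `NeckMove` combines both: `-(g τ +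
B(u))` in the tubes, `0` and `-(g + κ)` near the two sheets. These agree where they meet because `B`
is `0` at one end and `κ` at the other.

A given profile may join the sheets only at `f_v = 2c`, which leaves no room for cut-offs. A
preliminary isotopy (`hamiltonianIsotopic_sheets`, `IsBranch.exists_cut`) therefore flattens the
profile before `2c`.

The Hamiltonians have noncompact support. Their flows are complete because the fibre derivative,
which is the velocity in the base, is bounded, and the fibres of `X` are compact. -/

noncomputable section

namespace TropLag

open Set Metric Filter Topology
open scoped NNReal

/-! ### Global solutions of ordinary differential equations on the unit interval -/

section ODE

variable {E : Type*} [NormedAddCommGroup E] [NormedSpace ℝ E]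

/-- `γ` solves `γ' = V t γ` on `[0, 1]`. -/
def IsSolution (V : ℝ → E → E) (γ : ℝ → E) : Prop :=
  ∀ t ∈ Icc (0 : ℝ) 1, HasDerivWithinAt γ (V t (γ t)) (Icc 0 1) t

/-- `V t` is Lipschitz on every ball, uniformly in `t ∈ [0, 1]`. -/
def LipschitzOnBalls (V : ℝ → E → E) : Prop :=
  ∀ (x : E) (R : ℝ), ∃ K : ℝ≥0, ∀ t ∈ Icc (0 : ℝ) 1, LipschitzOnWith K (V t) (closedBall x R)

lemma lipschitzOnBalls_of_contDiff [FiniteDimensional ℝ E] {V : ℝ → E → E}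
    (hV : ContDiff ℝ 1 (Function.uncurry V)) : LipschitzOnBalls V := by
  intro x R
  have := FiniteDimensional.proper_real E
  obtain ⟨K, hK⟩ := (hV.contDiffOn (s := Icc (0 : ℝ) 1 ×ˢ closedBall x R)).exists_lipschitzOnWith
    (by simp) ((convex_Icc 0 1).prod (convex_closedBall x R))
    (isCompact_Icc.prod (isCompact_closedBall x R))
  refine ⟨K, fun t ht y hy z hz => ?_⟩
  have := hK (x := (t, y)) ⟨ht, hy⟩ (y := (t, z)) ⟨ht, hz⟩
  simpa [Prod.edist_eq, Function.uncurry] using this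

lemma IsSolution.continuousOn {V : ℝ → E → E} {γ : ℝ → E} (h : IsSolution V γ) :
    ContinuousOn γ (Icc 0 1) := fun t ht => (h t ht).continuousWithinAt

/-- Both solutions have compact image on `[0, 1]`, so a Lipschitz constant on one large ball
suffices; uniqueness is then applied separately to the left and to the right of `t₀`. -/
lemma IsSolution.eqOn {V : ℝ → E → E} (hV : LipschitzOnBalls V) {γ₁ γ₂ : ℝ → E}
    (h₁ : IsSolution V γ₁) (h₂ : IsSolution V γ₂) {t₀ : ℝ} (ht₀ : t₀ ∈ Icc (0 : ℝ) 1)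
    (h : γ₁ t₀ = γ₂ t₀) : EqOn γ₁ γ₂ (Icc 0 1) := by
  obtain ⟨R₁, hR₁⟩ := (isCompact_Icc.image_of_continuousOn h₁.continuousOn).isBounded.subset_closedBall
    (0 : E)
  obtain ⟨R₂, hR₂⟩ := (isCompact_Icc.image_of_continuousOn h₂.continuousOn).isBounded.subset_closedBall
    (0 : E)
  obtain ⟨K, hK⟩ := hV 0 (max R₁ R₂)
  have m₁ : ∀ t ∈ Icc (0 : ℝ) 1, γ₁ t ∈ closedBall (0 : E) (max R₁ R₂) := fun t ht =>
    closedBall_subset_closedBall (le_max_left _ _) (hR₁ (mem_image_of_mem _ ht))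
  have m₂ : ∀ t ∈ Icc (0 : ℝ) 1, γ₂ t ∈ closedBall (0 : E) (max R₁ R₂) := fun t ht =>
    closedBall_subset_closedBall (le_max_right _ _) (hR₂ (mem_image_of_mem _ ht))
  have right : ∀ {γ : ℝ → E}, IsSolution V γ → ∀ t ∈ Ico t₀ 1,
      HasDerivWithinAt γ (V t (γ t)) (Ici t) t := fun hγ t ht =>
    (hγ t ⟨ht₀.1.trans ht.1, ht.2.le⟩).mono_of_mem_nhdsWithin
      (mem_of_superset (Icc_mem_nhdsGE ht.2)
        (Icc_subset_Icc (ht₀.1.trans ht.1) le_rfl))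
  have left : ∀ {γ : ℝ → E}, IsSolution V γ → ∀ t ∈ Ioc 0 t₀,
      HasDerivWithinAt γ (V t (γ t)) (Iic t) t := fun hγ t ht =>
    (hγ t ⟨ht.1.le, ht.2.trans ht₀.2⟩).mono_of_mem_nhdsWithin
      (mem_of_superset (Icc_mem_nhdsLE ht.1)
        (Icc_subset_Icc le_rfl (ht.2.trans ht₀.2)))
  have sr : Icc t₀ 1 ⊆ Icc (0 : ℝ) 1 := Icc_subset_Icc ht₀.1 le_rfl
  have sl : Icc 0 t₀ ⊆ Icc (0 : ℝ) 1 := Icc_subset_Icc le_rfl ht₀.2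
  rw [← Icc_union_Icc_eq_Icc ht₀.1 ht₀.2]
  apply EqOn.union
  · exact ODE_solution_unique_of_mem_Icc_left (K := K)
      (s := fun _ => closedBall (0 : E) (max R₁ R₂))
      (fun t ht => hK t (sl (Ioc_subset_Icc_self ht)))
      (h₁.continuousOn.mono sl) (left h₁) (fun t ht => m₁ t (sl (Ioc_subset_Icc_self ht)))
      (h₂.continuousOn.mono sl) (left h₂) (fun t ht => m₂ t (sl (Ioc_subset_Icc_self ht))) h
  · exact ODE_solution_unique_of_mem_Icc_right (K := K)
      (s := fun _ => closedBall (0 : E) (max R₁ R₂))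
      (fun t ht => hK t (sr (Ico_subset_Icc_self ht)))
      (h₁.continuousOn.mono sr) (right h₁) (fun t ht => m₁ t (sr (Ico_subset_Icc_self ht)))
      (h₂.continuousOn.mono sr) (right h₂) (fun t ht => m₂ t (sr (Ico_subset_Icc_self ht))) h

/-- A bounded `C¹` vector field has solutions on all of `[0, 1]`. -/
lemma exists_isSolution_of_bounded [FiniteDimensional ℝ E] {V : ℝ → E → E}
    (hV : ContDiff ℝ 1 (Function.uncurry V)) {C : ℝ}
    (hC : ∀ t ∈ Icc (0 : ℝ) 1, ∀ x, ‖V t x‖ ≤ C) {t₀ : ℝ} (ht₀ : t₀ ∈ Icc (0 : ℝ) 1) (x₀ : E) :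
    ∃ γ : ℝ → E, γ t₀ = x₀ ∧ IsSolution V γ := by
  have := FiniteDimensional.complete ℝ E
  have hC0 : 0 ≤ C := (norm_nonneg _).trans (hC 0 (by simp) x₀)
  obtain ⟨K, hK⟩ := lipschitzOnBalls_of_contDiff hV x₀ C
  -- With speed at most `C` and a time interval of length one, a solution never leaves the ball of
  -- radius `C`, so a single Picard–Lindelöf step covers all of `[0, 1]`.
  have hP : IsPicardLindelof V (tmin := 0) (tmax := 1) ⟨t₀, ht₀⟩ x₀ ⟨C, hC0⟩ 0 ⟨C, hC0⟩ K :=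
    { lipschitzOnWith := hK
      continuousOn := fun x _ =>
        (hV.continuous.comp (continuous_id.prodMk continuous_const)).continuousOn
      norm_le := fun t ht x _ => hC t ht x
      mul_max_le := by
        have : max (1 - t₀) (t₀ - 0) ≤ 1 := max_le (by linarith [ht₀.1]) (by linarith [ht₀.2])
        have h := mul_le_of_le_one_right hC0 this
        simp only [sub_zero] at h
        simpa only [NNReal.coe_zero, sub_zero] using! h }
  exact hP.exists_eq_forall_mem_Icc_hasDerivWithinAt₀

/-- If the `C¹` vector field `V` on `E × F` has bounded `E`-component, and is bounded on every
strip `closedBall x R × F`, then it has solutions on all of `[0, 1]`. -/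
lemma exists_isSolution_of_bounded_fst {F : Type*} [NormedAddCommGroup F] [NormedSpace ℝ F]
    [FiniteDimensional ℝ F] {E : Type*} [NormedAddCommGroup E] [InnerProductSpace ℝ E]
    [FiniteDimensional ℝ E] {V : ℝ → E × F → E × F}
    (hV : ContDiff ℝ 1 (Function.uncurry V)) {C : ℝ}
    (hC : ∀ t ∈ Icc (0 : ℝ) 1, ∀ z, ‖(V t z).1‖ ≤ C)
    (hb : ∀ x R, ∃ C', ∀ t ∈ Icc (0 : ℝ) 1, ∀ z : E × F, z.1 ∈ closedBall x R → ‖V t z‖ ≤ C')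
    {t₀ : ℝ} (ht₀ : t₀ ∈ Icc (0 : ℝ) 1) (z₀ : E × F) :
    ∃ γ : ℝ → E × F, γ t₀ = z₀ ∧ IsSolution V γ := by
  have hC0 : 0 ≤ C := (norm_nonneg _).trans (hC 0 (by simp) z₀)
  -- The base component moves by at most `C` in unit time, so a cut-off in the base outside radius
  -- `C + 1` makes the field bounded without being felt by the trajectory. The added `1` keeps the
  -- inner radius positive.
  let χ : ContDiffBump z₀.1 := ⟨C + 1, C + 2, by linarith, by linarith⟩
  let W : ℝ → E × F → E × F := fun t z => χ z.1 • V t z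
  obtain ⟨C', hC'⟩ := hb z₀.1 (C + 2)
  have hW : ContDiff ℝ 1 (Function.uncurry W) := by
    have : ContDiff ℝ 1 (fun q : ℝ × E × F => χ q.2.1) := χ.contDiff.comp (by fun_prop)
    exact this.smul hV
  have hWV : ∀ t z, ‖W t z‖ ≤ ‖V t z‖ := fun t z => by
    rw [norm_smul, Real.norm_of_nonneg χ.nonneg]
    exact mul_le_of_le_one_left (norm_nonneg _) χ.le_one
  have hWb : ∀ t ∈ Icc (0 : ℝ) 1, ∀ z, ‖W t z‖ ≤ max C' 0 := by
    intro t ht z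
    by_cases hz : z.1 ∈ closedBall z₀.1 (C + 2)
    · exact (hWV t z).trans ((hC' t ht z hz).trans (le_max_left _ _))
    · have : χ z.1 = 0 := χ.zero_of_le_dist (by simpa using (not_le.1 hz).le)
      simp [W, this]
  obtain ⟨γ, hγ0, hγ⟩ := exists_isSolution_of_bounded hW hWb ht₀ z₀
  refine ⟨γ, hγ0, fun t ht => ?_⟩
  have hx : ∀ s ∈ Icc (0 : ℝ) 1, HasDerivWithinAt (fun s => (γ s).1) (W s (γ s)).1 (Icc 0 1) s :=
    fun s hs => (hγ s hs).fst
  have hle : ‖(γ t).1 - (γ t₀).1‖ ≤ C * ‖t - t₀‖ :=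
    (convex_Icc (0 : ℝ) 1).norm_image_sub_le_of_norm_hasDerivWithin_le hx (fun s hs => by
      have : ‖(W s (γ s)).1‖ ≤ ‖(V s (γ s)).1‖ := by
        change ‖χ (γ s).1 • (V s (γ s)).1‖ ≤ _
        rw [norm_smul, Real.norm_of_nonneg χ.nonneg]
        exact mul_le_of_le_one_left (norm_nonneg _) χ.le_one
      exact this.trans (hC s hs _)) ht₀ ht
  have ht1 : ‖t - t₀‖ ≤ 1 := by
    rw [Real.norm_eq_abs, abs_le]; constructor <;> linarith [ht.1, ht.2, ht₀.1, ht₀.2]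
  have h1 : χ (γ t).1 = 1 := by
    apply χ.one_of_mem_closedBall
    have hle' : ‖(γ t).1 - z₀.1‖ ≤ C * ‖t - t₀‖ := by rw [hγ0] at hle; exact hle
    rw [mem_closedBall, dist_eq_norm]
    calc _ ≤ C * ‖t - t₀‖ := hle'
      _ ≤ C * 1 := by gcongr
      _ ≤ C + 1 := by linarith
  have := hγ t ht
  simp only [W, h1, one_smul] at this
  exact this

end ODE

/-! ### The lattice and the covering -/

variable {n : ℕ}

lemma intVec_apply (k : Fin n → ℤ) (i : Fin n) : intVec k i = (k i : ℝ) := rfl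

lemma intVec_add (k l : Fin n → ℤ) : intVec (k + l) = intVec k + intVec l := by
  ext i; simp [intVec]

lemma intVec_neg (k : Fin n → ℤ) : intVec (-k) = -intVec k := by
  ext i; simp [intVec]

lemma intVec_sub (k l : Fin n → ℤ) : intVec (k - l) = intVec k - intVec l := by
  ext i; simp [intVec]

@[simp] lemma intVec_zero : intVec (0 : Fin n → ℤ) = 0 := by
  ext i; simp [intVec]

lemma intVec_injective : Function.Injective (intVec (n := n)) := by
  intro k l h
  funext i
  have := congrArg (fun q : Q n => q i) h
  simpa [intVec] using this

lemma proj_eq_proj_iff {z z' : CotQ n} :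
    proj z = proj z' ↔ ∃ k : Fin n → ℤ, z' = z + (0, intVec k) := by
  constructor
  · intro h
    have h1 : z.1 = z'.1 := congrArg (fun q : X n => q.1) h
    have h2 : ∀ i, ((z.2 i : ℝ) : UnitAddCircle) = ((z'.2 i : ℝ) : UnitAddCircle) :=
      fun i => congrFun (congrArg Prod.snd h) i
    have h3 : ∀ i, ∃ m : ℤ, z'.2 i = z.2 i + m := fun i => by
      have h4 : ((z'.2 i - z.2 i : ℝ) : UnitAddCircle) = 0 := by
        rw [AddCircle.coe_sub, h2 i, sub_self]
      obtain ⟨m, hm⟩ := (AddCircle.coe_eq_zero_iff (1 : ℝ)).1 h4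
      refine ⟨m, ?_⟩
      rw [zsmul_one] at hm
      linarith
    choose k hk using h3
    refine ⟨k, Prod.ext (by simp [h1]) ?_⟩
    ext i
    simp [intVec, hk i]
  · rintro ⟨k, rfl⟩
    refine Prod.ext (by simp [proj]) ?_
    funext i
    simp [proj, intVec]

lemma proj_add_intVec (z : CotQ n) (k : Fin n → ℤ) : proj (z + (0, intVec k)) = proj z :=
  (proj_eq_proj_iff.2 ⟨k, rfl⟩).symm

lemma proj_surjective : Function.Surjective (proj (n := n)) := by
  rintro ⟨x, q⟩
  choose p hp using fun i => QuotientAddGroup.mk_surjective (q i)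
  exact ⟨(x, WithLp.toLp 2 p), Prod.ext rfl (funext hp)⟩

/-- A lift of points of `X` to `T^*Q`. -/
def lift (z : X n) : CotQ n := (proj_surjective z).choose

@[simp] lemma proj_lift (z : X n) : proj (lift z) = z := (proj_surjective z).choose_spec

lemma exists_sub_intVec_mem_closedBall (p : Q n) :
    ∃ k : Fin n → ℤ, p - intVec k ∈ closedBall (0 : Q n) (n : ℝ) := by
  refine ⟨fun i => ⌊p i⌋, ?_⟩
  rw [mem_closedBall_zero_iff, EuclideanSpace.norm_eq]
  have h : ∀ i, ‖(p - intVec fun i => ⌊p i⌋) i‖ ^ 2 ≤ 1 := fun i => by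
    have : (p - intVec fun i => ⌊p i⌋) i = Int.fract (p i) := by
      simp [intVec, Int.self_sub_floor]
    rw [this, Real.norm_of_nonneg (Int.fract_nonneg _)]
    exact pow_le_one₀ (Int.fract_nonneg _) (Int.fract_lt_one _).le
  have hs : ∑ i, ‖(p - intVec fun i => ⌊p i⌋) i‖ ^ 2 ≤ (n : ℝ) := by
    calc _ ≤ ∑ _i : Fin n, (1 : ℝ) := Finset.sum_le_sum fun i _ => h i
      _ = n := by simp
  rw [Real.sqrt_le_left (by positivity)]
  rcases Nat.eq_zero_or_pos n with rfl | hn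
  · simp
  · have : (1 : ℝ) ≤ n := by exact_mod_cast hn
    nlinarith

/-- A continuous function on `A × ℝⁿ` which is periodic in `ℝⁿ` is bounded above over compact sets
in `A`. -/
lemma exists_bound_of_periodic {A : Type*} [TopologicalSpace A] {S : Set A} (hS : IsCompact S)
    {f : A × Q n → ℝ} (hf : Continuous f)
    (hper : ∀ a p (k : Fin n → ℤ), f (a, p + intVec k) = f (a, p)) :
    ∃ C, ∀ a ∈ S, ∀ p, f (a, p) ≤ C := by
  obtain ⟨C, hC⟩ := (hS.prod (isCompact_closedBall (0 : Q n) n)).bddAbove_image hf.continuousOn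
  refine ⟨C, fun a ha p => ?_⟩
  obtain ⟨k, hk⟩ := exists_sub_intVec_mem_closedBall p
  have := hC (mem_image_of_mem f (show (a, p - intVec k) ∈ S ×ˢ closedBall (0 : Q n) n from ⟨ha, hk⟩))
  rwa [← hper a (p - intVec k) k, sub_add_cancel] at this

/-! ### Hamiltonian vector fields on the cover -/

/-- `K` is invariant under the lattice of integral covectors. -/
def FibrePeriodic (K : ℝ × CotQ n → ℝ) : Prop :=
  ∀ t z (k : Fin n → ℤ), K (t, z + (0, intVec k)) = K (t, z)

/-- The Hamiltonian vector field `(∂K/∂p, -∂K/∂x)`. -/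
def hamField (K : ℝ × CotQ n → ℝ) (t : ℝ) (z : CotQ n) : CotQ n :=
  ((InnerProductSpace.toDual ℝ (Q n)).symm
      ((fderiv ℝ (fun y => K (t, y)) z).comp (ContinuousLinearMap.inr ℝ (Q n) (Q n))),
    -(InnerProductSpace.toDual ℝ (Q n)).symm
      ((fderiv ℝ (fun y => K (t, y)) z).comp (ContinuousLinearMap.inl ℝ (Q n) (Q n))))

lemma omega_hamField (K : ℝ × CotQ n → ℝ) (t : ℝ) (z W : CotQ n) :
    omega (hamField K t z) W = fderiv ℝ (fun y => K (t, y)) z W := by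
  simp only [omega, hamField, inner_neg_left, InnerProductSpace.toDual_symm_apply, sub_neg_eq_add]
  simp only [ContinuousLinearMap.comp_apply, ContinuousLinearMap.inr_apply,
    ContinuousLinearMap.inl_apply, ← map_add]
  simp

lemma eq_of_omega_eq {v w : CotQ n} (h : ∀ W, omega v W = omega w W) : v = w := by
  refine Prod.ext ?_ ?_
  · refine ext_inner_right ℝ fun y => ?_
    simpa [omega] using h (0, y)
  · refine ext_inner_right ℝ fun y => ?_
    simpa [omega] using h (y, 0)

lemma eq_hamField {K : ℝ × CotQ n → ℝ} {t : ℝ} {z v : CotQ n}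
    (h : ∀ W, omega v W = fderiv ℝ (fun y => K (t, y)) z W) : v = hamField K t z :=
  eq_of_omega_eq fun W => by rw [h, omega_hamField]

lemma contDiff_hamField {K : ℝ × CotQ n → ℝ} (hK : ContDiff ℝ ∞ K) :
    ContDiff ℝ ∞ (Function.uncurry (hamField K)) := by
  have h1 : ∀ q : ℝ × CotQ n, fderiv ℝ (fun y => K (q.1, y)) q.2 =
      (fderiv ℝ K q).comp (ContinuousLinearMap.inr ℝ ℝ (CotQ n)) := fun q => by
    have := ((hK.differentiable (by simp)) (q.1, q.2)).hasFDerivAt.comp q.2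
      (hasFDerivAt_prodMk_right q.1 q.2)
    exact this.fderiv
  have h2 : ContDiff ℝ ∞ (fun q : ℝ × CotQ n => fderiv ℝ (fun y => K (q.1, y)) q.2) := by
    simp_rw [h1]
    exact (hK.fderiv_right (m := ∞) (by simp)).clm_comp contDiff_const
  have h3 : ∀ T : (Q n) →L[ℝ] CotQ n, ContDiff ℝ ∞ (fun q : ℝ × CotQ n =>
      (InnerProductSpace.toDual ℝ (Q n)).symm
        ((fderiv ℝ (fun y => K (q.1, y)) q.2).comp T)) := fun T =>
    (InnerProductSpace.toDual ℝ (Q n)).symm.contDiff.comp (h2.clm_comp contDiff_const)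
  exact (h3 _).prodMk (h3 _).neg

lemma FibrePeriodic.hamField {K : ℝ × CotQ n → ℝ} (hK : FibrePeriodic K) (t : ℝ) (z : CotQ n)
    (k : Fin n → ℤ) : hamField K t (z + (0, intVec k)) = hamField K t z := by
  have : fderiv ℝ (fun y => K (t, y)) (z + (0, intVec k)) = fderiv ℝ (fun y => K (t, y)) z := by
    rw [← fderiv_comp_add_right]
    congr 1
    funext y
    exact hK t y k
  simp only [TropLag.hamField, this]

lemma IsSolution.add_intVec {K : ℝ × CotQ n → ℝ} (hK : FibrePeriodic K) {γ : ℝ → CotQ n}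
    (h : IsSolution (hamField K) γ) (k : Fin n → ℤ) :
    IsSolution (hamField K) (fun t => γ t + (0, intVec k)) := fun t ht => by
  rw [hK.hamField]
  exact (h t ht).add_const _

/-- The fibre derivative of `K` is bounded. -/
def FibreBounded (K : ℝ × CotQ n → ℝ) : Prop :=
  ∃ C, ∀ t ∈ Icc (0 : ℝ) 1, ∀ z, ‖(hamField K t z).1‖ ≤ C

/-- Periodicity bounds the field over compact subsets of the base, and `FibreBounded` bounds the
speed in the base; together these exclude blow-up. -/
lemma exists_isSolution_hamField {K : ℝ × CotQ n → ℝ} (hK : ContDiff ℝ ∞ K)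
    (hper : FibrePeriodic K) (hb : FibreBounded K) {t₀ : ℝ} (ht₀ : t₀ ∈ Icc (0 : ℝ) 1)
    (z₀ : CotQ n) : ∃ γ, γ t₀ = z₀ ∧ IsSolution (hamField K) γ := by
  obtain ⟨C, hC⟩ := hb
  have hV := contDiff_hamField hK
  refine exists_isSolution_of_bounded_fst (hV.of_le (by simp)) hC (fun x R => ?_) ht₀ z₀
  obtain ⟨C', hC'⟩ := exists_bound_of_periodic (n := n)
    (isCompact_Icc.prod (isCompact_closedBall x R) : IsCompact (Icc (0 : ℝ) 1 ×ˢ closedBall x R))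
    (f := fun q => ‖hamField K q.1.1 (q.1.2, q.2)‖)
    ((hV.continuous.comp (by fun_prop : Continuous fun q : (ℝ × Q n) × Q n =>
      (q.1.1, (q.1.2, q.2)))).norm)
    (fun a p k => by
      have := hper.hamField a.1 (a.2, p) k
      simpa using congrArg norm this)
  exact ⟨C', fun t ht z hz => hC' (t, z.1) ⟨ht, hz⟩ z.2⟩

/-- If `L₀` and `L₁` are the sets of initial and end points of a family of trajectories of a fibrewise
bounded Hamiltonian, then they are Hamiltonian isotopic. -/
theorem hamiltonianIsotopic_of_trajectories {K : ℝ × CotQ n → ℝ} (hK : ContDiff ℝ ∞ K)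
    (hper : FibrePeriodic K) (hb : FibreBounded K) {L₀ L₁ : Set (X n)}
    (h₀ : ∀ z ∈ L₀, ∃ γ, IsSolution (hamField K) γ ∧ proj (γ 0) = z ∧ proj (γ 1) ∈ L₁)
    (h₁ : ∀ z ∈ L₁, ∃ γ, IsSolution (hamField K) γ ∧ proj (γ 1) = z ∧ proj (γ 0) ∈ L₀) :
    HamiltonianIsotopic L₀ L₁ := by
  have hlip : LipschitzOnBalls (hamField K) :=
    lipschitzOnBalls_of_contDiff ((contDiff_hamField hK).of_le (by simp))
  have i0 : (0 : ℝ) ∈ Icc (0 : ℝ) 1 := by simp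
  have i1 : (1 : ℝ) ∈ Icc (0 : ℝ) 1 := by simp
  choose F hF0 hF using fun z : CotQ n => exists_isSolution_hamField hK hper hb i0 z
  -- Lifts that meet in `X` at one time differ there by a lattice translation, and translates of
  -- solutions are solutions. Hence the flow on `X` does not depend on the lift and is injective.
  have huniq : ∀ {γ₁ γ₂ : ℝ → CotQ n}, IsSolution (hamField K) γ₁ → IsSolution (hamField K) γ₂ →
      ∀ {t}, t ∈ Icc (0 : ℝ) 1 → proj (γ₁ t) = proj (γ₂ t) →
      ∀ s ∈ Icc (0 : ℝ) 1, proj (γ₁ s) = proj (γ₂ s) := by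
    intro γ₁ γ₂ h1 h2 t ht h s hs
    obtain ⟨k, hk⟩ := proj_eq_proj_iff.1 h
    have := (h1.add_intVec hper k).eqOn hlip h2 ht hk.symm hs
    exact proj_eq_proj_iff.2 ⟨k, this.symm⟩
  have hHK : ∀ t y, K (t, lift (proj y)) = K (t, y) := fun t y => by
    obtain ⟨k, hk⟩ := proj_eq_proj_iff.1 (proj_lift (proj y)).symm
    rw [hk, hper]
  let Φ : HamiltonianIsotopy n :=
    { H := fun t z => K (t, lift z)
      smooth := by
        simp_rw [hHK]
        exact hK
      ψ := fun t z => proj (F (lift z) t)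
      ψ_zero := fun z => by rw [hF0, proj_lift]
      bijective := by
        intro t ht
        refine ⟨fun z z' h => ?_, fun z => ?_⟩
        · have := huniq (hF _) (hF _) ht h 0 i0
          simpa [hF0] using this
        · obtain ⟨γ, hγt, hγ⟩ := exists_isSolution_hamField hK hper hb ht (lift z)
          refine ⟨proj (γ 0), ?_⟩
          have := huniq (hF (lift (proj (γ 0)))) hγ i0 (by rw [hF0, proj_lift]) t ht
          change proj (F (lift (proj (γ 0))) t) = z
          rw [this, hγt, proj_lift]
      flow := fun z => ⟨F (lift z), fun t => hamField K t (F (lift z) t), fun t ht =>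
        ⟨rfl, hF _ t ht, fun W => by
          simp_rw [hHK]
          exact omega_hamField K t _ W⟩⟩ }
  refine ⟨Φ, Subset.antisymm ?_ ?_⟩
  · rintro _ ⟨z, hz, rfl⟩
    obtain ⟨γ, hγ, h0, h1⟩ := h₀ z hz
    have := huniq (hF (lift z)) hγ i0 (by rw [hF0, proj_lift, h0]) 1 i1
    change proj (F (lift z) 1) ∈ L₁
    rwa [this]
  · intro z hz
    obtain ⟨γ, hγ, h1, h0⟩ := h₁ z hz
    refine ⟨proj (γ 0), h0, ?_⟩
    have := huniq (hF (lift (proj (γ 0)))) hγ i0 (by rw [hF0, proj_lift]) 1 i1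
    change proj (F (lift (proj (γ 0))) 1) = z
    rw [this, h1]

end TropLag
end

noncomputable section

namespace TropLag

open Set Metric Filter Topology
open scoped NNReal

variable {n : ℕ}

/-! ### Hamiltonian isotopy is an equivalence relation -/

lemma omega_add_left (u v W : CotQ n) : omega (u + v) W = omega u W + omega v W := by
  simp [omega, inner_add_left]; ring

lemma omega_smul_left (a : ℝ) (v W : CotQ n) : omega (a • v) W = a * omega v W := by
  simp [omega, inner_smul_left]; ring

/-- Time reversal: `-H (1 - t)` generates `ψ (1 - t) ∘ (ψ 1)⁻¹`. -/
lemma HamiltonianIsotopic.symm {L₁ L₂ : Set (X n)} (h : HamiltonianIsotopic L₁ L₂) :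
    HamiltonianIsotopic L₂ L₁ := by
  obtain ⟨Φ, rfl⟩ := h
  have hb1 := Φ.bijective 1 (by simp)
  let e := Equiv.ofBijective (Φ.ψ 1) hb1
  have hsub : ∀ t ∈ Icc (0 : ℝ) 1, 1 - t ∈ Icc (0 : ℝ) 1 := fun t ht =>
    ⟨by linarith [ht.2], by linarith [ht.1]⟩
  have hK := Φ.smooth
  refine ⟨{ H := fun t z => -Φ.H (1 - t) z
            smooth := ?_
            ψ := fun t z => Φ.ψ (1 - t) (e.symm z)
            ψ_zero := ?_
            bijective := ?_
            flow := ?_ }, ?_⟩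
  · exact (hK.comp (by fun_prop : ContDiff ℝ ∞ fun z : ℝ × CotQ n => (1 - z.1, z.2))).neg
  · intro z
    have := e.apply_symm_apply z
    rw [sub_zero]
    exact this
  · exact fun t ht => (Φ.bijective (1 - t) (hsub t ht)).comp e.symm.bijective
  · intro z
    obtain ⟨γ, γ', h⟩ := Φ.flow (e.symm z)
    refine ⟨fun t => γ (1 - t), fun t => -γ' (1 - t), fun t ht => ?_⟩
    obtain ⟨h1, h2, h3⟩ := h (1 - t) (hsub t ht)
    refine ⟨h1, ?_, fun W => ?_⟩
    · have hd : HasDerivWithinAt (fun t : ℝ => 1 - t) (-1) (Icc 0 1) t := by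
        simpa using (hasDerivWithinAt_id t (Icc (0 : ℝ) 1)).const_sub 1
      have := h2.scomp t hd hsub
      rw [neg_one_smul] at this
      exact this
    · change omega (-γ' (1 - t)) W = _
      rw [← neg_one_smul ℝ, omega_smul_left, h3 W]
      simp
  · rw [image_image]
    have : ∀ z, Φ.ψ (1 - 1) (e.symm (Φ.ψ 1 z)) = z := fun z => by
      rw [sub_self, Φ.ψ_zero]
      exact e.symm_apply_apply z
    simp only [this, image_id']

lemma deriv_smoothTransition_eq_zero {x : ℝ} (h : x ≤ 0 ∨ 1 ≤ x) :
    deriv Real.smoothTransition x = 0 := by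
  rcases h with h | h
  · refine IsLocalMin.deriv_eq_zero (Eventually.of_forall fun y => ?_)
    rw [Real.smoothTransition.zero_of_nonpos h]
    exact Real.smoothTransition.nonneg y
  · refine IsLocalMax.deriv_eq_zero (Eventually.of_forall fun y => ?_)
    rw [Real.smoothTransition.one_of_one_le h]
    exact Real.smoothTransition.le_one y

/-- Concatenation after reparametrising time by a smooth transition function. Each flow is at rest
during the other's half of the interval, so the joined Hamiltonian is smooth without any matching at
`t = 1/2`. -/
lemma HamiltonianIsotopic.trans {L₁ L₂ L₃ : Set (X n)} (h : HamiltonianIsotopic L₁ L₂)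
    (h' : HamiltonianIsotopic L₂ L₃) : HamiltonianIsotopic L₁ L₃ := by
  obtain ⟨Φ, rfl⟩ := h
  obtain ⟨Ψ, rfl⟩ := h'
  let σ := Real.smoothTransition
  have hσ : ContDiff ℝ ∞ σ := Real.smoothTransition.contDiff
  have hσ' : ContDiff ℝ ∞ (deriv σ) := (contDiff_infty_iff_deriv.1 hσ).2
  have hσI : ∀ t, σ t ∈ Icc (0 : ℝ) 1 := fun t =>
    ⟨Real.smoothTransition.nonneg t, Real.smoothTransition.le_one t⟩
  let a : ℝ → ℝ := fun t => σ (2 * t)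
  let b : ℝ → ℝ := fun t => σ (2 * t - 1)
  let a' : ℝ → ℝ := fun t => 2 * deriv σ (2 * t)
  let b' : ℝ → ℝ := fun t => 2 * deriv σ (2 * t - 1)
  have hda : ∀ t, HasDerivAt a (a' t) t := fun t => by
    have h1 : HasDerivAt (fun t : ℝ => 2 * t) 2 t := by simpa using (hasDerivAt_id t).const_mul 2
    have h2 := (hσ.differentiable (by simp) (2 * t)).hasDerivAt.comp t h1
    rw [mul_comm] at h2
    exact h2
  have hdb : ∀ t, HasDerivAt b (b' t) t := fun t => by
    have h1 : HasDerivAt (fun t : ℝ => 2 * t - 1) 2 t := by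
      simpa using ((hasDerivAt_id t).const_mul 2).sub_const 1
    have h2 := (hσ.differentiable (by simp) (2 * t - 1)).hasDerivAt.comp t h1
    rw [mul_comm] at h2
    exact h2
  have hlow : ∀ t, t ≤ 1 / 2 → b t = 0 ∧ b' t = 0 := fun t ht =>
    ⟨Real.smoothTransition.zero_of_nonpos (by linarith), by
      simp only [b', mul_eq_zero]
      exact Or.inr (deriv_smoothTransition_eq_zero (Or.inl (by linarith)))⟩
  have hhigh : ∀ t, 1 / 2 ≤ t → a t = 1 ∧ a' t = 0 := fun t ht =>
    ⟨Real.smoothTransition.one_of_one_le (by linarith), by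
      simp only [a', mul_eq_zero]
      exact Or.inr (deriv_smoothTransition_eq_zero (Or.inr (by linarith)))⟩
  refine ⟨{ H := fun t z => a' t * Φ.H (a t) z + b' t * Ψ.H (b t) z
            smooth := ?_
            ψ := fun t z => Ψ.ψ (b t) (Φ.ψ (a t) z)
            ψ_zero := ?_
            bijective := ?_
            flow := ?_ }, ?_⟩
  · have ha : ContDiff ℝ ∞ a := hσ.comp (by fun_prop)
    have hb : ContDiff ℝ ∞ b := hσ.comp (by fun_prop)
    have ha' : ContDiff ℝ ∞ a' := contDiff_const.mul (hσ'.comp (by fun_prop))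
    have hb' : ContDiff ℝ ∞ b' := contDiff_const.mul (hσ'.comp (by fun_prop))
    exact ((ha'.comp contDiff_fst).mul
        (Φ.smooth.comp ((ha.comp contDiff_fst).prodMk contDiff_snd))).add
      ((hb'.comp contDiff_fst).mul
        (Ψ.smooth.comp ((hb.comp contDiff_fst).prodMk contDiff_snd)))
  · intro z
    have : a 0 = 0 := by simp [a, σ, Real.smoothTransition.zero_of_nonpos]
    simp [(hlow 0 (by norm_num)).1, this, Φ.ψ_zero, Ψ.ψ_zero]
  · exact fun t _ => (Ψ.bijective _ (hσI _)).comp (Φ.bijective _ (hσI _))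
  · intro z
    obtain ⟨γ, γ', h⟩ := Φ.flow z
    obtain ⟨δ, δ', h'⟩ := Ψ.flow (Φ.ψ 1 z)
    have hglue : proj (δ 0) = proj (γ 1) := by
      rw [(h' 0 (by simp)).1, (h 1 (by simp)).1, Ψ.ψ_zero]
    obtain ⟨k, hk⟩ := proj_eq_proj_iff.1 hglue
    -- The lift `δ` may start at a lattice translate of `γ 1`; adding only its increment keeps the
    -- joined lift continuous.
    refine ⟨fun t => γ (a t) + (δ (b t) - δ 0), fun t => a' t • γ' (a t) + b' t • δ' (b t),
      fun t _ => ?_⟩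
    obtain ⟨h1, h2, h3⟩ := h (a t) (hσI _)
    obtain ⟨h1', h2', h3'⟩ := h' (b t) (hσI _)
    have hd : HasDerivWithinAt (fun t => γ (a t) + (δ (b t) - δ 0))
        (a' t • γ' (a t) + b' t • δ' (b t)) (Icc 0 1) t :=
      (h2.scomp t (hda t).hasDerivWithinAt fun s _ => hσI _).add
        ((h2'.scomp t (hdb t).hasDerivWithinAt fun s _ => hσI _).sub_const _)
    rcases le_total t (1 / 2) with ht | ht
    · obtain ⟨hb, hb'⟩ := hlow t ht
      simp only [hb, hb', sub_self, add_zero, zero_smul, zero_mul, Ψ.ψ_zero]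
      refine ⟨h1, ?_, fun W => ?_⟩
      · simpa [hb'] using hd
      · rw [omega_smul_left, h3 W, fderiv_const_mul]
        · simp
        · exact (Φ.smooth.comp (by fun_prop : ContDiff ℝ ∞ fun y : CotQ n => (a t, y))).differentiable
            (by simp) _
    · obtain ⟨ha, ha'⟩ := hhigh t ht
      have hpt : γ 1 + (δ (b t) - δ 0) = δ (b t) + (0, intVec k) := by rw [hk]; abel
      simp only [ha, ha', zero_add, zero_smul, zero_mul]
      refine ⟨?_, ?_, fun W => ?_⟩
      · rw [hpt, proj_add_intVec, h1']
      · simpa [ha, ha'] using hd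
      · rw [omega_smul_left, h3' W, fderiv_const_mul]
        · rw [hpt, ← fderiv_comp_add_right]
          simp [proj_add_intVec]
        · exact (Ψ.smooth.comp (by fun_prop : ContDiff ℝ ∞ fun y : CotQ n => (b t, y))).differentiable
            (by simp) _
  · rw [image_image]
    have ha1 : a 1 = 1 := (hhigh 1 (by norm_num)).1
    have hb1 : b 1 = 1 := Real.smoothTransition.one_of_one_le (by norm_num)
    simp only [ha1, hb1]

end TropLag
end

noncomputable section

namespace TropLag

open Set Metric Filter Topology MeasureTheory
open scoped NNReal Pointwise

variable {n : ℕ}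

/-! ### Convex geometry -/

/-- A finite system of affine inequalities which is solvable up to every positive error is
solvable. -/
lemma exists_solution_of_approx {ι : Type*} [Finite ι] (ξ : ι → Q n) (β : ι → ℝ)
    (h : ∀ η > 0, ∃ x, ∀ i, β i + inner ℝ (ξ i) x ≤ η) :
    ∃ x, ∀ i, β i + inner ℝ (ξ i) x ≤ 0 := by
  have hη : ∀ k : ℕ, (0 : ℝ) < 1 / ((k : ℝ) + 1) := fun k => by positivity
  -- For each error take the approximate solution of least norm. If these stay bounded, a limit
  -- point solves the system; otherwise they could be shortened along their limiting direction,
  -- against minimality.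
  have hmin : ∀ k : ℕ, ∃ x, (∀ i, β i + inner ℝ (ξ i) x ≤ 1 / ((k : ℝ) + 1)) ∧
      ∀ y, (∀ i, β i + inner ℝ (ξ i) y ≤ 1 / ((k : ℝ) + 1)) → ‖x‖ ≤ ‖y‖ := fun k => by
    have hcl : IsClosed {x : Q n | ∀ i, β i + inner ℝ (ξ i) x ≤ 1 / ((k : ℝ) + 1)} := by
      simp only [ofPred_forall]
      exact isClosed_iInter fun i => isClosed_le (by fun_prop) continuous_const
    obtain ⟨x, hx, hd⟩ := hcl.exists_infDist_eq_dist (h _ (hη k)) (0 : Q n)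
    refine ⟨x, hx, fun y hy => ?_⟩
    have := infDist_le_dist_of_mem (x := (0 : Q n)) (s := {x : Q n | ∀ i, β i + inner ℝ (ξ i) x ≤ 1 / ((k : ℝ) + 1)}) hy
    rw [hd] at this
    simpa using this
  choose x hx hxmin using hmin
  by_cases hb : ∃ R, ∀ k, ‖x k‖ ≤ R
  · obtain ⟨R, hR⟩ := hb
    obtain ⟨a, -, κ, hκ, ha⟩ := (isCompact_closedBall (0 : Q n) R).tendsto_subseq
      (x := x) fun k => by simpa using hR k
    refine ⟨a, fun i => ?_⟩
    have h1 : Tendsto (fun k => β i + inner ℝ (ξ i) (x (κ k))) atTop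
        (𝓝 (β i + inner ℝ (ξ i) a)) :=
      ((by fun_prop : Continuous fun y : Q n => β i + inner ℝ (ξ i) y).tendsto a).comp ha
    exact le_of_tendsto_of_tendsto' h1
      (tendsto_one_div_add_atTop_nhds_zero_nat.comp hκ.tendsto_atTop) fun k => hx (κ k) i
  · exfalso
    push Not at hb
    choose κ hκ using fun j : ℕ => hb (j + 1)
    let y : ℕ → Q n := fun j => x (κ j)
    have hypos : ∀ j, 0 < ‖y j‖ := fun j => lt_trans (by positivity) (hκ j)
    let d : ℕ → Q n := fun j => ‖y j‖⁻¹ • y j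
    have hyd : ∀ j, y j = ‖y j‖ • d j := fun j => by
      simp only [d, smul_smul, mul_inv_cancel₀ (hypos j).ne', one_smul]
    obtain ⟨e, he, θ, hθ, hlim⟩ := (isCompact_sphere (0 : Q n) 1).tendsto_subseq
      (x := d) fun j => by
        simp [d, norm_smul, inv_mul_cancel₀ (hypos j).ne']
    have he1 : ‖e‖ = 1 := by simpa using he
    have hylim : Tendsto (fun j => ‖y (θ j)‖) atTop atTop := by
      refine tendsto_atTop_mono (fun j => ?_) tendsto_natCast_atTop_atTop
      have h1 : (j : ℝ) ≤ θ j := by exact_mod_cast hθ.id_le j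
      have h2 := hκ (θ j)
      change ((θ j : ℕ) : ℝ) + 1 < ‖y (θ j)‖ at h2
      linarith
    have hin : ∀ ζ : Q n, Tendsto (fun j => inner ℝ ζ (d (θ j))) atTop (𝓝 (inner ℝ ζ e)) :=
      fun ζ => ((by fun_prop : Continuous fun y : Q n => inner ℝ ζ y).tendsto e).comp hlim
    have hval : ∀ i j, β i + ‖y (θ j)‖ * inner ℝ (ξ i) (d (θ j)) ≤ 1 := fun i j => by
      have h1 := hx (κ (θ j)) i
      have h2 : (1 : ℝ) / ((κ (θ j) : ℝ) + 1) ≤ 1 := by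
        rw [div_le_one (by positivity)]; linarith [Nat.cast_nonneg (α := ℝ) (κ (θ j))]
      change β i + inner ℝ (ξ i) (y (θ j)) ≤ _ at h1
      rw [hyd, inner_smul_right] at h1
      exact h1.trans h2
    have hnonpos : ∀ i, inner ℝ (ξ i) e ≤ 0 := fun i => by
      by_contra hpos
      push Not at hpos
      have h1 := (hylim.atTop_mul_pos hpos (hin (ξ i))).eventually_gt_atTop (1 - β i)
      obtain ⟨j, hj⟩ := h1.exists
      linarith [hval i j]
    -- Subtracting the limiting direction `e` preserves admissibility far out: constraints
    -- orthogonal to `e` do not change, and those with negative product with `e` have arbitrarily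
    -- large slack.
    have hev : ∀ᶠ j in atTop, ∀ i, β i + inner ℝ (ξ i) (y (θ j) - e) ≤
        1 / ((κ (θ j) : ℝ) + 1) := by
      rw [eventually_all]
      intro i
      rcases (hnonpos i).eq_or_lt with h0 | hneg
      · refine Eventually.of_forall fun j => ?_
        rw [inner_sub_right, h0, sub_zero]
        exact hx (κ (θ j)) i
      · have h1 := (hylim.atTop_mul_neg hneg (hin (ξ i))).eventually_le_atBot
          (inner ℝ (ξ i) e - β i)
        filter_upwards [h1] with j hj
        rw [inner_sub_right, hyd (θ j), inner_smul_right]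
        linarith [hη (κ (θ j))]
    have hev2 : ∀ᶠ j in atTop, 1 < ‖y (θ j)‖ * inner ℝ e (d (θ j)) := by
      have h1 := hin e
      rw [real_inner_self_eq_norm_sq, he1] at h1
      exact (hylim.atTop_mul_pos (by norm_num) h1).eventually_gt_atTop 1
    obtain ⟨j, hj1, hj2⟩ := (hev.and hev2).exists
    have h1 := hxmin _ _ hj1
    change ‖y (θ j)‖ ≤ _ at h1
    have h2 : ‖y (θ j) - e‖ ^ 2 < ‖y (θ j)‖ ^ 2 := by
      rw [norm_sub_sq_real, he1, real_inner_comm]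
      have h3 : inner ℝ e (y (θ j)) = ‖y (θ j)‖ * inner ℝ e (d (θ j)) := by
        conv_lhs => rw [hyd (θ j), inner_smul_right]
      rw [h3]
      linarith
    exact absurd (pow_le_pow_left₀ (norm_nonneg _) h1 2) (not_le.2 h2)

lemma mem_intrinsicInterior_iff_ball {s : Set (Q n)} {w : Q n} (hw : w ∈ affineSpan ℝ s) :
    w ∈ intrinsicInterior ℝ s ↔ ∃ r > 0, ball w r ∩ affineSpan ℝ s ⊆ s := by
  rw [mem_intrinsicInterior]
  constructor
  · rintro ⟨y, hy, rfl⟩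
    obtain ⟨r, hr, hsub⟩ := Metric.mem_nhds_iff.1 (mem_interior_iff_mem_nhds.1 hy)
    exact ⟨r, hr, fun z hz => hsub (show (⟨z, hz.2⟩ : affineSpan ℝ s) ∈ ball y r from hz.1)⟩
  · rintro ⟨r, hr, hsub⟩
    exact ⟨⟨w, hw⟩, mem_interior_iff_mem_nhds.2 (Metric.mem_nhds_iff.2 ⟨r, hr, fun z hz =>
      hsub ⟨hz, z.2⟩⟩), rfl⟩

/-- A point of a convex set which is not in the relative interior has a supporting functional
which is not constant on the set. -/
lemma exists_supporting_of_notMem_intrinsicInterior {s : Set (Q n)} (hs : Convex ℝ s) {w : Q n}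
    (hw : w ∈ s) (hwi : w ∉ intrinsicInterior ℝ s) :
    ∃ ξ : Q n, (∀ a ∈ s, inner ℝ ξ w ≤ inner ℝ ξ a) ∧ ∃ a ∈ s, inner ℝ ξ w < inner ℝ ξ a := by
  set D := (affineSpan ℝ s).direction with hD
  -- Adding the orthogonal complement of the direction of `s` turns the relative interior into a
  -- genuine interior, so Hahn–Banach separation from an open convex set applies.
  let s' : Set (Q n) := s + (Dᗮ : Set (Q n))
  have hs' : Convex ℝ s' := hs.add Dᗮ.convex
  have hss' : s ⊆ s' := fun a ha => ⟨a, ha, 0, Dᗮ.zero_mem, add_zero a⟩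
  obtain ⟨z, hz⟩ := Set.Nonempty.intrinsicInterior hs ⟨w, hw⟩
  have hzs : z ∈ s := intrinsicInterior_subset hz
  have mem_aff : ∀ {a}, a ∈ s → a ∈ affineSpan ℝ s := fun ha => subset_affineSpan ℝ s ha
  have hinteg : (interior s').Nonempty := by
    obtain ⟨r, hr, hsub⟩ := (mem_intrinsicInterior_iff_ball (mem_aff hzs)).1 hz
    refine ⟨z, mem_interior_iff_mem_nhds.2 (Metric.mem_nhds_iff.2 ⟨r, hr, fun y hy => ?_⟩)⟩
    let d : Q n := D.starProjection (y - z)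
    have hdn : ‖d‖ ≤ ‖y - z‖ := D.norm_starProjection_apply_le (y - z)
    have hdD : d ∈ D := D.starProjection_apply_mem (y - z)
    refine ⟨z + d, hsub ⟨?_, ?_⟩, y - z - d, D.sub_starProjection_mem_orthogonal _, by
      change z + d + (y - z - d) = y
      abel⟩
    · rw [mem_ball, dist_eq_norm] at hy ⊢
      rw [add_sub_cancel_left]
      exact hdn.trans_lt hy
    · have := AffineSubspace.vadd_mem_of_mem_direction hdD (mem_aff hzs)
      rwa [vadd_eq_add, add_comm] at this
  have hwn : w ∉ interior s' := by
    intro hwn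
    apply hwi
    obtain ⟨r, hr, hsub⟩ := Metric.mem_nhds_iff.1 (mem_interior_iff_mem_nhds.1 hwn)
    refine (mem_intrinsicInterior_iff_ball (mem_aff hw)).2 ⟨r, hr, fun y hy => ?_⟩
    obtain ⟨a, ha, e, he, hae⟩ := hsub hy.1
    have heD : e ∈ D := by
      have h1 : y -ᵥ a ∈ D := AffineSubspace.vsub_mem_direction hy.2 (mem_aff ha)
      have h2 : y -ᵥ a = e := by rw [vsub_eq_sub, ← hae]; simp
      rwa [h2] at h1
    have h0 : e = 0 := by
      have := (Submodule.mem_orthogonal D e).1 he e heD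
      simpa using this
    have : a = y := by simpa [h0] using hae
    rwa [← this]
  obtain ⟨f, hf⟩ := geometric_hahn_banach_open_point hs'.interior isOpen_interior hwn
  have hle : ∀ a ∈ s', f a ≤ f w := fun a ha => by
    have h1 : a ∈ closure (interior s') := by
      rw [hs'.closure_interior_eq_closure_of_nonempty_interior hinteg]
      exact subset_closure ha
    exact closure_minimal (fun y hy => (hf y hy).le) (isClosed_le f.continuous continuous_const) h1
  refine ⟨-(InnerProductSpace.toDual ℝ (Q n)).symm f, fun a ha => ?_, ?_⟩
  · simpa using hle a (hss' ha)
  -- A functional constant on `s` vanishes on the direction `D`, and boundedness above on `w + Dᗮ`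
  -- makes it vanish on `Dᗮ`. It would then be zero, which contradicts strict separation from an
  -- interior point.
  · by_contra hcon
    push Not at hcon
    have hconst : ∀ a ∈ s, f a = f w := fun a ha => by
      have h1 := hcon a ha
      simp only [inner_neg_left, InnerProductSpace.toDual_symm_apply] at h1
      exact le_antisymm (hle a (hss' ha)) (by linarith)
    have hfD : ∀ d ∈ D, f d = 0 := by
      intro d hd
      rw [hD, direction_affineSpan, vectorSpan_def] at hd
      refine Submodule.span_induction (p := fun d _ => f d = 0) ?_ (map_zero f) ?_ ?_ hd
      · rintro _ ⟨a, ha, b, hb, rfl⟩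
        simp [hconst a ha, hconst b hb]
      · intro x y _ _ hx hy; simp [hx, hy]
      · intro c x _ hx; simp [hx]
    have hfO : ∀ e ∈ Dᗮ, f e = 0 := by
      intro e he
      have h1 := hle (w + e) ⟨w, hw, e, he, rfl⟩
      have h2 := hle (w + -e) ⟨w, hw, -e, Dᗮ.neg_mem he, rfl⟩
      simp only [map_add, map_neg] at h1 h2
      linarith
    obtain ⟨y, hy⟩ := hinteg
    have h1 := hf y hy
    have h2 : f (y - w) = 0 := by
      rw [← add_sub_cancel (D.starProjection (y - w)) (y - w), map_add,
        hfD _ (D.starProjection_apply_mem _), hfO _ (D.sub_starProjection_mem_orthogonal _), add_zero]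
    rw [map_sub] at h2
    linarith

lemma finite_setOf_norm_intVec_le (R : ℝ) : {k : Fin n → ℤ | ‖intVec k‖ ≤ R}.Finite := by
  refine (Set.finite_Icc (fun _ : Fin n => -⌈R⌉) (fun _ => ⌈R⌉)).subset fun k hk => ?_
  have h : ∀ i, |(k i : ℝ)| ≤ R := fun i =>
    (EuclideanSpace.norm_eq (intVec k) ▸ by
      refine Real.abs_le_sqrt ?_
      have : ‖intVec k i‖ ^ 2 = (k i : ℝ) ^ 2 := by simp [intVec]
      rw [← this]
      exact Finset.single_le_sum (f := fun i => ‖intVec k i‖ ^ 2) (fun j _ => by positivity)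
        (Finset.mem_univ i) : |(k i : ℝ)| ≤ ‖intVec k‖).trans hk
  have h' : ∀ i, |k i| ≤ ⌈R⌉ := fun i => by
    have := (h i).trans (Int.le_ceil R)
    exact_mod_cast this
  exact ⟨fun i => (abs_le.1 (h' i)).1, fun i => (abs_le.1 (h' i)).2⟩

end TropLag
end

noncomputable section

namespace TropLag

open Set Metric Filter Topology MeasureTheory
open scoped NNReal Pointwise

variable {n : ℕ}

/-! ### Tropical polynomials and their strata -/

namespace TropicalPolynomial

variable (φ : TropicalPolynomial n)

lemma eval_le_mono {v : Fin n → ℤ} (hv : v ∈ φ.monomials) (x : Q n) : φ.eval x ≤ φ.mono v x :=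
  Finset.inf'_le _ hv

lemma exists_mem_active (x : Q n) : ∃ v, v ∈ φ.active x := by
  obtain ⟨v, hv, h⟩ := Finset.exists_mem_eq_inf' φ.nonempty (fun v => φ.mono v x)
  exact ⟨v, hv, h.symm⟩

lemma mono_add (v : Fin n → ℤ) (x h : Q n) :
    φ.mono v (x + h) = φ.mono v x + inner ℝ (intVec v) h := by
  simp [mono, inner_add_right, add_assoc]

lemma continuous_mono (v : Fin n → ℤ) : Continuous (φ.mono v) := by
  unfold mono; fun_prop

/-- A bound for the norms of all exponents. -/
def slope : ℝ := 1 + ∑ v ∈ φ.monomials, ‖intVec v‖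

lemma slope_pos : 0 < φ.slope :=
  add_pos_of_pos_of_nonneg one_pos (Finset.sum_nonneg fun _ _ => norm_nonneg _)

lemma norm_intVec_le_slope {v : Fin n → ℤ} (hv : v ∈ φ.monomials) : ‖intVec v‖ ≤ φ.slope := by
  have := Finset.single_le_sum (f := fun v : Fin n → ℤ => ‖intVec v‖)
    (fun _ _ => norm_nonneg _) hv
  unfold slope; linarith

lemma mono_sub_le {v : Fin n → ℤ} (hv : v ∈ φ.monomials) (x y : Q n) :
    φ.mono v x - φ.mono v y ≤ φ.slope * ‖x - y‖ := by
  have h : φ.mono v x - φ.mono v y = inner ℝ (intVec v) (x - y) := by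
    simp [mono, inner_sub_right]
  rw [h]
  exact (real_inner_le_norm _ _).trans
    (mul_le_mul_of_nonneg_right (φ.norm_intVec_le_slope hv) (norm_nonneg _))

lemma eval_sub_le (x y : Q n) : φ.eval x - φ.eval y ≤ φ.slope * ‖x - y‖ := by
  obtain ⟨v, hv, h⟩ := φ.exists_mem_active y
  have := φ.mono_sub_le hv x y
  linarith [φ.eval_le_mono hv x]

lemma continuous_eval : Continuous φ.eval := by
  have : LipschitzWith ⟨φ.slope, φ.slope_pos.le⟩ φ.eval :=
    LipschitzWith.of_le_add_mul _ fun x y => by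
      have := φ.eval_sub_le x y
      rw [dist_eq_norm]
      change φ.eval x ≤ φ.eval y + φ.slope * ‖x - y‖
      linarith
  exact this.continuous

lemma active_finite (q : Q n) : (φ.active q).Finite :=
  φ.monomials.finite_toSet.subset fun _ h => h.1

lemma vertexSet_finite : φ.vertexSet.Finite :=
  φ.monomials.finite_toSet.subset fun _ h => h.1

/-- All monomials which are minimal somewhere in a sufficiently small ball are simultaneously
minimal at some point. -/
lemma exists_radius : ∃ ε₀ > 0, ∀ x : Q n, ∃ q : Q n, ∀ u ∈ φ.monomials,
    (∃ z ∈ closedBall x ε₀, φ.eval z = φ.mono u z) → u ∈ φ.active q := by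
  have key : ∀ S ∈ φ.monomials.powerset, ∀ᶠ η in 𝓝[>] (0 : ℝ), ∀ x : Q n,
      (∀ u ∈ S, ∀ w ∈ φ.monomials, φ.mono u x - φ.mono w x ≤ η) →
      ∃ q, ∀ u ∈ S, u ∈ φ.active q := by
    intro S hS
    -- If the exponents in `S` are nowhere active together, they are nowhere nearly so, with a
    -- uniform gap: otherwise `exists_solution_of_approx` would produce a common point. Only
    -- finitely many `S` occur.
    by_cases hq : ∃ q, ∀ u ∈ S, u ∈ φ.active q
    · exact Eventually.of_forall fun η x _ => hq
    by_cases happ : ∀ η > 0, ∃ x : Q n, ∀ u ∈ S, ∀ w ∈ φ.monomials,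
        φ.mono u x - φ.mono w x ≤ η
    · exfalso
      have heq : ∀ (i : S × φ.monomials) (x : Q n), (φ.coeff i.1 - φ.coeff i.2) +
          inner ℝ (intVec (i.1 : Fin n → ℤ) - intVec (i.2 : Fin n → ℤ)) x =
          φ.mono i.1 x - φ.mono i.2 x := fun i x => by
        simp only [mono, inner_sub_left]; ring
      obtain ⟨q, hq'⟩ := exists_solution_of_approx (ι := S × φ.monomials)
        (fun i => intVec (i.1 : Fin n → ℤ) - intVec (i.2 : Fin n → ℤ))
        (fun i => φ.coeff i.1 - φ.coeff i.2) (fun η hη => by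
          obtain ⟨x, hx⟩ := happ η hη
          exact ⟨x, fun i => by rw [heq]; exact hx i.1 i.1.2 i.2 i.2.2⟩)
      refine hq ⟨q, fun u hu => ⟨Finset.mem_powerset.1 hS hu, ?_⟩⟩
      obtain ⟨w, hw, hwe⟩ := φ.exists_mem_active q
      have h1 := hq' (⟨u, hu⟩, ⟨w, hw⟩)
      rw [heq] at h1
      simp only at h1
      linarith [φ.eval_le_mono (Finset.mem_powerset.1 hS hu) q]
    · push Not at happ
      obtain ⟨η₀, hη₀, h⟩ := happ
      filter_upwards [Ioo_mem_nhdsGT hη₀] with η hη x hx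
      obtain ⟨u, hu, w, hw, hlt⟩ := h x
      linarith [hx u hu w hw, hη.2]
  have hall := (Finset.eventually_all _).2 key
  obtain ⟨η, hη, hpos⟩ := (hall.and self_mem_nhdsWithin).exists
  have hpos : 0 < η := hpos
  have hs := φ.slope_pos
  -- Monomials are `slope`-Lipschitz, so one that is minimal within this distance of `x` exceeds
  -- every other monomial at `x` by at most `η`.
  refine ⟨η / (2 * φ.slope), by positivity, fun x => ?_⟩
  classical
  let S := φ.monomials.filter fun u => ∃ z ∈ closedBall x (η / (2 * φ.slope)), φ.eval z = φ.mono u z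
  obtain ⟨q, hq⟩ := hη S (Finset.mem_powerset.2 (Finset.filter_subset _ _)) x (by
    intro u hu w hw
    obtain ⟨huM, z, hz, hze⟩ := Finset.mem_filter.1 hu
    rw [mem_closedBall, dist_eq_norm] at hz
    have h1 := φ.mono_sub_le huM x z
    have h2 := φ.mono_sub_le hw z x
    have h3 := φ.eval_le_mono hw z
    have h4 : φ.slope * ‖z - x‖ ≤ η / 2 := by
      calc φ.slope * ‖z - x‖ ≤ φ.slope * (η / (2 * φ.slope)) := by gcongr
        _ = η / 2 := by field_simp
    rw [norm_sub_rev] at h1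
    linarith)
  exact ⟨q, fun u hu hz => hq u (Finset.mem_filter.2 ⟨hu, hz⟩)⟩

/-- An active monomial dominates the affine function `φ` near `q` with equality at `q`; testing the
directions `h` and `-h` gives equal linear parts, and the exponent is determined by its linear part.
-/
lemma active_subsingleton_of_notMem_variety {q : Q n} (hq : q ∉ φ.variety) :
    (φ.active q).Subsingleton := by
  simp only [variety, mem_ofPred_eq, not_not] at hq
  obtain ⟨A, hA⟩ := hq
  have key : ∀ u ∈ φ.active q, ∀ h : Q n, inner ℝ (intVec u) h = A.linear h := by
    intro u hu
    have hge : ∀ h : Q n, A.linear h ≤ inner ℝ (intVec u) h := by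
      intro h
      have hlim : Tendsto (fun t : ℝ => q + t • h) (𝓝[>] 0) (𝓝 q) := by
        have : Continuous fun t : ℝ => q + t • h := by fun_prop
        have := this.tendsto 0
        simp only [zero_smul, add_zero] at this
        exact this.mono_left nhdsWithin_le_nhds
      obtain ⟨t, ht, htpos⟩ := ((hlim.eventually hA).and self_mem_nhdsWithin).exists
      have htpos : 0 < t := htpos
      have h1 := φ.eval_le_mono hu.1 (q + t • h)
      rw [ht, φ.mono_add, inner_smul_right, add_comm q, ← vadd_eq_add, A.map_vadd,
        vadd_eq_add, map_smul, smul_eq_mul, hu.2, hA.self_of_nhds] at h1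
      exact le_of_mul_le_mul_left (by linarith) htpos
    intro h
    refine le_antisymm ?_ (hge h)
    have := hge (-h)
    simp only [map_neg, inner_neg_right] at this
    linarith
  intro u hu v hv
  refine intVec_injective (ext_inner_right ℝ fun h => ?_)
  rw [key u hu, key v hv]

/-- Perturbing `q` in the direction `ξ` selects the active exponents that are minimal
on `ξ`. -/
lemma exists_active_eq (q ξ : Q n) (c : ℝ) (hc : ∀ u ∈ φ.active q, c ≤ inner ℝ ξ (intVec u))
    (hne : ∃ u ∈ φ.active q, inner ℝ ξ (intVec u) = c) :
    ∃ q', ∀ u, u ∈ φ.active q' ↔ u ∈ φ.active q ∧ inner ℝ ξ (intVec u) = c := by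
  obtain ⟨u₀, hu₀, hu₀c⟩ := hne
  have hpert : ∀ (u : Fin n → ℤ) (t : ℝ), φ.mono u (q + t • ξ) =
      φ.mono u q + t * inner ℝ ξ (intVec u) := fun u t => by
    rw [φ.mono_add, inner_smul_right, real_inner_comm]
  have hev : ∀ᶠ t in 𝓝[>] (0 : ℝ), ∀ w ∈ φ.monomials, w ∉ φ.active q →
      φ.mono u₀ (q + t • ξ) < φ.mono w (q + t • ξ) := by
    refine (Finset.eventually_all _).2 fun w hw => ?_
    by_cases hwa : w ∈ φ.active q
    · exact Eventually.of_forall fun t h => absurd hwa h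
    · have hlt : φ.mono u₀ (q + (0 : ℝ) • ξ) < φ.mono w (q + (0 : ℝ) • ξ) := by
        rw [zero_smul, add_zero, hu₀.2]
        exact lt_of_le_of_ne (φ.eval_le_mono hw q) fun h => hwa ⟨hw, h.symm⟩
      have c1 : ∀ u : Fin n → ℤ, Continuous fun t : ℝ => φ.mono u (q + t • ξ) := fun u =>
        (φ.continuous_mono u).comp (by fun_prop)
      have := ((c1 u₀).tendsto 0).eventually_lt ((c1 w).tendsto 0) hlt
      exact (this.filter_mono nhdsWithin_le_nhds).mono fun t ht _ => ht
  obtain ⟨t, ht, htpos⟩ := (hev.and self_mem_nhdsWithin).exists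
  have htpos : 0 < t := htpos
  have hmin : ∀ w ∈ φ.monomials, φ.mono u₀ (q + t • ξ) ≤ φ.mono w (q + t • ξ) := by
    intro w hw
    by_cases hwa : w ∈ φ.active q
    · rw [hpert, hpert, hu₀.2, hwa.2, hu₀c]
      have := hc w hwa
      gcongr
    · exact (ht w hw hwa).le
  have heval : φ.eval (q + t • ξ) = φ.mono u₀ (q + t • ξ) :=
    le_antisymm (φ.eval_le_mono hu₀.1 _) (Finset.le_inf' _ _ hmin)
  refine ⟨q + t • ξ, fun u => ⟨fun hu => ?_, fun hu => ⟨hu.1.1, ?_⟩⟩⟩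
  · have hua : u ∈ φ.active q := by
      by_contra hua
      exact absurd (hu.2.trans heval) (ht u hu.1 hua).ne'
    refine ⟨hua, ?_⟩
    have h1 := hu.2.trans heval
    rw [hpert, hpert, hu₀.2, hua.2, hu₀c] at h1
    exact mul_left_cancel₀ htpos.ne' (by linarith)
  · rw [heval, hpert, hpert, hu₀.2, hu.1.2, hu.2, hu₀c]

/-- A probability vector on the exponents, supported on the exponents active at a common point. -/
structure IsWeight (m : (Fin n → ℤ) → ℝ) : Prop where
  nonneg : ∀ u, 0 ≤ m u
  sum_eq : ∑ u ∈ φ.monomials, m u = 1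
  support : ∃ q, ∀ u, m u ≠ 0 → u ∈ φ.active q

/-- The mean of the exponents. -/
def mean (m : (Fin n → ℤ) → ℝ) : Q n := ∑ u ∈ φ.monomials, m u • intVec u

variable {φ}

/-- If there are no self-intersections, then a mean of exponents active at a common point is
a lattice point only if it is concentrated there. -/
lemma IsWeight.eq_one_of_mean_eq (hφ : φ.HasNoSelfIntersections) {m : (Fin n → ℤ) → ℝ}
    (hm : φ.IsWeight m) {w : Fin n → ℤ} (hw : φ.mean m = intVec w) :
    w ∈ φ.monomials ∧ m w = 1 := by
  obtain ⟨q₀, hq₀⟩ := hm.support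
  -- Take `q` with the fewest active exponents among points whose active set contains the support of
  -- `m`. The support then cannot lie in a proper face of the dual stratum, since moving `q` would
  -- discard exponents.
  have hex : ∃ N, ∃ q, (∀ u, m u ≠ 0 → u ∈ φ.active q) ∧ (φ.active q).ncard = N := ⟨_, q₀, hq₀, rfl⟩
  classical
  obtain ⟨q, hq, hqN⟩ := Nat.find_spec hex
  have hmin : ∀ q', (∀ u, m u ≠ 0 → u ∈ φ.active q') → (φ.active q).ncard ≤ (φ.active q').ncard :=
    fun q' hq' => by rw [hqN]; exact Nat.find_min' hex ⟨q', hq', rfl⟩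
  have hmean : φ.mean m ∈ φ.dualStratum q := by
    have h1 : φ.mean m = ∑ u ∈ φ.monomials.filter (fun u => m u ≠ 0), m u • intVec u := by
      rw [Finset.sum_filter_of_ne]
      · rfl
      · intro u _ h h0; exact h (by rw [h0, zero_smul])
    rw [h1]
    refine (convex_convexHull ℝ _).sum_mem (fun u _ => hm.nonneg u) ?_ fun u hu =>
      subset_convexHull ℝ _ (mem_image_of_mem _ (hq u (Finset.mem_filter.1 hu).2))
    rw [Finset.sum_filter_of_ne (fun u _ h => h), hm.sum_eq]
  by_cases hqV : q ∈ φ.variety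
  · exfalso
    have hnum := hφ q hqV
    -- An infinite set also has `ncard` zero, so finiteness is needed to read the hypothesis as
    -- emptiness.
    have hfin : {w : Fin n → ℤ | intVec w ∈ intrinsicInterior ℝ (φ.dualStratum q)}.Finite := by
      refine (finite_setOf_norm_intVec_le φ.slope).subset fun k hk => ?_
      have h1 : intVec k ∈ φ.dualStratum q := intrinsicInterior_subset hk
      have h2 : φ.dualStratum q ⊆ closedBall 0 φ.slope := by
        refine convexHull_min ?_ (convex_closedBall _ _)
        rintro _ ⟨u, hu, rfl⟩
        simpa using φ.norm_intVec_le_slope hu.1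
      simpa using h2 h1
    rw [selfIntersectionNumber, Set.ncard_eq_zero hfin] at hnum
    have hnot : φ.mean m ∉ intrinsicInterior ℝ (φ.dualStratum q) := by
      rw [hw]
      exact fun h => (hnum ▸ (show w ∈ {w : Fin n → ℤ | _} from h) : w ∈ (∅ : Set (Fin n → ℤ)))
    -- Since `ξ` attains its minimum on the stratum at the mean, all weights sit on the face where
    -- `ξ` is minimal. Perturbing `q` along `ξ` leaves exactly that face active, so by minimality it
    -- is the whole stratum, although `ξ` is not constant there.
    obtain ⟨ξ, hξ, a, ha, hlt⟩ := exists_supporting_of_notMem_intrinsicInterior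
      (convex_convexHull ℝ _) hmean hnot
    have hξu : ∀ u ∈ φ.active q, inner ℝ ξ (φ.mean m) ≤ inner ℝ ξ (intVec u) := fun u hu =>
      hξ _ (subset_convexHull ℝ _ (mem_image_of_mem _ hu))
    have hsum : ∑ u ∈ φ.monomials, m u * (inner ℝ ξ (intVec u) - inner ℝ ξ (φ.mean m)) = 0 := by
      simp only [mul_sub, Finset.sum_sub_distrib, ← Finset.sum_mul, hm.sum_eq, one_mul]
      rw [mean, inner_sum]
      simp [inner_smul_right]
    have hterm : ∀ u, m u ≠ 0 → inner ℝ ξ (intVec u) = inner ℝ ξ (φ.mean m) := by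
      intro u hu
      have h1 := (Finset.sum_eq_zero_iff_of_nonneg (fun u _ => by
        by_cases h0 : m u = 0
        · rw [h0, zero_mul]
        · exact mul_nonneg (hm.nonneg u) (sub_nonneg.2 (hξu u (hq u h0))))).1 hsum u (hq u hu).1
      rcases mul_eq_zero.1 h1 with h | h
      · exact absurd h hu
      · linarith
    have hexu : ∃ u, m u ≠ 0 := by
      by_contra h
      push Not at h
      have := hm.sum_eq
      simp [h] at this
    obtain ⟨u₀, hu₀⟩ := hexu
    obtain ⟨q', hq'⟩ := φ.exists_active_eq q ξ _ hξu ⟨u₀, hq u₀ hu₀, hterm u₀ hu₀⟩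
    have hle := hmin q' fun u hu => (hq' u).2 ⟨hq u hu, hterm u hu⟩
    have hsub : φ.active q' ⊆ φ.active q := fun u hu => ((hq' u).1 hu).1
    have heq : φ.active q' = φ.active q := Set.eq_of_subset_of_ncard_le hsub hle (φ.active_finite q)
    have hcon : φ.dualStratum q ⊆ {y | inner ℝ ξ y = inner ℝ ξ (φ.mean m)} := by
      refine convexHull_min ?_ ?_
      · rintro _ ⟨u, hu, rfl⟩
        exact ((hq' u).1 (heq ▸ hu)).2
      · exact convex_hyperplane (f := fun y => inner ℝ ξ y)
          ⟨fun x y => inner_add_right ξ x y, fun c x => inner_smul_right ξ x c⟩ _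
    exact hlt.ne' (hcon ha)
  · have hsub := φ.active_subsingleton_of_notMem_variety hqV
    obtain ⟨u, hu⟩ := φ.exists_mem_active q
    have h0 : ∀ u' ∈ φ.monomials, u' ≠ u → m u' = 0 := fun u' _ hne => by
      by_contra h
      exact hne (hsub (hq u' h) hu)
    have h1 : m u = 1 := by
      rw [← hm.sum_eq, Finset.sum_eq_single_of_mem u hu.1 h0]
    have h2 : φ.mean m = intVec u := by
      rw [mean, Finset.sum_eq_single_of_mem u hu.1, h1, one_smul]
      intro u' hu' hne
      rw [h0 u' hu' hne, zero_smul]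
    have : u = w := intVec_injective (h2 ▸ hw)
    exact this ▸ ⟨hu.1, h1⟩

variable (φ)

lemma norm_mean_le {m : (Fin n → ℤ) → ℝ} (hm : φ.IsWeight m) : ‖φ.mean m‖ ≤ φ.slope := by
  calc ‖φ.mean m‖ ≤ ∑ u ∈ φ.monomials, ‖m u • intVec u‖ := norm_sum_le _ _
    _ ≤ ∑ u ∈ φ.monomials, m u * φ.slope := Finset.sum_le_sum fun u hu => by
        rw [norm_smul, Real.norm_of_nonneg (hm.nonneg u)]
        exact mul_le_mul_of_nonneg_left (φ.norm_intVec_le_slope hu) (hm.nonneg u)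
    _ = φ.slope := by rw [← Finset.sum_mul, hm.sum_eq, one_mul]

/-- Quantitative version of `IsWeight.eq_one_of_mean_eq`. -/
lemma exists_lattice_separation (hφ : φ.HasNoSelfIntersections) {η : ℝ} (hη : 0 < η) :
    ∃ δ > 0, ∀ m, φ.IsWeight m → ∀ k : Fin n → ℤ, ‖φ.mean m - intVec k‖ < δ → 1 - η < m k := by
  classical
  -- Means have norm at most `slope` and `δ` will be below one, so only finitely many lattice points
  -- and supports have to be treated.
  let F : Set ((Fin n → ℤ) × Finset (Fin n → ℤ)) :=
    {k | ‖intVec k‖ ≤ φ.slope + 1} ×ˢ (φ.monomials.powerset : Set (Finset (Fin n → ℤ)))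
  have hF : F.Finite := (finite_setOf_norm_intVec_le _).prod (Finset.finite_toSet _)
  have key : ∀ i ∈ F, ∀ᶠ δ in 𝓝[>] (0 : ℝ), ∀ m, φ.IsWeight m → (∀ u, m u ≠ 0 → u ∈ i.2) →
      (∃ q, ∀ u ∈ i.2, u ∈ φ.active q) → ‖φ.mean m - intVec i.1‖ < δ → 1 - η < m i.1 := by
    rintro ⟨k, S⟩ -
    by_cases hS : ∃ q, ∀ u ∈ S, u ∈ φ.active q
    swap
    · exact Eventually.of_forall fun δ m _ _ h => absurd h hS
    let T : Set ((Fin n → ℤ) → ℝ) := {m | m ∈ Set.univ.pi (fun _ : Fin n → ℤ => Icc (0 : ℝ) 1) ∧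
      (∀ u, u ∉ S → m u = 0) ∧ ∑ u ∈ φ.monomials, m u = 1 ∧ m k ≤ 1 - η}
    have hT : IsCompact T := by
      have h1 : IsCompact (Set.univ.pi (fun _ : Fin n → ℤ => Icc (0 : ℝ) 1)) :=
        isCompact_univ_pi fun _ => isCompact_Icc
      refine h1.inter_right ?_
      refine IsClosed.inter ?_ (IsClosed.inter ?_ ?_)
      · have : {m : (Fin n → ℤ) → ℝ | ∀ u, u ∉ S → m u = 0} =
            ⋂ u, ⋂ (_ : u ∉ S), {m | m u = 0} := by ext; simp
        change IsClosed {m : (Fin n → ℤ) → ℝ | ∀ u, u ∉ S → m u = 0}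
        rw [this]
        exact isClosed_iInter fun u => isClosed_iInter fun _ =>
          isClosed_eq (continuous_apply u) continuous_const
      · exact isClosed_eq (continuous_finsetSum _ fun u _ => continuous_apply u) continuous_const
      · exact isClosed_le (continuous_apply k) continuous_const
    have hTW : ∀ m ∈ T, φ.IsWeight m := fun m hm =>
      ⟨fun u => (hm.1 u trivial).1, hm.2.2.1, hS.imp fun q hq u hu =>
        hq u (by by_contra h; exact hu (hm.2.1 u h))⟩
    have hcont : Continuous fun m : (Fin n → ℤ) → ℝ => ‖φ.mean m - intVec k‖ := by
      unfold mean
      exact ((continuous_finsetSum _ fun u _ =>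
        (continuous_apply u).smul continuous_const).sub continuous_const).norm
    have hle1 : ∀ m, φ.IsWeight m → (∀ u, m u ≠ 0 → u ∈ S) → m k ≤ 1 - η → m ∈ T := by
      intro m hm hmS hk
      refine ⟨fun u _ => ⟨hm.nonneg u, ?_⟩, fun u hu => ?_, hm.sum_eq, hk⟩
      · by_cases hu : u ∈ φ.monomials
        · rw [← hm.sum_eq]
          exact Finset.single_le_sum (fun u _ => hm.nonneg u) hu
        · obtain ⟨q, hq⟩ := hm.support
          have : m u = 0 := by by_contra h; exact hu (hq u h).1
          rw [this]; exact zero_le_one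
      · by_contra h; exact hu (hmS u h)
    rcases T.eq_empty_or_nonempty with hTe | hTne
    · refine Eventually.of_forall fun δ m hm hmS _ _ => ?_
      by_contra hcon
      have := hle1 m hm hmS (not_lt.1 hcon)
      rw [hTe] at this
      exact this
    · obtain ⟨m₀, hm₀, hm₀min⟩ := hT.exists_isMinOn hTne hcont.continuousOn
      have hpos : 0 < ‖φ.mean m₀ - intVec k‖ := by
        rw [norm_pos_iff, sub_ne_zero]
        intro h
        have h1 := ((hTW m₀ hm₀).eq_one_of_mean_eq hφ h).2
        have h2 := hm₀.2.2.2
        linarith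
      filter_upwards [Ioo_mem_nhdsGT hpos] with δ hδ m hm hmS _ hlt
      by_contra hcon
      have h1 : ‖φ.mean m₀ - intVec k‖ ≤ ‖φ.mean m - intVec k‖ :=
        hm₀min (hle1 m hm hmS (not_lt.1 hcon))
      linarith [hδ.2]
  have hall := (hF.eventually_all).2 key
  obtain ⟨δ, ⟨hδ, hpos⟩, hδ1⟩ := ((hall.and self_mem_nhdsWithin).and
    (Ioo_mem_nhdsGT (zero_lt_one' ℝ))).exists
  refine ⟨δ, hpos, fun m hm k hk => ?_⟩
  obtain ⟨q, hq⟩ := hm.support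
  refine hδ (k, φ.monomials.filter fun u => m u ≠ 0) ⟨?_, ?_⟩ m hm (fun u hu => ?_)
    ⟨q, fun u hu => hq u (Finset.mem_filter.1 hu).2⟩ hk
  · have h1 := φ.norm_mean_le hm
    have h2 : ‖intVec k‖ ≤ ‖φ.mean m‖ + ‖φ.mean m - intVec k‖ := by
      have := norm_sub_le (φ.mean m) (φ.mean m - intVec k)
      simpa using this
    change ‖intVec k‖ ≤ φ.slope + 1
    linarith [hδ1.2]
  · exact Finset.mem_coe.2 (Finset.mem_powerset.2 (Finset.filter_subset _ _))
  · exact Finset.mem_filter.2 ⟨(hq u hu).1, hu⟩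

end TropicalPolynomial

end TropLag
end

noncomputable section

namespace TropLag

open Set Metric Filter Topology MeasureTheory
open scoped NNReal Pointwise

variable {n : ℕ}

/-! ### Smoothings -/

/-- A symmetric mollifier supported in the ball of radius `ε`. -/
structure IsMollifier (ρ : Q n → ℝ) (ε : ℝ) : Prop where
  smooth : ContDiff ℝ ∞ ρ
  nonneg : ∀ x, 0 ≤ ρ x
  symm : ∀ x, ρ (-x) = ρ x
  integral_eq : ∫ x, ρ x = 1
  norm_le : ∀ x, ρ x ≠ 0 → ‖x‖ ≤ ε

lemma SmoothingKernel.isMollifier {ε : ℝ} (ρ : SmoothingKernel n ε) : IsMollifier ρ.toFun ε :=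
  ⟨ρ.smooth, ρ.nonneg, ρ.symm, ρ.integral_eq_one, fun x hx => by
    have : x ∈ tsupport ρ.toFun := subset_tsupport _ hx
    rw [ρ.support_eq] at this
    simpa using this⟩

namespace IsMollifier

variable {ρ : Q n → ℝ} {ε : ℝ}

lemma mono_radius (h : IsMollifier ρ ε) {ε' : ℝ} (hle : ε ≤ ε') : IsMollifier ρ ε' :=
  ⟨h.smooth, h.nonneg, h.symm, h.integral_eq, fun x hx => (h.norm_le x hx).trans hle⟩

lemma hasCompactSupport (h : IsMollifier ρ ε) : HasCompactSupport ρ :=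
  HasCompactSupport.intro (isCompact_closedBall (0 : Q n) ε) fun x hx => by
    by_contra h0
    exact hx (by simpa using h.norm_le x h0)

lemma integrable (h : IsMollifier ρ ε) : Integrable ρ := h.smooth.continuous.integrable_of_hasCompactSupport
  h.hasCompactSupport

lemma integrable_mul (h : IsMollifier ρ ε) {F : Q n → ℝ} (hF : Continuous F) : Integrable fun y => ρ y * F y :=
  (h.smooth.continuous.mul hF).integrable_of_hasCompactSupport h.hasCompactSupport.mul_right

lemma convexComb (h : IsMollifier ρ ε) {ρ' : Q n → ℝ} (h' : IsMollifier ρ' ε) {σ : ℝ} (hσ : σ ∈ Icc (0 : ℝ) 1) :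
    IsMollifier (fun x => (1 - σ) * ρ x + σ * ρ' x) ε where
  smooth := (contDiff_const.mul h.smooth).add (contDiff_const.mul h'.smooth)
  nonneg x := add_nonneg (mul_nonneg (by linarith [hσ.2]) (h.nonneg x))
    (mul_nonneg hσ.1 (h'.nonneg x))
  symm x := by rw [h.symm, h'.symm]
  integral_eq := by
    rw [integral_add (h.integrable.const_mul _) (h'.integrable.const_mul _),
      integral_const_mul, integral_const_mul, h.integral_eq, h'.integral_eq]
    ring
  norm_le x hx := by
    by_cases h0 : ρ x = 0
    · refine h'.norm_le x fun h0' => hx ?_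
      rw [h0, h0']; ring
    · exact h.norm_le x h0

lemma integral_mul_inner (h : IsMollifier ρ ε) (v : Q n) : ∫ y, ρ y * inner ℝ v y = 0 := by
  have h1 := integral_neg_eq_self (fun y => ρ y * inner ℝ v y) volume
  simp only [h.symm, inner_neg_right, mul_neg, integral_neg] at h1
  linarith

end IsMollifier

namespace TropicalPolynomial

variable (φ : TropicalPolynomial n)

/-- The convolution of `φ` with `ρ`. -/
def mollify (ρ : Q n → ℝ) (x : Q n) : ℝ := ∫ y, ρ y * φ.eval (x - y)

lemma smoothing_eq_mollify {ε : ℝ} (ρ : SmoothingKernel n ε) :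
    φ.smoothing ρ = φ.mollify ρ.toFun := rfl

/-- Indicator function of the locus where the monomial `u` is minimal. -/
def cell (u : Fin n → ℤ) : Q n → ℝ := Set.indicator {z | φ.eval z = φ.mono u z} 1

/-- The fraction of the minimal monomials at a point that are equal to `u`. -/
def share (u : Fin n → ℤ) (z : Q n) : ℝ :=
  if u ∈ φ.monomials then φ.cell u z / ∑ w ∈ φ.monomials, φ.cell w z else 0

lemma cell_nonneg (u : Fin n → ℤ) (z : Q n) : 0 ≤ φ.cell u z :=
  Set.indicator_nonneg (fun _ _ => zero_le_one) z

lemma sum_cell_pos (z : Q n) : 0 < ∑ w ∈ φ.monomials, φ.cell w z := by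
  obtain ⟨v, hv, h⟩ := φ.exists_mem_active z
  have h1 : φ.cell v z = 1 := Set.indicator_of_mem (show z ∈ {z | _} from h.symm) 1
  have := Finset.single_le_sum (f := fun w => φ.cell w z) (fun w _ => φ.cell_nonneg w z) hv
  rw [h1] at this
  linarith

lemma share_nonneg (u : Fin n → ℤ) (z : Q n) : 0 ≤ φ.share u z := by
  unfold share
  split_ifs
  · exact div_nonneg (φ.cell_nonneg u z) (φ.sum_cell_pos z).le
  · exact le_rfl

lemma sum_share (z : Q n) : ∑ u ∈ φ.monomials, φ.share u z = 1 := by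
  have : ∀ u ∈ φ.monomials, φ.share u z = φ.cell u z / ∑ w ∈ φ.monomials, φ.cell w z :=
    fun u hu => if_pos hu
  rw [Finset.sum_congr rfl this, ← Finset.sum_div, div_self (φ.sum_cell_pos z).ne']

lemma share_le_one (u : Fin n → ℤ) (z : Q n) : φ.share u z ≤ 1 := by
  by_cases hu : u ∈ φ.monomials
  · rw [← φ.sum_share z]
    exact Finset.single_le_sum (f := fun w => φ.share w z) (fun w _ => φ.share_nonneg w z) hu
  · simp [share, hu]

lemma eval_eq_of_share_ne_zero {u : Fin n → ℤ} {z : Q n} (h : φ.share u z ≠ 0) :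
    u ∈ φ.monomials ∧ φ.eval z = φ.mono u z := by
  unfold share at h
  split_ifs at h with hu
  · refine ⟨hu, ?_⟩
    by_contra hne
    exact h (by rw [cell, Set.indicator_of_notMem (s := {z | φ.eval z = φ.mono u z}) (fun h => hne h), zero_div])
  · exact absurd rfl h

lemma measurable_share (u : Fin n → ℤ) : Measurable (φ.share u) := by
  have h1 : ∀ w, Measurable (φ.cell w) := fun w =>
    measurable_one.indicator (isClosed_eq φ.continuous_eval (φ.continuous_mono w)).measurableSet
  unfold share
  split_ifs
  · exact (h1 u).div (Finset.measurable_sum _ fun w _ => h1 w)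
  · exact measurable_const

/-- The `ρ`-mass near `x` of the locus where `u` is minimal. -/
def mass (ρ : Q n → ℝ) (x : Q n) (u : Fin n → ℤ) : ℝ := ∫ y, ρ y * φ.share u (x - y)

variable {ρ : Q n → ℝ} {ε : ℝ}

lemma integrable_share (hρ : IsMollifier ρ ε) (x : Q n) (u : Fin n → ℤ) :
    Integrable fun y => ρ y * φ.share u (x - y) := by
  refine hρ.integrable.mul_bdd (c := 1)
    ((φ.measurable_share u).comp (measurable_const.sub measurable_id)).aestronglyMeasurable
    (ae_of_all _ fun y => ?_)
  rw [Real.norm_of_nonneg (φ.share_nonneg _ _)]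
  exact φ.share_le_one _ _

lemma mass_nonneg (hρ : IsMollifier ρ ε) (x : Q n) (u : Fin n → ℤ) : 0 ≤ φ.mass ρ x u :=
  integral_nonneg fun y => mul_nonneg (hρ.nonneg y) (φ.share_nonneg _ _)

lemma sum_mass (hρ : IsMollifier ρ ε) (x : Q n) : ∑ u ∈ φ.monomials, φ.mass ρ x u = 1 := by
  unfold mass
  rw [← integral_finsetSum _ fun u _ => φ.integrable_share hρ x u]
  simp_rw [← Finset.mul_sum, φ.sum_share, mul_one]
  exact hρ.integral_eq

lemma exists_of_mass_ne_zero (hρ : IsMollifier ρ ε) {x : Q n} {u : Fin n → ℤ} (h : φ.mass ρ x u ≠ 0) :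
    u ∈ φ.monomials ∧ ∃ z ∈ closedBall x ε, φ.eval z = φ.mono u z := by
  obtain ⟨y, hy⟩ : ∃ y, ρ y * φ.share u (x - y) ≠ 0 := by
    by_contra hcon
    push Not at hcon
    exact h (by simp [mass, hcon])
  obtain ⟨hu, he⟩ := φ.eval_eq_of_share_ne_zero (right_ne_zero_of_mul hy)
  refine ⟨hu, x - y, ?_, he⟩
  simpa using hρ.norm_le y (left_ne_zero_of_mul hy)

/-- A cell is closed and convex. If its interior is empty, it equals its frontier, which is a null
set, and so it carries no mass. -/
lemma mem_vertexSet_of_mass_ne_zero (hρ : IsMollifier ρ ε) {x : Q n} {u : Fin n → ℤ} (h : φ.mass ρ x u ≠ 0) :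
    u ∈ φ.vertexSet := by
  refine ⟨(φ.exists_of_mass_ne_zero hρ h).1, interior {z | φ.eval z = φ.mono u z},
    isOpen_interior, ?_, fun z hz =>
      interior_subset (s := {z | φ.eval z = φ.mono u z}) hz⟩
  by_contra hne
  rw [not_nonempty_iff_eq_empty] at hne
  have hu := (φ.exists_of_mass_ne_zero hρ h).1
  have hcl : IsClosed {z | φ.eval z = φ.mono u z} := isClosed_eq φ.continuous_eval (φ.continuous_mono u)
  have hconv : Convex ℝ {z | φ.eval z = φ.mono u z} := by
    have : {z | φ.eval z = φ.mono u z} =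
        ⋂ w ∈ φ.monomials, {z | φ.mono u z ≤ φ.mono w z} := by
      ext z
      simp only [mem_ofPred_eq, mem_iInter]
      exact ⟨fun hz w hw => hz ▸ φ.eval_le_mono hw z,
        fun hz => le_antisymm (φ.eval_le_mono hu z) (Finset.le_inf' _ _ hz)⟩
    rw [this]
    refine convex_iInter₂ fun w _ => ?_
    have hset : {z | φ.mono u z ≤ φ.mono w z} =
        {z | inner ℝ (intVec u - intVec w) z ≤ φ.coeff w - φ.coeff u} := by
      ext z
      simp only [mem_ofPred_eq, mono, inner_sub_left]
      constructor <;> intro h <;> linarith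
    rw [hset]
    exact convex_halfSpace_le (f := fun z => inner ℝ (intVec u - intVec w) z)
      ⟨fun x y => inner_add_right _ x y, fun c x => inner_smul_right _ x c⟩ _
  have h0 : volume {z | φ.eval z = φ.mono u z} = 0 := by
    have := hconv.addHaar_frontier volume
    rwa [hcl.frontier_eq, hne, sdiff_empty] at this
  apply h
  refine integral_eq_zero_of_ae ?_
  have h1 : volume ((fun y => x - y) ⁻¹' {z | φ.eval z = φ.mono u z}) = 0 := by
    rw [(Measure.measurePreserving_sub_left volume x).measure_preimage hcl.measurableSet.nullMeasurableSet, h0]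
  have h2 : ∀ᵐ y, y ∉ (fun y => x - y) ⁻¹' {z | φ.eval z = φ.mono u z} := measure_eq_zero_iff_ae_notMem.1 h1
  filter_upwards [h2] with y hy
  by_contra hne'
  exact hy (φ.eval_eq_of_share_ne_zero (right_ne_zero_of_mul hne')).2

lemma integrable_eval (hρ : IsMollifier ρ ε) (x : Q n) : Integrable fun y => ρ y * φ.eval (x - y) :=
  hρ.integrable_mul (φ.continuous_eval.comp (by fun_prop))

lemma contDiff_mollify (hρ : IsMollifier ρ ε) : ContDiff ℝ ∞ (φ.mollify ρ) := by
  have := hρ.hasCompactSupport.contDiff_convolution_left (ContinuousLinearMap.lsmul ℝ ℝ)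
    (μ := volume) (n := ⊤) hρ.smooth φ.continuous_eval.locallyIntegrable
  exact this

/-- At each point the mean of the minimal exponents weighted by their shares is a supergradient of
the concave function `φ`. Averaging against `ρ` gives a supergradient of the mollification without
differentiating `φ`. -/
lemma mollify_add_le (hρ : IsMollifier ρ ε) (x k : Q n) :
    φ.mollify ρ (x + k) ≤ φ.mollify ρ x + inner ℝ (φ.mean (φ.mass ρ x)) k := by
  have h1 : inner ℝ (φ.mean (φ.mass ρ x)) k =
      ∫ y, ∑ u ∈ φ.monomials, (ρ y * φ.share u (x - y)) * inner ℝ (intVec u) k := by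
    rw [integral_finsetSum _ fun u _ => (φ.integrable_share hρ x u).mul_const _, mean, sum_inner]
    simp_rw [integral_mul_const, inner_smul_left]
    rfl
  have hinteg : Integrable fun y =>
      ∑ u ∈ φ.monomials, (ρ y * φ.share u (x - y)) * inner ℝ (intVec u) k :=
    integrable_finsetSum _ fun u _ => (φ.integrable_share hρ x u).mul_const _
  rw [h1, mollify, mollify, ← integral_add (φ.integrable_eval hρ x) hinteg]
  refine integral_mono (φ.integrable_eval hρ _) ((φ.integrable_eval hρ x).add hinteg) fun y => ?_
  have h2 : φ.eval (x + k - y) ≤ φ.eval (x - y) +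
      ∑ u ∈ φ.monomials, φ.share u (x - y) * inner ℝ (intVec u) k := by
    calc φ.eval (x + k - y) = ∑ u ∈ φ.monomials, φ.share u (x - y) * φ.eval (x + k - y) := by
          rw [← Finset.sum_mul, φ.sum_share, one_mul]
      _ ≤ ∑ u ∈ φ.monomials, φ.share u (x - y) * (φ.eval (x - y) + inner ℝ (intVec u) k) := by
          refine Finset.sum_le_sum fun u hu => ?_
          by_cases h0 : φ.share u (x - y) = 0
          · simp [h0]
          · refine mul_le_mul_of_nonneg_left ?_ (φ.share_nonneg _ _)
            rw [(φ.eval_eq_of_share_ne_zero h0).2, ← φ.mono_add, sub_add_eq_add_sub]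
            exact φ.eval_le_mono hu _
      _ = _ := by simp_rw [mul_add, Finset.sum_add_distrib, ← Finset.sum_mul, φ.sum_share, one_mul]
  have h3 := mul_le_mul_of_nonneg_left h2 (hρ.nonneg y)
  simp only [mul_add, Finset.mul_sum, ← mul_assoc] at h3
  exact h3

/-- By `mollify_add_le`, the linear function given by the mean minus the mollification is minimal at
`x`; its differential therefore vanishes there. -/
lemma gradient_mollify (hρ : IsMollifier ρ ε) (x : Q n) : gradient (φ.mollify ρ) x = φ.mean (φ.mass ρ x) := by
  have hd : DifferentiableAt ℝ (φ.mollify ρ) x :=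
    (φ.contDiff_mollify hρ).differentiable (by simp) x
  have hmin : IsLocalMin (fun z => inner ℝ (φ.mean (φ.mass ρ x)) z - φ.mollify ρ z) x := by
    refine Eventually.of_forall fun z => ?_
    have := φ.mollify_add_le hρ x (z - x)
    rw [add_sub_cancel, inner_sub_right] at this
    simp only
    linarith
  have hfd : HasFDerivAt (fun z => inner ℝ (φ.mean (φ.mass ρ x)) z - φ.mollify ρ z)
      (innerSL ℝ (φ.mean (φ.mass ρ x)) - fderiv ℝ (φ.mollify ρ) x) x :=
    (innerSL ℝ (φ.mean (φ.mass ρ x))).hasFDerivAt.sub hd.hasFDerivAt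
  have h0 := hmin.hasFDerivAt_eq_zero hfd
  rw [sub_eq_zero] at h0
  refine ext_inner_right ℝ fun k => ?_
  rw [gradient, InnerProductSpace.toDual_symm_apply, ← h0]
  rfl

/-- A symmetric kernel reproduces affine functions. The primitive thus becomes the integral of a
quantity which is nonnegative for exponents of `φ`. -/
lemma mono_sub_mollify (hρ : IsMollifier ρ ε) (v : Fin n → ℤ) (x : Q n) :
    φ.mono v x - φ.mollify ρ x = ∫ y, ρ y * (φ.mono v (x - y) - φ.eval (x - y)) := by
  have h1 : ∫ y, ρ y * φ.mono v (x - y) = φ.mono v x := by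
    have : ∀ y, ρ y * φ.mono v (x - y) = φ.mono v x * ρ y - ρ y * inner ℝ (intVec v) y := fun y => by
      rw [sub_eq_add_neg, φ.mono_add, inner_neg_right]; ring
    simp_rw [this]
    rw [integral_sub (hρ.integrable.const_mul _) (hρ.integrable_mul (by fun_prop)),
      integral_const_mul, hρ.integral_eq, hρ.integral_mul_inner]
    ring
  have hi : Integrable fun y => ρ y * φ.mono v (x - y) :=
    hρ.integrable_mul ((φ.continuous_mono v).comp (by fun_prop))
  simp_rw [mul_sub]
  rw [integral_sub hi (φ.integrable_eval hρ x), h1, mollify]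

/-- The gap `φ.mono w - φ.eval` vanishes where `w` is minimal. Nonzero mass puts such a point within
`ε` of `x`, so on the support of the kernel the gap is at most `2 * slope` times a distance `2 ε`.
-/
lemma mono_sub_mollify_le (hρ : IsMollifier ρ ε) {w : Fin n → ℤ} {x : Q n} (hw : φ.mass ρ x w ≠ 0) :
    φ.mono w x - φ.mollify ρ x ≤ 4 * φ.slope * ε * (1 - φ.mass ρ x w) := by
  obtain ⟨hwM, z₀, hz₀, he₀⟩ := φ.exists_of_mass_ne_zero hρ hw
  have hε : 0 ≤ ε := dist_nonneg.trans (mem_closedBall.1 hz₀)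
  have hC : 0 ≤ 4 * φ.slope * ε := by have := φ.slope_pos; positivity
  rw [φ.mono_sub_mollify hρ]
  have h1 : 4 * φ.slope * ε * (1 - φ.mass ρ x w) =
      ∫ y, ρ y * (4 * φ.slope * ε * (1 - φ.share w (x - y))) := by
    have : ∀ y, ρ y * (4 * φ.slope * ε * (1 - φ.share w (x - y))) =
      4 * φ.slope * ε * ρ y - 4 * φ.slope * ε * (ρ y * φ.share w (x - y)) := fun y => by ring
    simp_rw [this]
    rw [integral_sub (hρ.integrable.const_mul _) ((φ.integrable_share hρ x w).const_mul _),
      integral_const_mul, integral_const_mul, hρ.integral_eq, mass]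
    ring
  have hi : Integrable fun y => ρ y * (4 * φ.slope * ε * (1 - φ.share w (x - y))) := by
    have := (hρ.integrable.const_mul (4 * φ.slope * ε)).sub
      ((φ.integrable_share hρ x w).const_mul (4 * φ.slope * ε))
    refine this.congr (ae_of_all _ fun y => ?_)
    simp only [Pi.sub_apply]
    ring
  rw [h1]
  refine integral_mono (hρ.integrable_mul
    (((φ.continuous_mono w).comp (by fun_prop)).sub (φ.continuous_eval.comp (by fun_prop)))) hi
    fun y => ?_
  by_cases h0 : ρ y = 0
  · simp [h0]
  refine mul_le_mul_of_nonneg_left ?_ (hρ.nonneg y)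
  by_cases hs : φ.share w (x - y) = 0
  · rw [hs, sub_zero, mul_one]
    have a1 := φ.mono_sub_le hwM (x - y) z₀
    have a2 := φ.eval_sub_le z₀ (x - y)
    have a3 : ‖x - y - z₀‖ ≤ 2 * ε := by
      have e1 := hρ.norm_le y h0
      have e2 : ‖z₀ - x‖ ≤ ε := by rwa [mem_closedBall, dist_eq_norm] at hz₀
      have e3 : x - y - z₀ = -(y + (z₀ - x)) := by abel
      rw [e3, norm_neg]
      exact (norm_add_le _ _).trans (by linarith)
    have a4 : φ.slope * ‖x - y - z₀‖ ≤ φ.slope * (2 * ε) :=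
      mul_le_mul_of_nonneg_left a3 φ.slope_pos.le
    rw [norm_sub_rev] at a2
    linarith
  · rw [(φ.eval_eq_of_share_ne_zero hs).2, sub_self]
    exact mul_nonneg hC (by linarith [φ.share_le_one w (x - y)])

lemma mono_sub_mollify_nonneg (hρ : IsMollifier ρ ε) {w : Fin n → ℤ} (hw : w ∈ φ.monomials) (x : Q n) :
    0 ≤ φ.mono w x - φ.mollify ρ x := by
  rw [φ.mono_sub_mollify hρ]
  exact integral_nonneg fun y => mul_nonneg (hρ.nonneg y)
    (sub_nonneg.2 (φ.eval_le_mono hw _))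

lemma abs_mollify_sub_eval_le (hρ : IsMollifier ρ ε) (x : Q n) : |φ.mollify ρ x - φ.eval x| ≤ φ.slope * ε := by
  have h1 : φ.mollify ρ x - φ.eval x = ∫ y, ρ y * (φ.eval (x - y) - φ.eval x) := by
    simp_rw [mul_sub]
    rw [integral_sub (φ.integrable_eval hρ x) (hρ.integrable.mul_const _), integral_mul_const,
      hρ.integral_eq, one_mul, mollify]
  have h2 : φ.slope * ε = ∫ y, ρ y * (φ.slope * ε) := by
    rw [integral_mul_const, hρ.integral_eq, one_mul]
  rw [h1, h2, ← Real.norm_eq_abs]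
  refine norm_integral_le_of_norm_le (hρ.integrable.mul_const _) (ae_of_all _ fun y => ?_)
  rw [norm_mul, Real.norm_of_nonneg (hρ.nonneg y)]
  by_cases h0 : ρ y = 0
  · simp [h0]
  refine mul_le_mul_of_nonneg_left ?_ (hρ.nonneg y)
  have a1 := φ.eval_sub_le (x - y) x
  have a2 := φ.eval_sub_le x (x - y)
  have a3 : ‖x - y - x‖ ≤ ε := by simpa using hρ.norm_le y h0
  rw [norm_sub_rev] at a2
  have a4 := mul_le_mul_of_nonneg_left a3 φ.slope_pos.le
  rw [Real.norm_eq_abs, abs_le]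
  constructor <;> linarith

lemma isWeight_mass (hρ : IsMollifier ρ ε) {ε₀ : ℝ} (hε₀ : ∀ x : Q n, ∃ q : Q n, ∀ u ∈ φ.monomials,
    (∃ z ∈ closedBall x ε₀, φ.eval z = φ.mono u z) → u ∈ φ.active q) (hε : ε ≤ ε₀) (x : Q n) :
    φ.IsWeight (φ.mass ρ x) := by
  obtain ⟨q, hq⟩ := hε₀ x
  refine ⟨φ.mass_nonneg hρ x, φ.sum_mass hρ x, q, fun u hu => ?_⟩
  obtain ⟨huM, z, hz, he⟩ := φ.exists_of_mass_ne_zero hρ hu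
  exact hq u huM ⟨z, closedBall_subset_closedBall hε hz, he⟩

lemma mollify_convexComb (hρ : IsMollifier ρ ε) {ρ' : Q n → ℝ} (hρ' : IsMollifier ρ' ε) (σ : ℝ)
    (x : Q n) : φ.mollify (fun y => (1 - σ) * ρ y + σ * ρ' y) x =
      (1 - σ) * φ.mollify ρ x + σ * φ.mollify ρ' x := by
  unfold mollify
  rw [← integral_const_mul, ← integral_const_mul,
    ← integral_add ((φ.integrable_eval hρ x).const_mul _) ((φ.integrable_eval hρ' x).const_mul _)]
  refine integral_congr_ae (ae_of_all _ fun y => ?_)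
  simp only
  ring

end TropicalPolynomial

end TropLag
end

noncomputable section

namespace TropLag

open Set Metric Filter Topology MeasureTheory
open scoped NNReal Pointwise

variable {n : ℕ}

/-! ### Separation of the sheets -/

namespace TropicalPolynomial

variable (φ : TropicalPolynomial n)

/-- The difference of the monomial `v` and a smoothing `ψ` of `φ`. -/
def prim (ψ : Q n → ℝ) (v : Fin n → ℤ) (x : Q n) : ℝ := φ.mono v x - ψ x

lemma hasGradientAt_mono (v : Fin n → ℤ) (x : Q n) : HasGradientAt (φ.mono v) (intVec v) x := by
  rw [hasGradientAt_iff_hasFDerivAt]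
  have := ((innerSL ℝ (intVec v)).hasFDerivAt (x := x)).const_add (φ.coeff v)
  exact this

lemma contDiff_mono (v : Fin n → ℤ) : ContDiff ℝ ∞ (φ.mono v) := by
  unfold mono; exact contDiff_const.add (contDiff_const.inner ℝ contDiff_id)

lemma gradient_prim {ψ : Q n → ℝ} (hψ : Differentiable ℝ ψ) (v : Fin n → ℤ) (x : Q n) :
    gradient (φ.prim ψ v) x = intVec v - gradient ψ x := by
  have h1 := (φ.hasGradientAt_mono v x).hasFDerivAt
  have h2 := (hψ x).hasGradientAt.hasFDerivAt
  have h3 : HasGradientAt (φ.prim ψ v) (intVec v - gradient ψ x) x := by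
    rw [hasGradientAt_iff_hasFDerivAt, map_sub]
    exact h1.sub h2
  exact h3.gradient

/-- Quantitative separation of the two sheets given by `ψ`, and of the necks: `m` and `M` bound the
values of the primitives at which the necks live. -/
structure Separated (ψ : Q n → ℝ) (m M K δ : ℝ) : Prop where
  disjoint : ∀ v ∈ φ.vertexSet, ∀ w ∈ φ.vertexSet, ∀ x, φ.prim ψ v x ≤ M → φ.prim ψ w x < M → v = w
  gradient_le : ∀ x, ‖gradient ψ x‖ ≤ K
  vertex_le : ∀ v ∈ φ.vertexSet, ‖intVec v‖ ≤ K
  outer : ∀ x, (∀ v ∈ φ.vertexSet, m ≤ φ.prim ψ v x) → ∀ k, δ ≤ ‖gradient ψ x - intVec k‖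
  neck : ∀ v ∈ φ.vertexSet, ∀ x, m ≤ φ.prim ψ v x → φ.prim ψ v x < M → ∀ l : ℝ, |l| ≤ 1 → ∀ k ≠ 0,
    δ ≤ ‖l • gradient (φ.prim ψ v) x - intVec k‖

variable {φ}

/-- Exponents with nonzero mass lie in `vertexSet`, so a lower bound on all primitives keeps every
mass away from one. -/
lemma mass_le {ρ : Q n → ℝ} {ε ε₀ m₀ : ℝ}
    (hρ : IsMollifier ρ ε) (hε₀ : 0 < ε₀) (hε : ε ≤ ε₀) {x : Q n}
    (hx : ∀ v ∈ φ.vertexSet, m₀ ≤ φ.prim (φ.mollify ρ) v x) (w : Fin n → ℤ) :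
    φ.mass ρ x w ≤ 1 - min 1 (m₀ / (4 * φ.slope * ε₀)) := by
  have hs := φ.slope_pos
  by_cases hw : φ.mass ρ x w = 0
  · rw [hw]
    linarith [min_le_left 1 (m₀ / (4 * φ.slope * ε₀))]
  · have h1 := φ.mono_sub_mollify_le (hρ.mono_radius hε) hw
    have h2 := hx w (φ.mem_vertexSet_of_mass_ne_zero hρ hw)
    have h3 : m₀ / (4 * φ.slope * ε₀) ≤ 1 - φ.mass ρ x w := by
      rw [div_le_iff₀ (by positivity)]
      unfold prim at h2
      linarith
    linarith [min_le_right 1 (m₀ / (4 * φ.slope * ε₀))]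

/-- The points of the segment from `intVec v` to the mean are again means of weights. Up to sign and
translation by `v`, they are the multiples of `df_v`. -/
lemma IsWeight.convexComb_single {m : (Fin n → ℤ) → ℝ} (hm : φ.IsWeight m) {v : Fin n → ℤ}
    {q : Q n} (hv : v ∈ φ.active q) (hq : ∀ u, m u ≠ 0 → u ∈ φ.active q) {l : ℝ}
    (hl : l ∈ Icc (0 : ℝ) 1) : φ.IsWeight (fun u => l * m u + (1 - l) * (Pi.single v 1 : (Fin n → ℤ) → ℝ) u) := by
  have hs : ∀ u, (0 : ℝ) ≤ (Pi.single v 1 : (Fin n → ℤ) → ℝ) u := fun u => by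
    by_cases h : u = v
    · subst h; simp
    · simp [h]
  refine ⟨fun u => add_nonneg (mul_nonneg hl.1 (hm.nonneg u))
    (mul_nonneg (by linarith [hl.2]) (hs u)), ?_, q, fun u hu => ?_⟩
  · rw [Finset.sum_add_distrib, ← Finset.mul_sum, ← Finset.mul_sum, hm.sum_eq,
      Finset.sum_pi_single', if_pos hv.1]
    ring
  · by_cases h : u = v
    · exact h ▸ hv
    · refine hq u fun h0 => hu ?_
      simp [h0, h]

lemma mean_convexComb_single {m : (Fin n → ℤ) → ℝ} {v : Fin n → ℤ} (hv : v ∈ φ.monomials) (l : ℝ) :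
    φ.mean (fun u => l * m u + (1 - l) * (Pi.single v 1 : (Fin n → ℤ) → ℝ) u) = l • φ.mean m + (1 - l) • intVec v := by
  unfold mean
  simp only [add_smul, Finset.sum_add_distrib, mul_smul, ← Finset.smul_sum]
  congr 2
  rw [Finset.sum_eq_single_of_mem v hv]
  · simp
  · intro u _ hu; simp [hu]

variable (φ)

/-- Uniform separation for all mollifiers of small radius. -/
lemma exists_separation_mollify (hφ : φ.HasNoSelfIntersections) {ε₀ : ℝ} (hε₀pos : 0 < ε₀)
    (hε₀ : ∀ x : Q n, ∃ q : Q n, ∀ u ∈ φ.monomials,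
      (∃ z ∈ closedBall x ε₀, φ.eval z = φ.mono u z) → u ∈ φ.active q) {m₀ : ℝ} (hm₀ : 0 < m₀) :
    ∃ δ > 0, ∀ (ρ : Q n → ℝ) (ε : ℝ), IsMollifier ρ ε → ε ≤ ε₀ → ∀ x,
      (∀ v ∈ φ.vertexSet, m₀ ≤ φ.prim (φ.mollify ρ) v x) →
      (∀ k, δ ≤ ‖gradient (φ.mollify ρ) x - intVec k‖) ∧
      ∀ v ∈ φ.vertexSet, φ.eval x = φ.mono v x → ∀ l : ℝ, |l| ≤ 1 → ∀ k ≠ 0,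
        δ ≤ ‖l • gradient (φ.prim (φ.mollify ρ) v) x - intVec k‖ := by
  have hs := φ.slope_pos
  have hη : 0 < min 1 (m₀ / (4 * φ.slope * ε₀)) := lt_min one_pos (by positivity)
  obtain ⟨δ, hδ, hsep⟩ := φ.exists_lattice_separation hφ hη
  refine ⟨δ, hδ, fun ρ ε hρ hε x hx => ?_⟩
  have hmass := fun w => mass_le hρ hε₀pos hε hx w
  have hW := φ.isWeight_mass hρ hε₀ hε x
  have hdiff : Differentiable ℝ (φ.mollify ρ) := (φ.contDiff_mollify hρ).differentiable (by simp)
  refine ⟨fun k => ?_, fun v hv hve l hl k hk => ?_⟩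
  · by_contra hcon
    rw [φ.gradient_mollify hρ] at hcon
    linarith [hsep _ hW k (not_le.1 hcon), hmass k]
  · obtain ⟨q, hq⟩ := hε₀ x
    have hvq : v ∈ φ.active q := hq v hv.1 ⟨x, mem_closedBall_self hε₀pos.le, hve⟩
    have hsupp : ∀ u, φ.mass ρ x u ≠ 0 → u ∈ φ.active q := fun u hu => by
      obtain ⟨huM, z, hz, he⟩ := φ.exists_of_mass_ne_zero hρ hu
      exact hq u huM ⟨z, closedBall_subset_closedBall hε hz, he⟩
    have key : ∀ l ∈ Icc (0 : ℝ) 1, ∀ k ≠ 0,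
        δ ≤ ‖l • gradient (φ.prim (φ.mollify ρ) v) x - intVec k‖ := by
      intro l hl k hk
      by_contra hcon
      -- The norm of `l df_v - k` is the distance from a point of the segment between `v` and the
      -- mean to the lattice point `v - k`. As `k ≠ 0`, the mass placed at `v` does not count there,
      -- and what remains is at most `l` times a mass bounded away from one.
      have h1 := hsep _ (hW.convexComb_single hvq hsupp hl) (v - k) (by
        rw [φ.gradient_prim hdiff] at hcon
        rw [mean_convexComb_single hv.1, ← φ.gradient_mollify hρ, ← norm_neg, intVec_sub]
        have h2 : -(l • gradient (φ.mollify ρ) x + (1 - l) • intVec v - (intVec v - intVec k)) =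
            l • (intVec v - gradient (φ.mollify ρ) x) - intVec k := by module
        rw [h2]
        exact not_le.1 hcon)
      have h2 : v - k ≠ v := fun h => hk (by simpa using h)
      simp only [Pi.single_eq_of_ne h2, mul_zero, add_zero] at h1
      have h3 : l * φ.mass ρ x (v - k) ≤ φ.mass ρ x (v - k) :=
        mul_le_of_le_one_left (φ.mass_nonneg hρ x _) hl.2
      linarith [hmass (v - k)]
    rcases le_total 0 l with h0 | h0
    · exact key l ⟨h0, (abs_le.1 hl).2⟩ k hk
    · have h1 := key (-l) ⟨by linarith, by linarith [(abs_le.1 hl).1]⟩ (-k) (neg_ne_zero.2 hk)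
      have h2 : l • gradient (φ.prim (φ.mollify ρ) v) x - intVec k =
          -(-l • gradient (φ.prim (φ.mollify ρ) v) x - intVec (-k)) := by
        rw [intVec_neg]; module
      rwa [h2, norm_neg]

/-- The sublevel set of a primitive lies in the interior of the corresponding cell. -/
lemma eventually_eval_eq (hφ : φ.HasNoSelfIntersections) {ε₀ ε : ℝ}
    (hε₀ : ∀ x : Q n, ∃ q : Q n, ∀ u ∈ φ.monomials,
      (∃ z ∈ closedBall x ε₀, φ.eval z = φ.mono u z) → u ∈ φ.active q) (hε : ε ≤ ε₀)
    (D : SurgeryData φ ε) {v : Fin n → ℤ} (hv : v ∈ φ.vertexSet) {x : Q n}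
    (hx : φ.primitive D.kernel v x < 2 * D.profile.c) :
    ∀ᶠ z in 𝓝 x, φ.eval z = φ.mono v z := by
  have hρ := D.kernel.isMollifier
  -- At a point `y` of `U_v` all mass sits on `v`, so `f_v(y) = 0`. The nonnegative integrand for
  -- `f_v(y)` then vanishes on the full support of the kernel, so `φ` is the monomial `v` on the
  -- closed `ε`-ball about `y`, whose interior contains `x`.
  obtain ⟨y, hy, hxy⟩ := mem_thickening_iff.1 (D.neck v hv x hx)
  have hg : φ.mean (φ.mass D.kernel.toFun y) = intVec v := by
    rw [← φ.gradient_mollify hρ]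
    exact hy
  have hm := ((φ.isWeight_mass hρ hε₀ hε y).eq_one_of_mean_eq hφ hg).2
  have h0 : φ.mono v y - φ.mollify D.kernel.toFun y = 0 := by
    refine le_antisymm ?_ (φ.mono_sub_mollify_nonneg hρ hv.1 y)
    have := φ.mono_sub_mollify_le hρ (x := y) (w := v) (by rw [hm]; exact one_ne_zero)
    rwa [hm, sub_self, mul_zero] at this
  rw [φ.mono_sub_mollify hρ] at h0
  have hc : Continuous fun z => D.kernel.toFun z * (φ.mono v (y - z) - φ.eval (y - z)) :=
    D.kernel.smooth.continuous.mul
      (((φ.continuous_mono v).comp (by fun_prop)).sub (φ.continuous_eval.comp (by fun_prop)))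
  have hzero : ∀ z, D.kernel.toFun z * (φ.mono v (y - z) - φ.eval (y - z)) = 0 := by
    intro z
    by_contra hz
    exact (hc.integral_pos_of_hasCompactSupport_nonneg_nonzero (μ := volume)
      hρ.hasCompactSupport.mul_right
      (fun z => mul_nonneg (hρ.nonneg z) (sub_nonneg.2 (φ.eval_le_mono hv.1 _))) (x := z) hz).ne' h0
  have hball : ∀ z ∈ closedBall (0 : Q n) ε, φ.mono v (y - z) - φ.eval (y - z) = 0 := by
    rw [← D.kernel.support_eq]
    have hcl : IsClosed {z | φ.mono v (y - z) - φ.eval (y - z) = 0} := isClosed_eq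
      (((φ.continuous_mono v).comp (by fun_prop)).sub (φ.continuous_eval.comp (by fun_prop)))
      continuous_const
    have := closure_minimal (s := Function.support D.kernel.toFun)
      (t := {z | φ.mono v (y - z) - φ.eval (y - z) = 0})
      (fun z hz => (mul_eq_zero.1 (hzero z)).resolve_left hz) hcl
    exact fun z hz => this hz
  filter_upwards [isOpen_ball.mem_nhds (show x ∈ ball y ε from hxy)] with z hz
  have := hball (y - z) (by
    rw [mem_closedBall_zero_iff, ← dist_eq_norm, dist_comm]
    exact (mem_ball.1 hz).le)
  rw [sub_sub_cancel] at this
  linarith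

lemma eq_of_eventually_eval_eq {v w : Fin n → ℤ} {x : Q n}
    (hv : ∀ᶠ z in 𝓝 x, φ.eval z = φ.mono v z) (hw : ∀ᶠ z in 𝓝 x, φ.eval z = φ.mono w z) : v = w := by
  have h : φ.mono v =ᶠ[𝓝 x] φ.mono w := by
    filter_upwards [hv, hw] with z h1 h2
    rw [← h1, h2]
  have h1 := (φ.hasGradientAt_mono v x).gradient
  have h2 := ((φ.hasGradientAt_mono w x).hasFDerivAt.congr_of_eventuallyEq h).fderiv
  refine intVec_injective ?_
  rw [← h1, gradient, h2]
  simp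

/-- Closed sublevel sets of a primitive do not meet the open sublevel sets of the others. -/
lemma eq_of_primitive_le (hφ : φ.HasNoSelfIntersections) {ε₀ ε : ℝ}
    (hε₀ : ∀ x : Q n, ∃ q : Q n, ∀ u ∈ φ.monomials,
      (∃ z ∈ closedBall x ε₀, φ.eval z = φ.mono u z) → u ∈ φ.active q) (hε : ε ≤ ε₀)
    (D : SurgeryData φ ε) : ∀ v ∈ φ.vertexSet, ∀ w ∈ φ.vertexSet, ∀ x,
      φ.prim (φ.mollify D.kernel.toFun) v x ≤ 2 * D.profile.c →
      φ.prim (φ.mollify D.kernel.toFun) w x < 2 * D.profile.c → v = w := by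
  intro v hv w hw x hxv hxw
  have hρ := D.kernel.isMollifier
  have hev := fun v hv x => φ.eventually_eval_eq hφ hε₀ hε D (v := v) hv (x := x)
  -- The delicate value is `f_v(x) = 2c`. At a local minimum of `f_v` the gradient of the smoothing
  -- is `v`, which forces `f_v(x) = 0`; otherwise points with `f_v < 2c` accumulate at `x`.
  by_cases hmin : IsLocalMin (φ.prim (φ.mollify D.kernel.toFun) v) x
  · have hg : gradient (φ.prim (φ.mollify D.kernel.toFun) v) x = 0 := by
      rw [gradient, hmin.fderiv_eq_zero, map_zero]
    rw [φ.gradient_prim ((φ.contDiff_mollify hρ).differentiable (by simp)), sub_eq_zero] at hg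
    have hm := ((φ.isWeight_mass hρ hε₀ hε x).eq_one_of_mean_eq hφ
      ((φ.gradient_mollify hρ x).symm.trans hg.symm)).2
    have h0 := φ.mono_sub_mollify_le hρ (x := x) (w := v) (by rw [hm]; exact one_ne_zero)
    rw [hm, sub_self, mul_zero] at h0
    have hc := D.profile.c_pos
    have hlt : φ.primitive D.kernel v x < 2 * D.profile.c :=
      lt_of_le_of_lt h0 (by linarith)
    exact φ.eq_of_eventually_eval_eq (hev v hv x hlt) (hev w hw x hxw)
  · have hfr : ∃ᶠ z in 𝓝 x, φ.prim (φ.mollify D.kernel.toFun) v z < 2 * D.profile.c := by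
      intro hcon
      refine hmin (hcon.mono fun z hz => ?_)
      exact hxv.trans (not_lt.1 hz)
    obtain ⟨z, hz, hwz⟩ := (hfr.and_eventually (hev w hw x hxw).eventually_nhds).exists
    exact φ.eq_of_eventually_eval_eq (hev v hv z hz) hwz

/-- Along the interpolation one of the weights `1 - σ`, `σ` is at least `1/2` and both primitives
are nonnegative, so the threshold `min c₁ c₂ / 2` bounds one of the two original primitives by its
own `c`. This places the point inside the cell of `v`. -/
theorem exists_separated (hφ : φ.HasNoSelfIntersections) :
    ∃ ε₀ > 0, ∀ ε₁ ε₂ : ℝ, 0 < ε₁ → ε₁ < ε₀ → 0 < ε₂ → ε₂ < ε₀ →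
      ∀ (D₁ : SurgeryData φ ε₁) (D₂ : SurgeryData φ ε₂),
      (∀ m > 0, ∃ K, ∃ δ > 0, φ.Separated (φ.smoothing D₁.kernel) m (2 * D₁.profile.c) K δ) ∧
      (∀ m > 0, ∃ K, ∃ δ > 0, φ.Separated (φ.smoothing D₂.kernel) m (2 * D₂.profile.c) K δ) ∧
      ∀ m > 0, ∃ K, ∃ δ > 0, ∀ σ ∈ Icc (0 : ℝ) 1, φ.Separated
        (fun x => (1 - σ) * φ.smoothing D₁.kernel x + σ * φ.smoothing D₂.kernel x) m
        (min D₁.profile.c D₂.profile.c / 2) K δ := by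
  obtain ⟨ε₀, hε₀pos, hε₀⟩ := φ.exists_radius
  refine ⟨ε₀, hε₀pos, fun ε₁ ε₂ _ h₁ _ h₂ D₁ D₂ => ?_⟩
  have build : ∀ m > 0, ∃ K, ∃ δ > 0, ∀ (ρ : Q n → ℝ) (M : ℝ), IsMollifier ρ ε₀ →
      (∀ v ∈ φ.vertexSet, ∀ x, φ.prim (φ.mollify ρ) v x < M → ∀ᶠ z in 𝓝 x, φ.eval z = φ.mono v z) →
      (∀ v ∈ φ.vertexSet, ∀ w ∈ φ.vertexSet, ∀ x, φ.prim (φ.mollify ρ) v x ≤ M →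
        φ.prim (φ.mollify ρ) w x < M → v = w) → φ.Separated (φ.mollify ρ) m M K δ := by
    intro m hm
    obtain ⟨δ, hδ, hsep⟩ := φ.exists_separation_mollify hφ hε₀pos hε₀ hm
    refine ⟨φ.slope, δ, hδ, fun ρ M hρ hM hD => ?_⟩
    refine ⟨hD, fun x => ?_, fun v hv => φ.norm_intVec_le_slope hv.1,
      fun x hx => (hsep ρ ε₀ hρ le_rfl x hx).1, fun v hv x hmx hxM l hl k hk => ?_⟩
    · rw [φ.gradient_mollify hρ]
      exact φ.norm_mean_le (φ.isWeight_mass hρ hε₀ le_rfl x)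
    · refine (hsep ρ ε₀ hρ le_rfl x fun w hw => ?_).2 v hv (hM v hv x hxM).self_of_nhds l hl k hk
      by_contra hcon
      have hwv : v = w := φ.eq_of_eventually_eval_eq (hM v hv x hxM) (hM w hw x (by linarith))
      exact hcon (hwv ▸ hmx)
  have hev₁ := fun v hv x => φ.eventually_eval_eq hφ hε₀ h₁.le D₁ (v := v) hv (x := x)
  have hev₂ := fun v hv x => φ.eventually_eval_eq hφ hε₀ h₂.le D₂ (v := v) hv (x := x)
  have hρ₁ := D₁.kernel.isMollifier.mono_radius h₁.le
  have hρ₂ := D₂.kernel.isMollifier.mono_radius h₂.le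
  refine ⟨fun m hm => ?_, fun m hm => ?_, fun m hm => ?_⟩
  · obtain ⟨K, δ, hδ, h⟩ := build m hm
    exact ⟨K, δ, hδ, h _ _ hρ₁ hev₁ (φ.eq_of_primitive_le hφ hε₀ h₁.le D₁)⟩
  · obtain ⟨K, δ, hδ, h⟩ := build m hm
    exact ⟨K, δ, hδ, h _ _ hρ₂ hev₂ (φ.eq_of_primitive_le hφ hε₀ h₂.le D₂)⟩
  · obtain ⟨K, δ, hδ, h⟩ := build m hm
    refine ⟨K, δ, hδ, fun σ hσ => ?_⟩
    have heq : (fun x => (1 - σ) * φ.smoothing D₁.kernel x + σ * φ.smoothing D₂.kernel x) =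
        φ.mollify (fun y => (1 - σ) * D₁.kernel.toFun y + σ * D₂.kernel.toFun y) := by
      funext x
      rw [φ.mollify_convexComb hρ₁ hρ₂]
      rfl
    rw [heq]
    have hev : ∀ v ∈ φ.vertexSet, ∀ x, φ.prim (φ.mollify
        (fun y => (1 - σ) * D₁.kernel.toFun y + σ * D₂.kernel.toFun y)) v x ≤
          min D₁.profile.c D₂.profile.c / 2 → ∀ᶠ z in 𝓝 x, φ.eval z = φ.mono v z := by
      intro v hv x hx
      rw [← heq] at hx
      have n₁ := φ.mono_sub_mollify_nonneg hρ₁ hv.1 x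
      have n₂ := φ.mono_sub_mollify_nonneg hρ₂ hv.1 x
      rw [← φ.smoothing_eq_mollify] at n₁ n₂
      have hsplit : (1 - σ) * (φ.mono v x - φ.smoothing D₁.kernel x) +
          σ * (φ.mono v x - φ.smoothing D₂.kernel x) ≤ min D₁.profile.c D₂.profile.c / 2 := by
        unfold prim at hx
        linarith
      have c₁ := min_le_left D₁.profile.c D₂.profile.c
      have c₂ := min_le_right D₁.profile.c D₂.profile.c
      have p₁ := D₁.profile.c_pos
      have p₂ := D₂.profile.c_pos
      rcases le_total σ (1 / 2) with hs | hs
      · refine hev₁ v hv x ?_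
        unfold primitive
        nlinarith [mul_nonneg hσ.1 n₂, mul_nonneg (by linarith : (0 : ℝ) ≤ 1 / 2 - σ) n₁]
      · refine hev₂ v hv x ?_
        unfold primitive
        nlinarith [mul_nonneg (sub_nonneg.2 hσ.2) n₁, mul_nonneg (by linarith : (0 : ℝ) ≤ σ - 1 / 2) n₂]
    exact h _ _ (hρ₁.convexComb hρ₂ hσ) (fun v hv x hx => hev v hv x hx.le)
      fun v hv w hw x hxv hxw =>
        φ.eq_of_eventually_eval_eq (hev v hv x hxv) (hev w hw x hxw.le)

end TropicalPolynomial

end TropLag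
end

noncomputable section

namespace TropLag

open Set Metric Filter Topology
open scoped NNReal Pointwise

variable {n : ℕ}

/-! ### Periodization -/

section Periodize

variable {A : Type*}

/-- The sum of the lattice translates of a function on `A × ℝⁿ`. -/
def periodize (E : A × Q n → ℝ) (q : A × Q n) : ℝ :=
  ∑ᶠ k : Fin n → ℤ, E (q.1, q.2 - intVec k)

lemma periodize_add_intVec (E : A × Q n → ℝ) (a : A) (p : Q n) (k : Fin n → ℤ) :
    periodize E (a, p + intVec k) = periodize E (a, p) := by
  unfold periodize
  rw [← finsum_comp_equiv (Equiv.addRight k)]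
  refine finsum_congr fun l => ?_
  simp only [Equiv.coe_addRight, intVec_add]
  congr 2
  abel

lemma periodize_eq_single {E : A × Q n → ℝ} {a : A} {p : Q n} (k : Fin n → ℤ)
    (h : ∀ l ≠ k, E (a, p - intVec l) = 0) : periodize E (a, p) = E (a, p - intVec k) :=
  finsum_eq_single _ k h

variable [NormedAddCommGroup A]

/-- The support of `E` is bounded in `ℝⁿ`, locally uniformly in `A`. -/
def FibreSupport (E : A × Q n → ℝ) (R : ℝ) : Prop :=
  ∀ a p, E (a, p) ≠ 0 → ‖p‖ ≤ R * (1 + ‖a‖)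

lemma periodize_eq_sum {E : A × Q n → ℝ} {R : ℝ} (hR : 0 ≤ R) (hE : FibreSupport E R) (r : ℝ) :
    ∃ F : Finset (Fin n → ℤ), ∀ q ∈ ball (0 : A × Q n) r,
      periodize E q = ∑ k ∈ F, E (q.1, q.2 - intVec k) := by
  refine ⟨(finite_setOf_norm_intVec_le (r + R * (1 + r))).toFinset, fun q hq => ?_⟩
  refine finsum_eq_sum_of_support_subset _ fun k hk => ?_
  rw [mem_ball_zero_iff, Prod.norm_def, max_lt_iff] at hq
  have h1 := hE _ _ hk
  have h2 : ‖intVec k‖ ≤ ‖q.2‖ + ‖q.2 - intVec k‖ := by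
    have := norm_sub_le q.2 (q.2 - intVec k)
    simpa using this
  have h3 : R * (1 + ‖q.1‖) ≤ R * (1 + r) := by gcongr; exact hq.1.le
  simp only [Set.Finite.coe_toFinset, mem_ofPred_eq]
  linarith [hq.2]

lemma contDiff_periodize [NormedSpace ℝ A] {E : A × Q n → ℝ} {R : ℝ} (hR : 0 ≤ R) (hE : FibreSupport E R)
    (hs : ContDiff ℝ ∞ E) : ContDiff ℝ ∞ (periodize E) := by
  rw [contDiff_iff_contDiffAt]
  intro q
  obtain ⟨F, hF⟩ := periodize_eq_sum hR hE (‖q‖ + 1)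
  have hev : periodize E =ᶠ[𝓝 q] fun q => ∑ k ∈ F, E (q.1, q.2 - intVec k) := by
    filter_upwards [isOpen_ball.mem_nhds (show q ∈ ball (0 : A × Q n) (‖q‖ + 1) by simp)]
      with y hy using hF y hy
  refine ContDiffAt.congr_of_eventuallyEq ?_ hev
  exact (ContDiff.sum fun k _ => hs.comp (by fun_prop)).contDiffAt

/-- A function of `(t, x, p)` which depends on `(t, x)` only through bounded parameters is
fibrewise bounded. -/
lemma fibreBounded_of_param [NormedSpace ℝ A] [FiniteDimensional ℝ A] {P : A × Q n → ℝ} (hP : ContDiff ℝ ∞ P)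
    (hper : ∀ a p (k : Fin n → ℤ), P (a, p + intVec k) = P (a, p)) {α : ℝ × Q n → A}
    (hα : ContDiff ℝ ∞ α) (hb : ∃ C, ∀ t ∈ Icc (0 : ℝ) 1, ∀ x, ‖α (t, x)‖ ≤ C) :
    FibreBounded (fun q : ℝ × CotQ n => P (α (q.1, q.2.1), q.2.2)) := by
  have := FiniteDimensional.proper_real A
  obtain ⟨C, hC⟩ := hb
  -- The base velocity is a derivative in `p` only, so `α` enters through its values and no bound on
  -- the derivatives of `α` is required.
  obtain ⟨C', hC'⟩ := exists_bound_of_periodic (n := n) (isCompact_closedBall (0 : A) C)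
    (f := fun q => ‖fderiv ℝ P q‖) (hP.continuous_fderiv (by simp)).norm (fun a p k => by
      have h : (fun q : A × Q n => P (q + (0, intVec k))) = P := by
        funext q
        have := hper q.1 q.2 k
        rwa [show q + (0, intVec k) = (q.1, q.2 + intVec k) from Prod.ext (by simp) rfl]
      have h2 := fderiv_comp_add_right (𝕜 := ℝ) (f := P) (x := (a, p)) (0, intVec k)
      rw [h] at h2
      rw [h2]
      simp)
  refine ⟨C', fun t ht z => ?_⟩
  simp only [hamField, LinearIsometryEquiv.norm_map]
  have hα' : HasFDerivAt (fun x => α (t, x)) (fderiv ℝ (fun x => α (t, x)) z.1) z.1 :=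
    ((hα.comp (by fun_prop : ContDiff ℝ ∞ fun x : Q n => (t, x))).differentiable (by simp)
      z.1).hasFDerivAt
  have hd : HasFDerivAt (fun y : CotQ n => P (α (t, y.1), y.2))
      ((fderiv ℝ P (α (t, z.1), z.2)).comp
        (((fderiv ℝ (fun x => α (t, x)) z.1).comp (ContinuousLinearMap.fst ℝ _ _)).prod
          (ContinuousLinearMap.snd ℝ _ _))) z :=
    (((hP.differentiable (by simp)) (α (t, z.1), z.2)).hasFDerivAt).comp z
      ((hα'.comp z hasFDerivAt_fst).prodMk hasFDerivAt_snd)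
  rw [hd.fderiv]
  refine ContinuousLinearMap.opNorm_le_bound _ ((norm_nonneg _).trans (hC' _ (by
    simpa using hC t ht z.1) z.2)) fun w => ?_
  simp only [ContinuousLinearMap.comp_apply, ContinuousLinearMap.inr_apply,
    ContinuousLinearMap.prod_apply, ContinuousLinearMap.coe_fst', ContinuousLinearMap.coe_snd',
    map_zero]
  refine (ContinuousLinearMap.le_opNorm _ _).trans ?_
  have hw : ‖((0 : A), w)‖ = ‖w‖ := by simp [Prod.norm_def]
  rw [hw]
  exact mul_le_mul_of_nonneg_right (hC' _ (by simpa using hC t ht z.1) z.2) (norm_nonneg _)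

end Periodize

lemma hamField_add {K₁ K₂ : ℝ × CotQ n → ℝ} (h₁ : ContDiff ℝ ∞ K₁) (h₂ : ContDiff ℝ ∞ K₂) (t : ℝ)
    (z : CotQ n) : hamField (fun q => K₁ q + K₂ q) t z = hamField K₁ t z + hamField K₂ t z := by
  have hd : ∀ {K : ℝ × CotQ n → ℝ}, ContDiff ℝ ∞ K → DifferentiableAt ℝ (fun y => K (t, y)) z :=
    fun hK => (hK.comp (by fun_prop : ContDiff ℝ ∞ fun y : CotQ n => (t, y))).differentiable
      (by simp) z
  refine (eq_hamField fun W => ?_).symm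
  rw [omega_add_left, omega_hamField, omega_hamField, fderiv_fun_add (hd h₁) (hd h₂)]
  rfl

lemma hamField_neg (K : ℝ × CotQ n → ℝ) (t : ℝ) (z : CotQ n) :
    hamField (fun q => -K q) t z = -hamField K t z := by
  refine (eq_hamField fun W => ?_).symm
  rw [← neg_one_smul ℝ, omega_smul_left, omega_hamField, fderiv_fun_neg]
  simp

lemma FibreBounded.add {K₁ K₂ : ℝ × CotQ n → ℝ} (h₁ : ContDiff ℝ ∞ K₁) (h₂ : ContDiff ℝ ∞ K₂)
    (b₁ : FibreBounded K₁) (b₂ : FibreBounded K₂) : FibreBounded fun q => K₁ q + K₂ q := by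
  obtain ⟨C₁, hC₁⟩ := b₁
  obtain ⟨C₂, hC₂⟩ := b₂
  refine ⟨C₁ + C₂, fun t ht z => ?_⟩
  rw [hamField_add h₁ h₂]
  exact (norm_add_le _ _).trans (add_le_add (hC₁ t ht z) (hC₂ t ht z))

lemma FibreBounded.neg {K : ℝ × CotQ n → ℝ} (b : FibreBounded K) : FibreBounded fun q => -K q := by
  obtain ⟨C, hC⟩ := b
  refine ⟨C, fun t ht z => ?_⟩
  rw [hamField_neg]
  simpa using hC t ht z

lemma FibreBounded.sum {ι : Type*} {K : ι → ℝ × CotQ n → ℝ} (s : Finset ι)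
    (h : ∀ i ∈ s, ContDiff ℝ ∞ (K i)) (b : ∀ i ∈ s, FibreBounded (K i)) :
    FibreBounded fun q => ∑ i ∈ s, K i q := by
  classical
  induction s using Finset.induction_on with
  | empty =>
    refine ⟨0, fun t _ z => ?_⟩
    simp [hamField]
  | insert i s hi ih =>
    simp_rw [Finset.sum_insert hi]
    exact FibreBounded.add (h i (Finset.mem_insert_self _ _))
      (ContDiff.sum fun j hj => h j (Finset.mem_insert_of_mem hj)) (b i (Finset.mem_insert_self _ _))
      (ih (fun j hj => h j (Finset.mem_insert_of_mem hj))
        fun j hj => b j (Finset.mem_insert_of_mem hj))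

/-! ### A periodic bump function -/

/-- The periodization of a bump function around the lattice points. -/
def latticeBump (η : ContDiffBump (0 : Q n)) (p : Q n) : ℝ :=
  periodize (fun q : ℝ × Q n => η q.2) (0, p)

variable (η : ContDiffBump (0 : Q n))

lemma fibreSupport_bump : FibreSupport (fun q : ℝ × Q n => η q.2) η.rOut := by
  intro a p h
  have h1 : ‖p‖ < η.rOut := by
    by_contra hcon
    exact h (η.zero_of_le_dist (by simpa using hcon))
  nlinarith [norm_nonneg a, η.rOut_pos]

lemma contDiff_latticeBump : ContDiff ℝ ∞ (latticeBump η) :=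
  (contDiff_periodize η.rOut_pos.le (fibreSupport_bump η) (η.contDiff.comp contDiff_snd)).comp
    (by fun_prop : ContDiff ℝ ∞ fun p : Q n => ((0 : ℝ), p))

lemma latticeBump_add_intVec (p : Q n) (k : Fin n → ℤ) :
    latticeBump η (p + intVec k) = latticeBump η p :=
  periodize_add_intVec _ 0 p k

lemma one_le_norm_intVec {k : Fin n → ℤ} (hk : k ≠ 0) : 1 ≤ ‖intVec k‖ := by
  obtain ⟨i, hi⟩ : ∃ i, k i ≠ 0 := by
    by_contra h
    push Not at h
    exact hk (funext h)
  have h1 : (1 : ℝ) ≤ ‖intVec k i‖ := by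
    rw [intVec_apply, Real.norm_eq_abs]
    exact_mod_cast Int.one_le_abs hi
  exact h1.trans (PiLp.norm_apply_le (intVec k) i)

lemma latticeBump_eq_one (hη : η.rOut ≤ 1 / 2) {p : Q n} (h : ‖p‖ ≤ η.rIn) :
    latticeBump η p = 1 := by
  unfold latticeBump
  rw [periodize_eq_single 0]
  · exact η.one_of_mem_closedBall (by simpa using h)
  · intro l hl
    refine η.zero_of_le_dist ?_
    rw [dist_zero_right]
    have h1 := one_le_norm_intVec hl
    have h2 : ‖intVec l‖ ≤ ‖p‖ + ‖p - intVec l‖ := by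
      have := norm_sub_le p (p - intVec l)
      simpa using this
    linarith [η.rIn_lt_rOut]

lemma latticeBump_eq_zero {p : Q n} (h : ∀ k, η.rOut ≤ ‖p - intVec k‖) : latticeBump η p = 0 := by
  unfold latticeBump periodize
  refine finsum_eq_zero_of_forall_eq_zero fun k => η.zero_of_le_dist ?_
  simpa using h k

lemma latticeBump_eventually_eq_one (hη : η.rOut ≤ 1 / 2) {p : Q n} (k : Fin n → ℤ)
    (h : ‖p - intVec k‖ < η.rIn) : ∀ᶠ q in 𝓝 p, latticeBump η q = 1 := by
  have hc : Continuous fun q : Q n => ‖q - intVec k‖ := by fun_prop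
  filter_upwards [hc.continuousAt.eventually_lt continuousAt_const h] with q hq
  rw [← sub_add_cancel q (intVec k), latticeBump_add_intVec]
  exact latticeBump_eq_one η hη hq.le

lemma latticeBump_eventually_eq_zero {p : Q n} (h : ∀ k, 2 * η.rOut ≤ ‖p - intVec k‖) :
    ∀ᶠ q in 𝓝 p, latticeBump η q = 0 := by
  filter_upwards [ball_mem_nhds p η.rOut_pos] with q hq
  refine latticeBump_eq_zero η fun k => ?_
  have h1 : ‖p - intVec k‖ ≤ ‖q - p‖ + ‖q - intVec k‖ := by
    have h3 := norm_sub_le_norm_sub_add_norm_sub p q (intVec k)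
    rw [norm_sub_rev p q] at h3
    exact h3
  rw [mem_ball, dist_eq_norm] at hq
  linarith [h k]

end TropLag
end

noncomputable section

namespace TropLag

open Set Metric Filter Topology
open scoped NNReal Pointwise

variable {n : ℕ}

/-! ### Deforming the two sheets near the ends of the necks -/

lemma contDiff_gradient {F : Q n → ℝ} (hF : ContDiff ℝ ∞ F) : ContDiff ℝ ∞ (gradient F) :=
  (InnerProductSpace.toDual ℝ (Q n)).symm.contDiff.comp (hF.fderiv_right (by simp))

lemma bounded_of_zero_outside {F : Type*} [NormedAddCommGroup F] {a : ℝ → F} (ha : Continuous a)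
    {l r : ℝ} (h : ∀ t ∉ Ioo l r, a t = 0) : ∃ C, 0 ≤ C ∧ ∀ t, ‖a t‖ ≤ C := by
  obtain ⟨C, hC⟩ := (isCompact_Icc (a := l) (b := r)).exists_bound_of_continuousOn ha.continuousOn
  refine ⟨max C 0, le_max_right _ _, fun t => ?_⟩
  by_cases ht : t ∈ Ioo l r
  · exact (hC t (Ioo_subset_Icc_self ht)).trans (le_max_left _ _)
  · rw [h t ht, norm_zero]
    exact le_max_right _ _

/-- The product rule at a point where one factor vanishes to first order or the other is
locally constant. -/
lemma hasFDerivAt_comp_mul {f : Q n → ℝ} {a : ℝ → ℝ} {b : CotQ n → ℝ} {z : CotQ n} {e : ℝ}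
    (hf : DifferentiableAt ℝ f z.1) (ha : Differentiable ℝ a) (hb : DifferentiableAt ℝ b z)
    (h : (a (f z.1) = 0 ∧ deriv a (f z.1) = 0) ∨ ∀ᶠ y in 𝓝 z, b y = e) :
    HasFDerivAt (fun y : CotQ n => a (f y.1) * b y)
      ((deriv a (f z.1) * e) •
        (innerSL ℝ (gradient f z.1)).comp (ContinuousLinearMap.fst ℝ (Q n) (Q n))) z := by
  have h1 : HasFDerivAt (fun y : CotQ n => a (f y.1))
      (deriv a (f z.1) • (innerSL ℝ (gradient f z.1)).comp
        (ContinuousLinearMap.fst ℝ (Q n) (Q n))) z := by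
    have h2 : HasFDerivAt f (innerSL ℝ (gradient f z.1)) z.1 := hf.hasGradientAt.hasFDerivAt
    have h3 : HasFDerivAt (fun y : CotQ n => f y.1) _ z := h2.comp z hasFDerivAt_fst
    exact (ha (f z.1)).hasDerivAt.comp_hasFDerivAt z h3
  rcases h with ⟨h0, h0'⟩ | h
  · refine (h1.mul hb.hasFDerivAt).congr_fderiv ?_
    rw [h0, h0']
    simp
  · have hb' : HasFDerivAt b (0 : CotQ n →L[ℝ] ℝ) z :=
      (hasFDerivAt_const e z).congr_of_eventuallyEq h
    refine (h1.mul hb').congr_fderiv ?_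
    rw [h.self_of_nhds]
    simp [smul_smul, mul_comm]

namespace TropicalPolynomial

variable (φ : TropicalPolynomial n)

/-- The two sheets of `ψ` outside the necks, together with the necks with profile derivatives
`S` and `R`. -/
def sheets (ψ : Q n → ℝ) (c : ℝ) (S R : ℝ → ℝ) : Set (X n) :=
  {z | ∃ x : Q n, (∀ v ∈ φ.vertexSet, 2 * c ≤ φ.prim ψ v x) ∧
    (z = proj (x, 0) ∨ z = proj (x, -gradient ψ x))} ∪
  ⋃ v ∈ φ.vertexSet, {z | ∃ x : Q n, c ≤ φ.prim ψ v x ∧ φ.prim ψ v x ≤ 2 * c ∧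
    (z = proj (x, R (φ.prim ψ v x) • gradient (φ.prim ψ v) x) ∨
      z = proj (x, S (φ.prim ψ v x) • gradient (φ.prim ψ v) x))}

variable {φ}

lemma contDiff_prim {ψ : Q n → ℝ} (hψ : ContDiff ℝ ∞ ψ) (v : Fin n → ℤ) :
    ContDiff ℝ ∞ (φ.prim ψ v) :=
  (φ.contDiff_mono v).sub hψ

lemma Separated.norm_gradient_prim_le {ψ : Q n → ℝ} {m M K δ : ℝ} (h : φ.Separated ψ m M K δ)
    (hψ : ContDiff ℝ ∞ ψ) {v : Fin n → ℤ} (hv : v ∈ φ.vertexSet) (x : Q n) :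
    ‖gradient (φ.prim ψ v) x‖ ≤ 2 * K := by
  rw [gradient_prim _ (hψ.differentiable (by simp))]
  linarith [norm_sub_le (intVec v) (gradient ψ x), h.gradient_le x, h.vertex_le v hv]

/-- The Hamiltonian which moves the two sheets by the differentials of `a₀ ∘ f_v` and
`a₁ ∘ f_v`. -/
def sheetHam (φ : TropicalPolynomial n) (V : Finset (Fin n → ℤ)) (ψ : Q n → ℝ) (η : ContDiffBump (0 : Q n)) (a₀ a₁ : ℝ → ℝ)
    (q : ℝ × CotQ n) : ℝ :=
  -∑ v ∈ V, (a₀ (φ.prim ψ v q.2.1) * latticeBump η q.2.2 +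
    a₁ (φ.prim ψ v q.2.1) * latticeBump η (q.2.2 + gradient ψ q.2.1))

section SheetHam

variable (V : Finset (Fin n → ℤ)) {ψ : Q n → ℝ} (η : ContDiffBump (0 : Q n)) {a₀ a₁ : ℝ → ℝ}

lemma contDiff_sheetHam (hψ : ContDiff ℝ ∞ ψ) (h₀ : ContDiff ℝ ∞ a₀) (h₁ : ContDiff ℝ ∞ a₁) :
    ContDiff ℝ ∞ (φ.sheetHam V ψ η a₀ a₁) := by
  have hβ := contDiff_latticeBump η
  have hg := contDiff_gradient hψ
  have hp : ∀ v, ContDiff ℝ ∞ fun q : ℝ × CotQ n => φ.prim ψ v q.2.1 := fun v =>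
    (contDiff_prim hψ v).comp (by fun_prop)
  refine ContDiff.neg (ContDiff.sum fun v _ => ?_)
  exact ((h₀.comp (hp v)).mul (hβ.comp (by fun_prop))).add
    ((h₁.comp (hp v)).mul (hβ.comp (contDiff_snd.snd.add (hg.comp (by fun_prop)))))

lemma fibrePeriodic_sheetHam : FibrePeriodic (φ.sheetHam V ψ η a₀ a₁) := by
  intro t z k
  simp only [sheetHam, Prod.fst_add, Prod.snd_add, add_zero, latticeBump_add_intVec,
    add_right_comm _ (intVec k)]

lemma fibreBounded_sheetHam (hψ : ContDiff ℝ ∞ ψ) (h₀ : ContDiff ℝ ∞ a₀) (h₁ : ContDiff ℝ ∞ a₁)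
    {l r K : ℝ} (z₀ : ∀ t ∉ Ioo l r, a₀ t = 0) (z₁ : ∀ t ∉ Ioo l r, a₁ t = 0)
    (hK : ∀ x, ‖gradient ψ x‖ ≤ K) : FibreBounded (φ.sheetHam V ψ η a₀ a₁) := by
  have hβ := contDiff_latticeBump η
  have hg := contDiff_gradient hψ
  have hp : ∀ v, ContDiff ℝ ∞ fun q : ℝ × CotQ n => φ.prim ψ v q.2.1 := fun v =>
    (contDiff_prim hψ v).comp (by fun_prop)
  have hp' : ∀ v, ContDiff ℝ ∞ fun q : ℝ × Q n => φ.prim ψ v q.2 := fun v =>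
    (contDiff_prim hψ v).comp (by fun_prop)
  obtain ⟨C₀, hC₀, b₀⟩ := bounded_of_zero_outside h₀.continuous z₀
  obtain ⟨C₁, hC₁, b₁⟩ := bounded_of_zero_outside h₁.continuous z₁
  refine FibreBounded.neg (FibreBounded.sum _ (fun v _ => ?_) fun v _ => ?_)
  · exact ((h₀.comp (hp v)).mul (hβ.comp (by fun_prop))).add
      ((h₁.comp (hp v)).mul (hβ.comp (contDiff_snd.snd.add (hg.comp (by fun_prop)))))
  · refine FibreBounded.add ((h₀.comp (hp v)).mul (hβ.comp (by fun_prop)))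
      ((h₁.comp (hp v)).mul (hβ.comp (contDiff_snd.snd.add (hg.comp (by fun_prop))))) ?_ ?_
    · exact fibreBounded_of_param (P := fun q : ℝ × Q n => q.1 * latticeBump η q.2)
        (contDiff_fst.mul (hβ.comp contDiff_snd))
        (fun a p k => by simp only [latticeBump_add_intVec])
        (α := fun q => a₀ (φ.prim ψ v q.2)) (h₀.comp (hp' v)) ⟨C₀, fun t _ x => b₀ _⟩
    · refine fibreBounded_of_param
        (P := fun q : (ℝ × Q n) × Q n => q.1.1 * latticeBump η (q.2 + q.1.2))
        ((contDiff_fst.comp contDiff_fst).mul (hβ.comp (by fun_prop)))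
        (fun a p k => by simp only [latticeBump_add_intVec, add_right_comm _ (intVec k)])
        (α := fun q => (a₁ (φ.prim ψ v q.2), gradient ψ q.2))
        ((h₁.comp (hp' v)).prodMk (hg.comp contDiff_snd)) ⟨max C₁ K, fun t _ x => ?_⟩
      exact max_le_max (b₁ _) (hK x)

/-- Where the bumps are locally constant the Hamiltonian depends on `x` alone, so `x` is fixed and
`p` is translated by a constant covector. Where `a₀` and `a₁` vanish to first order nothing moves.
-/
lemma isSolution_sheetHam (hψ : ContDiff ℝ ∞ ψ) (h₀ : ContDiff ℝ ∞ a₀) (h₁ : ContDiff ℝ ∞ a₁)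
    {l r e₀ e₁ : ℝ} (z₀ : ∀ t ∉ Ioo l r, a₀ t = 0) (z₁ : ∀ t ∉ Ioo l r, a₁ t = 0)
    (d₀ : ∀ t ∉ Ioo l r, deriv a₀ t = 0) (d₁ : ∀ t ∉ Ioo l r, deriv a₁ t = 0) {x p ξ : Q n}
    (hξ : ξ = ∑ v ∈ V, (deriv a₀ (φ.prim ψ v x) * e₀ + deriv a₁ (φ.prim ψ v x) * e₁) •
      gradient (φ.prim ψ v) x)
    (h : ∀ t ∈ Icc (0 : ℝ) 1, (∀ v ∈ V, φ.prim ψ v x ∉ Ioo l r) ∨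
      ((∀ᶠ y in 𝓝 (p + t • ξ), latticeBump η y = e₀) ∧
        ∀ᶠ y in 𝓝 (p + t • ξ + gradient ψ x), latticeBump η y = e₁)) :
    IsSolution (hamField (φ.sheetHam V ψ η a₀ a₁)) fun t => (x, p + t • ξ) := by
  intro t ht
  have hβ := (contDiff_latticeBump η).differentiable (by simp)
  have hg := contDiff_gradient hψ
  have hbd : Differentiable ℝ fun y : CotQ n => latticeBump η (y.2 + gradient ψ y.1) :=
    hβ.comp (differentiable_snd.add ((hg.differentiable (by simp)).comp differentiable_fst))
  have key : (0, ξ) = hamField (φ.sheetHam V ψ η a₀ a₁) t (x, p + t • ξ) := by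
    refine eq_hamField fun W => ?_
    have hd : HasFDerivAt (fun y : CotQ n => φ.sheetHam V ψ η a₀ a₁ (t, y))
        (-∑ v ∈ V, ((deriv a₀ (φ.prim ψ v x) * e₀) • (innerSL ℝ (gradient (φ.prim ψ v) x)).comp
          (ContinuousLinearMap.fst ℝ (Q n) (Q n)) +
          (deriv a₁ (φ.prim ψ v x) * e₁) • (innerSL ℝ (gradient (φ.prim ψ v) x)).comp
          (ContinuousLinearMap.fst ℝ (Q n) (Q n)))) (x, p + t • ξ) := by
      refine HasFDerivAt.neg (HasFDerivAt.fun_sum fun v hv => ?_)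
      have hf : DifferentiableAt ℝ (φ.prim ψ v) x :=
        (contDiff_prim hψ v).differentiable (by simp) x
      refine HasFDerivAt.add
        (hasFDerivAt_comp_mul (b := fun y : CotQ n => latticeBump η y.2) (z := (x, p + t • ξ)) hf
          (h₀.differentiable (by simp)) (by fun_prop) ?_)
        (hasFDerivAt_comp_mul (z := (x, p + t • ξ)) hf (h₁.differentiable (by simp)) (hbd _) ?_)
      · rcases h t ht with h | h
        · exact Or.inl ⟨z₀ _ (h v hv), d₀ _ (h v hv)⟩
        · exact Or.inr ((continuous_snd.tendsto (x, p + t • ξ)).eventually h.1)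
      · rcases h t ht with h | h
        · exact Or.inl ⟨z₁ _ (h v hv), d₁ _ (h v hv)⟩
        · refine Or.inr ?_
          have hc : Continuous fun y : CotQ n => y.2 + gradient ψ y.1 :=
            continuous_snd.add (hg.continuous.comp continuous_fst)
          exact (hc.tendsto (x, p + t • ξ)).eventually h.2
    rw [hd.fderiv, hξ]
    simp [omega, sum_inner, inner_smul_left, add_mul]
  rw [← key]
  refine HasDerivAt.hasDerivWithinAt ?_
  refine (hasDerivAt_const t x).prodMk ?_
  simpa using ((hasDerivAt_id t).smul_const ξ).const_add p

end SheetHam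

lemma prim_not_mem_of_ne {ψ : Q n → ℝ} {m M K δ l : ℝ} (h : φ.Separated ψ m M K δ)
    {v w : Fin n → ℤ} (hv : v ∈ φ.vertexSet) (hw : w ∈ φ.vertexSet) (hne : w ≠ v) {x : Q n}
    (hx : φ.prim ψ v x ≤ M) : φ.prim ψ w x ∉ Ioo l M := fun hc =>
  hne (h.disjoint v hv w hw x hx hc.2).symm

/-- In the collar `l < f_v < 2c` the branch `S df_v` is close to `0`, and `R df_v` is close to
`df_v`, which is the upper sheet modulo the lattice. The bumps around the two sheets tell the
branches apart, and each branch is translated by its own exact differential. -/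
theorem hamiltonianIsotopic_sheets {ψ : Q n → ℝ} (hψ : ContDiff ℝ ∞ ψ) {c K δ : ℝ}
    (hδ : 0 < δ) (hsep : φ.Separated ψ c (2 * c) K δ) {S R a₀ a₁ : ℝ → ℝ}
    (h₀ : ContDiff ℝ ∞ a₀) (h₁ : ContDiff ℝ ∞ a₁) {l κ : ℝ} (hl : c ≤ l)
    (z₀ : ∀ t ∉ Ioo l (2 * c), a₀ t = 0) (z₁ : ∀ t ∉ Ioo l (2 * c), a₁ t = 0)
    (d₀ : ∀ t ∉ Ioo l (2 * c), deriv a₀ t = 0) (d₁ : ∀ t ∉ Ioo l (2 * c), deriv a₁ t = 0)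
    (hκ : κ * (2 * K) < min (1 / 4) (δ / 16))
    (hS : ∀ t ∈ Ioo l (2 * c), |S t| ≤ κ) (hS' : ∀ t ∈ Ioo l (2 * c), |S t + deriv a₀ t| ≤ κ)
    (hR : ∀ t ∈ Ioo l (2 * c), |1 - R t| ≤ κ)
    (hR' : ∀ t ∈ Ioo l (2 * c), |1 - (R t + deriv a₁ t)| ≤ κ) :
    HamiltonianIsotopic (φ.sheets ψ c S R)
      (φ.sheets ψ c (fun t => S t + deriv a₀ t) (fun t => R t + deriv a₁ t)) := by
  classical
  -- The bound `1/4` keeps the bumps at different lattice points disjoint; `δ/16` gives `4ρ ≤ δ -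
  -- ρ`, so the bump of one sheet vanishes near the other even after a displacement by `ρ`.
  set ρ := min (1 / 4) (δ / 16) with hρ
  have hρpos : 0 < ρ := by positivity
  let η : ContDiffBump (0 : Q n) := ⟨ρ, 2 * ρ, hρpos, by linarith⟩
  have hη : η.rOut ≤ 1 / 2 := by
    change 2 * ρ ≤ 1 / 2
    linarith [min_le_left (1 / 4) (δ / 16)]
  have hηδ : 2 * η.rOut ≤ δ - ρ := by
    change 2 * (2 * ρ) ≤ δ - ρ
    linarith [min_le_right (1 / 4) (δ / 16)]
  set V := φ.vertexSet_finite.toFinset with hV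
  have hmem : ∀ v, v ∈ V ↔ v ∈ φ.vertexSet := fun v => by simp [hV]
  have hψd : Differentiable ℝ ψ := hψ.differentiable (by simp)
  -- the trajectories outside the ends of the necks are constant
  have hconst : ∀ x p, (∀ v ∈ φ.vertexSet, φ.prim ψ v x ∉ Ioo l (2 * c)) →
      IsSolution (hamField (φ.sheetHam V ψ η a₀ a₁)) fun _ => (x, p) := by
    intro x p h
    have := isSolution_sheetHam (φ := φ) V η hψ h₀ h₁ (e₀ := 0) (e₁ := 0) z₀ z₁ d₀ d₁ (x := x) (p := p)
      (ξ := 0) (by simp) (fun t _ => Or.inl fun v hv => h v ((hmem v).1 hv))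
    simpa using this
  have hsum : ∀ v ∈ φ.vertexSet, ∀ x, φ.prim ψ v x ≤ 2 * c → ∀ e₀ e₁ : ℝ,
      ∑ w ∈ V, (deriv a₀ (φ.prim ψ w x) * e₀ + deriv a₁ (φ.prim ψ w x) * e₁) •
        gradient (φ.prim ψ w) x =
      (deriv a₀ (φ.prim ψ v x) * e₀ + deriv a₁ (φ.prim ψ v x) * e₁) • gradient (φ.prim ψ v) x := by
    intro v hv x hx e₀ e₁
    refine Finset.sum_eq_single v (fun w hw hne => ?_) fun h => absurd ((hmem v).2 hv) h
    have := prim_not_mem_of_ne (l := l) hsep hv ((hmem w).1 hw) hne hx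
    rw [d₀ _ this, d₁ _ this]
    simp
  have hout : ∀ v ∈ φ.vertexSet, ∀ x, φ.prim ψ v x ∈ Ioo l (2 * c) → ∀ τ : ℝ, |τ| ≤ κ → ∀ k,
      δ - ρ ≤ ‖(gradient ψ x + τ • gradient (φ.prim ψ v) x) - intVec k‖ := by
    intro v hv x hx τ hτ k
    have h1 := hsep.outer x (fun w hw => by
      by_cases hne : w = v
      · subst hne
        linarith [hx.1]
      · have := prim_not_mem_of_ne (l := l) hsep hv hw hne hx.2.le
        by_contra hcon
        exact hne (hsep.disjoint v hv w hw x hx.2.le (by linarith [hx.1, hx.2])).symm) k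
    have h2 := norm_sub_norm_le (gradient ψ x - intVec k) (-(τ • gradient (φ.prim ψ v) x))
    rw [norm_neg, norm_smul, Real.norm_eq_abs, sub_neg_eq_add] at h2
    have h3 : |τ| * ‖gradient (φ.prim ψ v) x‖ ≤ κ * (2 * K) := mul_le_mul hτ
      (hsep.norm_gradient_prim_le hψ hv x) (norm_nonneg _) ((abs_nonneg τ).trans hτ)
    rw [add_sub_right_comm]
    linarith
  have hin : ∀ v ∈ φ.vertexSet, ∀ x (τ : ℝ), |τ| ≤ κ → ‖τ • gradient (φ.prim ψ v) x‖ < ρ := by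
    intro v hv x τ hτ
    rw [norm_smul, Real.norm_eq_abs]
    exact (mul_le_mul hτ (hsep.norm_gradient_prim_le hψ hv x) (norm_nonneg _)
      ((abs_nonneg τ).trans hτ)).trans_lt hκ
  have hconv : ∀ {y d t : ℝ}, t ∈ Icc (0 : ℝ) 1 → |y| ≤ κ → |y + d| ≤ κ → |y + t * d| ≤ κ := by
    intro y d t ht h1 h2
    rw [abs_le] at *
    constructor <;> nlinarith [ht.1, ht.2]
  -- the lower sheet
  have hlow : ∀ v ∈ φ.vertexSet, ∀ x, φ.prim ψ v x ∈ Ioo l (2 * c) →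
      IsSolution (hamField (φ.sheetHam V ψ η a₀ a₁)) fun t =>
        (x, S (φ.prim ψ v x) • gradient (φ.prim ψ v) x +
          t • (deriv a₀ (φ.prim ψ v x) • gradient (φ.prim ψ v) x)) := by
    intro v hv x hx
    refine isSolution_sheetHam (φ := φ) V η hψ h₀ h₁ (e₀ := 1) (e₁ := 0) z₀ z₁ d₀ d₁
      (by rw [hsum v hv x hx.2.le]; simp) fun t ht => Or.inr ?_
    have hb := hconv ht (hS _ hx) (hS' _ hx)
    rw [smul_smul, ← add_smul]
    constructor
    · refine latticeBump_eventually_eq_one η hη 0 ?_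
      rw [intVec_zero, sub_zero]
      exact hin v hv x _ hb
    · refine latticeBump_eventually_eq_zero η fun k => hηδ.trans ?_
      rw [add_comm]
      exact hout v hv x hx _ hb k
  -- the upper sheet
  have hup : ∀ v ∈ φ.vertexSet, ∀ x, φ.prim ψ v x ∈ Ioo l (2 * c) →
      IsSolution (hamField (φ.sheetHam V ψ η a₀ a₁)) fun t =>
        (x, R (φ.prim ψ v x) • gradient (φ.prim ψ v) x +
          t • (deriv a₁ (φ.prim ψ v x) • gradient (φ.prim ψ v) x)) := by
    intro v hv x hx
    refine isSolution_sheetHam (φ := φ) V η hψ h₀ h₁ (e₀ := 0) (e₁ := 1) z₀ z₁ d₀ d₁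
      (by rw [hsum v hv x hx.2.le]; simp) fun t ht => Or.inr ?_
    have hb : |(1 - R (φ.prim ψ v x)) + t * (-deriv a₁ (φ.prim ψ v x))| ≤ κ :=
      hconv ht (hR _ hx) (by
        have := hR' _ hx
        rwa [show 1 - (R (φ.prim ψ v x) + deriv a₁ (φ.prim ψ v x)) =
          1 - R (φ.prim ψ v x) + -deriv a₁ (φ.prim ψ v x) by ring] at this)
    set τ := (1 - R (φ.prim ψ v x)) + t * (-deriv a₁ (φ.prim ψ v x)) with hτ
    have hp : R (φ.prim ψ v x) • gradient (φ.prim ψ v) x +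
        t • (deriv a₁ (φ.prim ψ v x) • gradient (φ.prim ψ v) x) =
        gradient (φ.prim ψ v) x - τ • gradient (φ.prim ψ v) x := by
      rw [hτ]; module
    have hg := φ.gradient_prim hψd v x
    rw [hp]
    constructor
    · refine latticeBump_eventually_eq_zero η fun k => hηδ.trans ?_
      have := hout v hv x hx _ hb (v - k)
      rw [intVec_sub] at this
      refine this.trans_eq ?_
      rw [← norm_neg]
      congr 1
      nth_rewrite 2 [hg]
      abel
    · refine latticeBump_eventually_eq_one η hη v ?_
      have := hin v hv x _ hb
      rw [← norm_neg] at this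
      refine lt_of_eq_of_lt ?_ this
      congr 1
      nth_rewrite 1 [hg]
      abel
  have hends : ∀ (a : ℝ → ℝ), (∀ t ∉ Ioo l (2 * c), deriv a t = 0) → ∀ v ∈ φ.vertexSet,
      ∀ x, φ.prim ψ v x ≤ 2 * c → ∀ T : ℝ → ℝ, (φ.prim ψ v x ∈ Ioo l (2 * c) →
        IsSolution (hamField (φ.sheetHam V ψ η a₀ a₁)) fun t =>
          (x, T (φ.prim ψ v x) • gradient (φ.prim ψ v) x +
            t • (deriv a (φ.prim ψ v x) • gradient (φ.prim ψ v) x))) →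
      ∃ γ, IsSolution (hamField (φ.sheetHam V ψ η a₀ a₁)) γ ∧
        γ 0 = (x, T (φ.prim ψ v x) • gradient (φ.prim ψ v) x) ∧
        γ 1 = (x, (T (φ.prim ψ v x) + deriv a (φ.prim ψ v x)) • gradient (φ.prim ψ v) x) := by
    intro a ha v hv x hx T hT
    by_cases hm : φ.prim ψ v x ∈ Ioo l (2 * c)
    · exact ⟨_, hT hm, by simp, by simp [add_smul]⟩
    · refine ⟨_, hconst x (T (φ.prim ψ v x) • gradient (φ.prim ψ v) x) fun w hw => ?_, rfl, ?_⟩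
      · by_cases hne : w = v
        · exact hne ▸ hm
        · exact prim_not_mem_of_ne hsep hv hw hne hx
      · simp only [ha _ hm, add_zero]
  have hlow' := fun v hv x hx => hends a₀ d₀ v hv x hx S (hlow v hv x)
  have hup' := fun v hv x hx => hends a₁ d₁ v hv x hx R (hup v hv x)
  refine hamiltonianIsotopic_of_trajectories (contDiff_sheetHam (φ := φ) V η hψ h₀ h₁)
    (fibrePeriodic_sheetHam V η) (fibreBounded_sheetHam V η hψ h₀ h₁ z₀ z₁ hsep.gradient_le) ?_ ?_
  · rintro z (⟨x, hx, hz⟩ | hz)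
    · have hc : ∀ p, IsSolution (hamField (φ.sheetHam V ψ η a₀ a₁)) fun _ => (x, p) := fun p =>
        hconst x p fun v hv h => absurd (hx v hv) (not_le.2 h.2)
      rcases hz with rfl | rfl
      · exact ⟨_, hc 0, rfl, Or.inl ⟨x, hx, Or.inl rfl⟩⟩
      · exact ⟨_, hc _, rfl, Or.inl ⟨x, hx, Or.inr rfl⟩⟩
    · simp only [mem_iUnion] at hz
      obtain ⟨v, hv, x, hcx, hx, rfl | rfl⟩ := hz
      · obtain ⟨γ, hγ, e0, e1⟩ := hup' v hv x hx
        refine ⟨γ, hγ, by rw [e0], Or.inr ?_⟩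
        simp only [mem_iUnion]
        exact ⟨v, hv, x, hcx, hx, Or.inl (by rw [e1])⟩
      · obtain ⟨γ, hγ, e0, e1⟩ := hlow' v hv x hx
        refine ⟨γ, hγ, by rw [e0], Or.inr ?_⟩
        simp only [mem_iUnion]
        exact ⟨v, hv, x, hcx, hx, Or.inr (by rw [e1])⟩
  · rintro z (⟨x, hx, hz⟩ | hz)
    · have hc : ∀ p, IsSolution (hamField (φ.sheetHam V ψ η a₀ a₁)) fun _ => (x, p) := fun p =>
        hconst x p fun v hv h => absurd (hx v hv) (not_le.2 h.2)
      rcases hz with rfl | rfl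
      · exact ⟨_, hc 0, rfl, Or.inl ⟨x, hx, Or.inl rfl⟩⟩
      · exact ⟨_, hc _, rfl, Or.inl ⟨x, hx, Or.inr rfl⟩⟩
    · simp only [mem_iUnion] at hz
      obtain ⟨v, hv, x, hcx, hx, rfl | rfl⟩ := hz
      · obtain ⟨γ, hγ, e0, e1⟩ := hup' v hv x hx
        refine ⟨γ, hγ, by rw [e1], Or.inr ?_⟩
        simp only [mem_iUnion]
        exact ⟨v, hv, x, hcx, hx, Or.inl (by rw [e0])⟩
      · obtain ⟨γ, hγ, e0, e1⟩ := hlow' v hv x hx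
        refine ⟨γ, hγ, by rw [e1], Or.inr ?_⟩
        simp only [mem_iUnion]
        exact ⟨v, hv, x, hcx, hx, Or.inr (by rw [e0])⟩

end TropicalPolynomial

end TropLag
end

noncomputable section

namespace TropLag

open Set Metric Filter Topology
open scoped NNReal Pointwise

variable {n : ℕ}

/-! ### The Hamiltonian of a tube -/

/-- The square of the norm, modified near `0` so that it does not vanish. -/
def normSqReg (δ : ℝ) (d : Q n) : ℝ := ‖d‖ ^ 2 + Real.smoothTransition (1 - ‖d‖ ^ 2 / δ ^ 2)

lemma normSqReg_pos {δ : ℝ} (d : Q n) : 0 < normSqReg δ d := by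
  unfold normSqReg
  by_cases hd : d = 0
  · subst hd
    simp
  · have := norm_pos_iff.2 hd
    have := Real.smoothTransition.nonneg (1 - ‖d‖ ^ 2 / δ ^ 2)
    positivity

lemma contDiff_normSqReg (δ : ℝ) : ContDiff ℝ ∞ (normSqReg (n := n) δ) := by
  have h : ContDiff ℝ ∞ fun d : Q n => ‖d‖ ^ 2 := contDiff_norm_sq ℝ
  exact h.add (Real.smoothTransition.contDiff.comp (contDiff_const.sub (h.div_const _)))

lemma normSqReg_eq {δ : ℝ} (hδ : 0 < δ) {d : Q n} (h : δ ≤ ‖d‖) : normSqReg δ d = ‖d‖ ^ 2 := by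
  unfold normSqReg
  rw [Real.smoothTransition.zero_of_nonpos, add_zero]
  rw [sub_nonpos, one_le_div (by positivity)]
  gcongr

/-- The coordinate of `p` along `d`. -/
def coordAlong (δ : ℝ) (d p : Q n) : ℝ := inner ℝ p d / normSqReg δ d

lemma contDiff_coordAlong (δ : ℝ) : ContDiff ℝ ∞ fun q : Q n × Q n => coordAlong δ q.1 q.2 :=
  (contDiff_snd.inner ℝ contDiff_fst).div ((contDiff_normSqReg δ).comp contDiff_fst)
    fun q => (normSqReg_pos q.1).ne'

lemma coordAlong_smul {δ : ℝ} (hδ : 0 < δ) {d : Q n} (h : δ ≤ ‖d‖) (τ : ℝ) :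
    coordAlong δ d (τ • d) = τ := by
  have : 0 < ‖d‖ := hδ.trans_le h
  rw [coordAlong, normSqReg_eq hδ h, real_inner_smul_left, real_inner_self_eq_norm_sq]
  field_simp

/-- The function `w (g τ + B ((τ - 1/2) f))` of the coordinate `τ` of `p` along `d`, cut off to a
neighbourhood of the segment from `0` to `d`. -/
def tubeFun (B : ℝ → ℝ) (θ : ContDiffBump (1 / 2 : ℝ)) (η : ContDiffBump (0 : Q n)) (δ : ℝ)
    (q : (ℝ × ℝ × ℝ × Q n) × Q n) : ℝ :=
  q.1.1 * (q.1.2.1 * coordAlong δ q.1.2.2.2 q.2 +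
      B ((coordAlong δ q.1.2.2.2 q.2 - 1 / 2) * q.1.2.2.1)) *
    θ (coordAlong δ q.1.2.2.2 q.2) * η (q.2 - coordAlong δ q.1.2.2.2 q.2 • q.1.2.2.2)

section Tube

variable {B : ℝ → ℝ} (θ : ContDiffBump (1 / 2 : ℝ)) (η : ContDiffBump (0 : Q n)) (δ : ℝ)

lemma contDiff_tubeFun (hB : ContDiff ℝ ∞ B) : ContDiff ℝ ∞ (tubeFun B θ η δ) := by
  have hc : ContDiff ℝ ∞ fun q : (ℝ × ℝ × ℝ × Q n) × Q n => coordAlong δ q.1.2.2.2 q.2 :=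
    (contDiff_coordAlong δ).comp
      (by fun_prop : ContDiff ℝ ∞ fun q : (ℝ × ℝ × ℝ × Q n) × Q n => (q.1.2.2.2, q.2))
  refine ((ContDiff.mul (by fun_prop) (ContDiff.add (ContDiff.mul (by fun_prop) hc) ?_)).mul
    (θ.contDiff.comp hc)).mul (η.contDiff.comp ?_)
  · exact hB.comp ((hc.sub contDiff_const).mul (by fun_prop))
  · exact contDiff_snd.sub (hc.smul (by fun_prop))

lemma fibreSupport_tubeFun :
    FibreSupport (tubeFun B θ η δ) (η.rOut + (1 / 2 + θ.rOut)) := by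
  rintro ⟨w, g, f, d⟩ p h
  unfold tubeFun at h
  simp only at h
  set τ := coordAlong δ d p with hτ
  have h1 : ‖p - τ • d‖ < η.rOut := by
    by_contra hcon
    exact h (by rw [η.zero_of_le_dist (by simpa using hcon), mul_zero])
  have h2 : |τ - 1 / 2| < θ.rOut := by
    by_contra hcon
    exact h (by rw [θ.zero_of_le_dist (by simpa [Real.dist_eq] using hcon), mul_zero, zero_mul])
  have h3 : |τ| ≤ 1 / 2 + θ.rOut := by
    have := abs_add_le (τ - 1 / 2) (1 / 2)
    rw [sub_add_cancel, abs_of_pos (by norm_num : (0 : ℝ) < 1 / 2)] at this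
    linarith
  have h4 : ‖p‖ ≤ ‖p - τ • d‖ + |τ| * ‖d‖ := by
    have := norm_add_le (p - τ • d) (τ • d)
    rwa [sub_add_cancel, norm_smul, Real.norm_eq_abs] at this
  have h5 : ‖d‖ ≤ ‖(w, g, f, d)‖ :=
    (le_max_right ‖f‖ ‖d‖).trans ((le_max_right ‖g‖ _).trans (le_max_right ‖w‖ _))
  have h6 := norm_nonneg d
  have h7 := η.rOut_pos
  have h8 := θ.rOut_pos
  have h9 := abs_nonneg τ
  calc ‖p‖ ≤ η.rOut + (1 / 2 + θ.rOut) * ‖(w, g, f, d)‖ := by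
        have := mul_le_mul h3 h5 h6 (by linarith)
        linarith
    _ ≤ _ := by nlinarith [h6.trans h5]

/-- Close to the segment from `0` to `d`, the periodization of `tubeFun` is the function without
cut-off. -/
lemma periodize_tubeFun {K : ℝ} {w g f : ℝ} {d p : Q n} {δ' : ℝ} (hK : ‖d‖ ≤ 2 * K)
    (hneck : w ≠ 0 → ∀ l : ℝ, |l| ≤ 1 → ∀ k ≠ 0, δ' ≤ ‖l • d - intVec k‖)
    (hsmall : η.rIn + η.rOut + (θ.rIn + θ.rOut - 1) * (2 * K) ≤ δ') (hθ : 1 / 2 ≤ θ.rIn)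
    (h1 : |coordAlong δ d p - 1 / 2| ≤ θ.rIn) (h2 : ‖p - coordAlong δ d p • d‖ ≤ η.rIn) :
    periodize (tubeFun B θ η δ) ((w, g, f, d), p) =
      w * (g * coordAlong δ d p + B ((coordAlong δ d p - 1 / 2) * f)) := by
  rw [periodize_eq_single 0]
  · simp only [intVec_zero, sub_zero, tubeFun]
    rw [θ.one_of_mem_closedBall (by simpa [Real.dist_eq] using h1),
      η.one_of_mem_closedBall (by simpa using h2), mul_one, mul_one]
  · intro l hl
    by_contra hne
    unfold tubeFun at hne
    simp only at hne
    have hw : w ≠ 0 := fun h => hne (by rw [h]; ring)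
    set τ := coordAlong δ d p
    set τ' := coordAlong δ d (p - intVec l)
    have h3 : ‖p - intVec l - τ' • d‖ < η.rOut := by
      by_contra hcon
      exact hne (by rw [η.zero_of_le_dist (by simpa using hcon), mul_zero])
    have h4 : |τ' - 1 / 2| < θ.rOut := by
      by_contra hcon
      exact hne (by
        rw [θ.zero_of_le_dist (by simpa [Real.dist_eq] using hcon), mul_zero, zero_mul])
    -- If `p` and `p - l` were both in the tube, `(τ' - τ) d` would be close to `-l`. The factor may
    -- slightly exceed one in absolute value, so it is clamped to `[-1, 1]` where `hneck` applies;
    -- the error is part of `hsmall`.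
    obtain ⟨q, hq, hq'⟩ : ∃ q : ℝ, |q| ≤ 1 ∧ |q - (τ' - τ)| ≤ θ.rIn + θ.rOut - 1 := by
      have hle : |τ' - τ| ≤ θ.rIn + θ.rOut := by
        have := abs_sub_le τ' (1 / 2) τ
        rw [abs_sub_comm (1 / 2) τ] at this
        linarith
      rw [abs_le] at hle
      have hp : 0 ≤ θ.rIn + θ.rOut - 1 := by linarith [θ.rIn_lt_rOut]
      refine ⟨max (-1) (min 1 (τ' - τ)), ?_, ?_⟩
      · rw [abs_le]
        exact ⟨le_max_left _ _, max_le (by norm_num) (min_le_left _ _)⟩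
      · rw [abs_le]
        rcases le_total 1 (τ' - τ) with h | h
        · rw [min_eq_left h, max_eq_right (by norm_num)]
          constructor <;> linarith
        · rw [min_eq_right h]
          rcases le_total (-1) (τ' - τ) with h' | h'
          · rw [max_eq_right h']
            constructor <;> linarith
          · rw [max_eq_left h']
            constructor <;> linarith
    have h5 := hneck hw q hq (-l) (neg_ne_zero.2 hl)
    rw [intVec_neg] at h5
    have h6 : q • d - -intVec l = (p - τ • d) - (p - intVec l - τ' • d) + (q - (τ' - τ)) • d := by
      module
    have h7 : ‖q • d - -intVec l‖ ≤ ‖p - τ • d‖ + ‖p - intVec l - τ' • d‖ +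
        |q - (τ' - τ)| * ‖d‖ := by
      rw [h6]
      refine (norm_add_le _ _).trans (add_le_add (norm_sub_le _ _) ?_)
      rw [norm_smul, Real.norm_eq_abs]
    have h8 : |q - (τ' - τ)| * ‖d‖ ≤ (θ.rIn + θ.rOut - 1) * (2 * K) :=
      mul_le_mul hq' hK (norm_nonneg _) ((abs_nonneg _).trans hq')
    linarith

end Tube

/-- The derivative of the coordinate along `d(x)`, for a map `d`, at a multiple of `d`. -/
lemma hasFDerivAt_coordAlong {d : Q n → Q n} {d' : Q n →L[ℝ] Q n} {x : Q n}
    (hd : HasFDerivAt d d' x) (hsymm : ∀ u w, inner ℝ (d' u) w = inner ℝ u (d' w)) {δ : ℝ}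
    (hδ : 0 < δ) (hx : δ < ‖d x‖) (τ : ℝ) :
    HasFDerivAt (fun y : CotQ n => coordAlong δ (d y.1) y.2)
      ((‖d x‖ ^ 2)⁻¹ • ((innerSL ℝ (d x)).comp (ContinuousLinearMap.snd ℝ (Q n) (Q n)) -
        τ • (innerSL ℝ (d' (d x))).comp (ContinuousLinearMap.fst ℝ (Q n) (Q n))))
      (x, τ • d x) := by
  have hpos : 0 < ‖d x‖ := hδ.trans hx
  have hd1 : HasFDerivAt (fun y : CotQ n => d y.1)
      (d'.comp (ContinuousLinearMap.fst ℝ (Q n) (Q n))) (x, τ • d x) :=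
    hd.comp (x, τ • d x) hasFDerivAt_fst
  have hnum := (hasFDerivAt_snd (𝕜 := ℝ) (p := (x, τ • d x)) (E := Q n) (F := Q n)).inner ℝ hd1
  have hden := hd1.norm_sq
  have hinv := (hasDerivAt_inv (by positivity : ‖d x‖ ^ 2 ≠ 0)).comp_hasFDerivAt (x, τ • d x) hden
  have hdiv := hnum.mul hinv
  have hev : (fun y : CotQ n => coordAlong δ (d y.1) y.2) =ᶠ[𝓝 (x, τ • d x)]
      ((fun y : CotQ n => inner ℝ y.2 (d y.1)) * (Inv.inv ∘ fun y => ‖d y.1‖ ^ 2)) := by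
    have hc : ContinuousAt (fun y : CotQ n => ‖d y.1‖) (x, τ • d x) := hd1.continuousAt.norm
    filter_upwards [hc.eventually_const_lt hx] with y hy
    rw [coordAlong, normSqReg_eq hδ hy.le, div_eq_mul_inv]
    rfl
  refine (hdiv.congr_of_eventuallyEq hev).congr_fderiv (ContinuousLinearMap.ext fun W => ?_)
  have h1 : inner ℝ (d x) (d' W.1) = inner ℝ (d' (d x)) W.1 := (hsymm _ _).symm
  simp only [add_apply, FunLike.coe_smul, Pi.smul_apply, ContinuousLinearMap.comp_apply,
    ContinuousLinearMap.prod_apply, fderivInnerCLM_apply, sub_apply, innerSL_apply_apply,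
    ContinuousLinearMap.coe_fst', ContinuousLinearMap.coe_snd', real_inner_smul_left,
    real_inner_self_eq_norm_sq, smul_eq_mul, Function.comp_apply, two_smul ℕ, h1,
    real_inner_comm (d x) W.2]
  field_simp
  ring

end TropLag
end

noncomputable section

namespace TropLag

open Set Metric Filter Topology
open scoped NNReal Pointwise

variable {n : ℕ}

/-! ### Moving the necks -/

/-- A path `ψ - σ g`, `σ ∈ [0, 1]`, of potentials with uniformly separated sheets, together with a
function `B` of the coordinate `u` along the necks. -/
structure NeckMove (φ : TropicalPolynomial n) where
  ψ : Q n → ℝ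
  g : Q n → ℝ
  B : ℝ → ℝ
  κ : ℝ
  c : ℝ
  m : ℝ
  M : ℝ
  K : ℝ
  δ : ℝ
  C : ℝ
  ψ_smooth : ContDiff ℝ ∞ ψ
  g_smooth : ContDiff ℝ ∞ g
  B_smooth : ContDiff ℝ ∞ B
  g_bound : ∀ x, |g x| ≤ C
  B_low : ∀ u, u ≤ -c → B u = 0
  B_high : ∀ u, c ≤ u → B u = κ
  m_pos : 0 < m
  m_le : m ≤ 2 * c
  c_lt : 2 * c < M
  δ_pos : 0 < δ
  sep : ∀ σ ∈ Icc (0 : ℝ) 1, φ.Separated (fun x => ψ x - σ * g x) (m / 4) M K δ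

namespace NeckMove

variable {φ : TropicalPolynomial n} (N : NeckMove φ)

/-- The potential at time `σ`. -/
def pot (σ : ℝ) (x : Q n) : ℝ := N.ψ x - σ * N.g x

/-- The primitive at the vertex `v` and time `σ`. -/
def f (σ : ℝ) (v : Fin n → ℤ) (x : Q n) : ℝ := φ.prim (N.pot σ) v x

/-- The differential of the primitive at the vertex `v` and time `σ`. -/
def d (σ : ℝ) (v : Fin n → ℤ) (x : Q n) : Q n := gradient (φ.prim (N.pot σ) v) x

lemma separated {σ : ℝ} (hσ : σ ∈ Icc (0 : ℝ) 1) :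
    φ.Separated (N.pot σ) (N.m / 4) N.M N.K N.δ := N.sep σ hσ

lemma contDiff_pot (σ : ℝ) : ContDiff ℝ ∞ (N.pot σ) :=
  N.ψ_smooth.sub (contDiff_const.mul N.g_smooth)

lemma contDiff_f_at (σ : ℝ) (v : Fin n → ℤ) : ContDiff ℝ ∞ (N.f σ v) :=
  φ.contDiff_prim (N.contDiff_pot σ) v

lemma contDiff_d_at (σ : ℝ) (v : Fin n → ℤ) : ContDiff ℝ ∞ (N.d σ v) :=
  contDiff_gradient (N.contDiff_f_at σ v)

lemma f_eq (σ : ℝ) (v : Fin n → ℤ) (x : Q n) : N.f σ v x = φ.prim N.ψ v x + σ * N.g x := by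
  unfold f pot TropicalPolynomial.prim
  ring

lemma gradient_pot (σ : ℝ) (x : Q n) :
    gradient (N.pot σ) x = gradient N.ψ x - σ • gradient N.g x := by
  have h1 := (N.ψ_smooth.differentiable (by simp) x).hasGradientAt.hasFDerivAt
  have h2 := (N.g_smooth.differentiable (by simp) x).hasGradientAt.hasFDerivAt
  have h3 : HasGradientAt (N.pot σ) (gradient N.ψ x - σ • gradient N.g x) x := by
    rw [hasGradientAt_iff_hasFDerivAt, map_sub, map_smul]
    exact h1.sub (h2.const_smul σ)
  exact h3.gradient

lemma d_eq_sub (σ : ℝ) (v : Fin n → ℤ) (x : Q n) :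
    N.d σ v x = intVec v - gradient (N.pot σ) x :=
  φ.gradient_prim ((N.contDiff_pot σ).differentiable (by simp)) v x

lemma d_eq (σ : ℝ) (v : Fin n → ℤ) (x : Q n) :
    N.d σ v x = intVec v - gradient N.ψ x + σ • gradient N.g x := by
  rw [d_eq_sub, gradient_pot]
  abel

lemma contDiff_f (v : Fin n → ℤ) : ContDiff ℝ ∞ fun q : ℝ × Q n => N.f q.1 v q.2 := by
  simp_rw [f_eq]
  exact ((φ.contDiff_prim N.ψ_smooth v).comp contDiff_snd).add
    (contDiff_fst.mul (N.g_smooth.comp contDiff_snd))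

lemma contDiff_gradient_pot : ContDiff ℝ ∞ fun q : ℝ × Q n => gradient (N.pot q.1) q.2 := by
  simp_rw [gradient_pot]
  exact ((contDiff_gradient N.ψ_smooth).comp contDiff_snd).sub
    (contDiff_fst.smul ((contDiff_gradient N.g_smooth).comp contDiff_snd))

lemma contDiff_d (v : Fin n → ℤ) : ContDiff ℝ ∞ fun q : ℝ × Q n => N.d q.1 v q.2 := by
  simp_rw [d_eq_sub]
  exact contDiff_const.sub N.contDiff_gradient_pot

lemma norm_d_le {σ : ℝ} (hσ : σ ∈ Icc (0 : ℝ) 1) {v : Fin n → ℤ} (hv : v ∈ φ.vertexSet) (x : Q n) :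
    ‖N.d σ v x‖ ≤ 2 * N.K :=
  (N.separated hσ).norm_gradient_prim_le (N.contDiff_pot σ) hv x

lemma K_nonneg : 0 ≤ N.K :=
  (norm_nonneg _).trans ((N.sep 0 (by simp)).gradient_le 0)

/-- Since `df_v = v - dψ`, this is the separation of the two sheets at the lattice point `v`. The
other primitives are at least `M` there, so its hypothesis holds. -/
lemma le_norm_d {σ : ℝ} (hσ : σ ∈ Icc (0 : ℝ) 1) {v : Fin n → ℤ} (hv : v ∈ φ.vertexSet) {x : Q n}
    (h₁ : N.m / 4 ≤ N.f σ v x) (h₂ : N.f σ v x < N.M) : N.δ ≤ ‖N.d σ v x‖ := by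
  rw [d_eq_sub, norm_sub_rev]
  refine (N.separated hσ).outer x (fun w hw => ?_) v
  by_contra hcon
  have hlt : φ.prim (N.pot σ) w x < N.M := by linarith [N.m_le, N.c_lt, N.m_pos]
  have := (N.separated hσ).disjoint v hv w hw x h₂.le hlt
  subst this
  exact hcon h₁

/-- The width of the cut-off regions. -/
def h : ℝ := min (N.m / 4) ((N.M - 2 * N.c) / 4)

lemma h_pos : 0 < N.h := lt_min (by linarith [N.m_pos]) (by linarith [N.c_lt])

lemma h_le' : N.h ≤ (N.M - 2 * N.c) / 4 := min_le_right _ _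

/-- A cut-off function of the values of the primitives. -/
def cut : ContDiffBump ((N.m / 2 + (2 * N.c + N.h)) / 2) :=
  ⟨(2 * N.c + N.h - N.m / 2) / 2, (2 * N.c + N.h - N.m / 2) / 2 + N.h,
    by linarith [N.h_pos, N.m_le, N.m_pos], by linarith [N.h_pos]⟩

/-- A second cut-off function, equal to one on the support of the first. -/
def cutOuter : ContDiffBump ((N.m / 2 + (2 * N.c + N.h)) / 2) :=
  ⟨N.cut.rOut, N.cut.rOut + 1, N.cut.rOut_pos, by linarith⟩

/-- Neck values lie in `[m, 2c]`. The plateau exceeds this interval on both sides, so slightly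
displaced values still see the uncut Hamiltonian. -/
lemma cut_eq_one {t : ℝ} (h₁ : N.m / 2 ≤ t) (h₂ : t ≤ 2 * N.c + N.h) : N.cut t = 1 := by
  refine N.cut.one_of_mem_closedBall ?_
  rw [mem_closedBall, Real.dist_eq, abs_le]
  simp only [cut]
  constructor <;> linarith

lemma cut_eq_zero {t : ℝ} (h : 2 * N.c + 2 * N.h ≤ t) : N.cut t = 0 := by
  refine N.cut.zero_of_le_dist ?_
  rw [Real.dist_eq]
  refine le_trans ?_ (le_abs_self _)
  simp only [cut]
  linarith

lemma cut_eq_zero_of_le {t : ℝ} (h : N.M ≤ t) : N.cut t = 0 :=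
  N.cut_eq_zero (by linarith [N.h_le', N.c_lt])

/-- The tube parameters must be bounded, which `f_v` is not; replacing it by `cutOuter f_v * f_v`
makes them so and changes nothing where `cut` is nonzero. -/
lemma cut_mul_comp (F : ℝ → ℝ) (t : ℝ) : N.cut t * F (N.cutOuter t * t) = N.cut t * F t := by
  by_cases ht : dist t ((N.m / 2 + (2 * N.c + N.h)) / 2) ≤ N.cut.rOut
  · rw [N.cutOuter.one_of_mem_closedBall (mem_closedBall.2 ht), one_mul]
  · rw [N.cut.zero_of_le_dist (not_le.1 ht).le, zero_mul, zero_mul]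

/-- The radius of the tubes around the segments. -/
def ρ : ℝ := min (1 / 4) (N.δ / 16)

lemma ρ_pos : 0 < N.ρ := lt_min (by norm_num) (by linarith [N.δ_pos])

/-- The bump function in the directions normal to the segments. -/
def η : ContDiffBump (0 : Q n) := ⟨N.ρ, 2 * N.ρ, N.ρ_pos, by linarith [N.ρ_pos]⟩

/-- The bump function in the direction of the segments. -/
def θ : ContDiffBump (1 / 2 : ℝ) :=
  ⟨1 / 2 + N.δ / (32 * (N.K + 1)), 1 / 2 + 2 * (N.δ / (32 * (N.K + 1))),
    by have := N.K_nonneg; have := N.δ_pos; positivity,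
    by have := N.K_nonneg; have := N.δ_pos; have : 0 < N.δ / (32 * (N.K + 1)) := by positivity
       linarith⟩

lemma half_lt_θ : 1 / 2 < N.θ.rIn := by
  have := N.K_nonneg
  have := N.δ_pos
  have : 0 < N.δ / (32 * (N.K + 1)) := by positivity
  change 1 / 2 < 1 / 2 + N.δ / (32 * (N.K + 1))
  linarith

/-- The normal radii contribute `3ρ ≤ 3δ/16`, and the excess of the tangential radii over the
segment contributes at most another `3δ/16`. -/
lemma small : N.η.rIn + N.η.rOut + (N.θ.rIn + N.θ.rOut - 1) * (2 * N.K) ≤ N.δ := by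
  have hK := N.K_nonneg
  have hδ := N.δ_pos
  have h1 : N.ρ ≤ N.δ / 16 := min_le_right _ _
  have h2 : N.δ / (32 * (N.K + 1)) * N.K ≤ N.δ / 32 := by
    rw [div_mul_eq_mul_div, div_le_div_iff₀ (by positivity) (by norm_num)]
    nlinarith
  change N.ρ + 2 * N.ρ + (1 / 2 + N.δ / (32 * (N.K + 1)) +
    (1 / 2 + 2 * (N.δ / (32 * (N.K + 1)))) - 1) * (2 * N.K) ≤ N.δ
  nlinarith

lemma η_rOut_le : N.η.rOut ≤ 1 / 2 := by
  have : N.ρ ≤ 1 / 4 := min_le_left _ _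
  change 2 * N.ρ ≤ 1 / 2
  linarith

lemma two_mul_η_rOut_le : 2 * N.η.rOut ≤ N.δ := by
  have : N.ρ ≤ N.δ / 16 := min_le_right _ _
  have := N.δ_pos
  change 2 * (2 * N.ρ) ≤ N.δ
  linarith

/-- The vertices, as a finite set. -/
def V (_N : NeckMove φ) : Finset (Fin n → ℤ) := φ.vertexSet_finite.toFinset

lemma mem_V {v : Fin n → ℤ} : v ∈ N.V ↔ v ∈ φ.vertexSet := by simp [V]

/-- The parameters of the tube at the vertex `v`. -/
def param (v : Fin n → ℤ) (q : ℝ × Q n) : ℝ × ℝ × ℝ × Q n :=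
  (N.cut (N.f q.1 v q.2), N.g q.2, N.cutOuter (N.f q.1 v q.2) * N.f q.1 v q.2, N.d q.1 v q.2)

/-- The part of the Hamiltonian which moves the upper sheet. -/
def sheetPart (q : ℝ × CotQ n) : ℝ :=
  (1 - ∑ v ∈ N.V, N.cut (N.f q.1 v q.2.1)) * (N.g q.2.1 + N.κ) *
    latticeBump N.η (q.2.2 + gradient (N.pot q.1) q.2.1)

/-- The part of the Hamiltonian which moves the neck at `v`. -/
def tubePart (v : Fin n → ℤ) (q : ℝ × CotQ n) : ℝ :=
  periodize (tubeFun N.B N.θ N.η (N.δ / 2)) (N.param v (q.1, q.2.1), q.2.2)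

/-- The Hamiltonian which moves the sheets and the necks. -/
def ham (q : ℝ × CotQ n) : ℝ := -(N.sheetPart q + ∑ v ∈ N.V, N.tubePart v q)

lemma contDiff_param (v : Fin n → ℤ) : ContDiff ℝ ∞ (N.param v) :=
  (N.cut.contDiff.comp (N.contDiff_f v)).prodMk ((N.g_smooth.comp contDiff_snd).prodMk
    (((N.cutOuter.contDiff.comp (N.contDiff_f v)).mul (N.contDiff_f v)).prodMk (N.contDiff_d v)))

lemma contDiff_periodize_tubeFun :
    ContDiff ℝ ∞ (periodize (tubeFun N.B N.θ N.η (N.δ / 2))) :=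
  contDiff_periodize (by have := N.η.rOut_pos; have := N.θ.rOut_pos; positivity)
    (fibreSupport_tubeFun _ _ _) (contDiff_tubeFun _ _ _ N.B_smooth)

lemma contDiff_tubePart (v : Fin n → ℤ) : ContDiff ℝ ∞ (N.tubePart v) :=
  N.contDiff_periodize_tubeFun.comp (((N.contDiff_param v).comp
    (by fun_prop : ContDiff ℝ ∞ fun q : ℝ × CotQ n => (q.1, q.2.1))).prodMk contDiff_snd.snd)

lemma contDiff_coeff :
    ContDiff ℝ ∞ fun q : ℝ × Q n => (1 - ∑ v ∈ N.V, N.cut (N.f q.1 v q.2)) * (N.g q.2 + N.κ) :=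
  (contDiff_const.sub (ContDiff.sum fun v _ => N.cut.contDiff.comp (N.contDiff_f v))).mul
    ((N.g_smooth.comp contDiff_snd).add contDiff_const)

lemma contDiff_sheetPart : ContDiff ℝ ∞ N.sheetPart := by
  have hq : ContDiff ℝ ∞ fun q : ℝ × CotQ n => (q.1, q.2.1) := by fun_prop
  exact (N.contDiff_coeff.comp hq).mul ((contDiff_latticeBump N.η).comp
    (contDiff_snd.snd.add (N.contDiff_gradient_pot.comp hq)))

lemma contDiff_ham : ContDiff ℝ ∞ N.ham :=
  (N.contDiff_sheetPart.add (ContDiff.sum fun v _ => N.contDiff_tubePart v)).neg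

lemma fibrePeriodic_ham : FibrePeriodic N.ham := by
  intro t z k
  simp only [ham, sheetPart, tubePart, Prod.fst_add, Prod.snd_add, add_zero,
    periodize_add_intVec, latticeBump_add_intVec, add_right_comm _ (intVec k)]

lemma fibreBounded_ham : FibreBounded N.ham := by
  refine FibreBounded.neg (FibreBounded.add N.contDiff_sheetPart
    (ContDiff.sum fun v _ => N.contDiff_tubePart v) ?_
    (FibreBounded.sum _ (fun v _ => N.contDiff_tubePart v) fun v hv => ?_))
  · refine fibreBounded_of_param
      (P := fun q : (ℝ × Q n) × Q n => q.1.1 * latticeBump N.η (q.2 + q.1.2))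
      ((contDiff_fst.comp contDiff_fst).mul ((contDiff_latticeBump N.η).comp (by fun_prop)))
      (fun a p k => by simp only [latticeBump_add_intVec, add_right_comm _ (intVec k)])
      (α := fun q => ((1 - ∑ v ∈ N.V, N.cut (N.f q.1 v q.2)) * (N.g q.2 + N.κ),
        gradient (N.pot q.1) q.2))
      (N.contDiff_coeff.prodMk N.contDiff_gradient_pot)
      ⟨max ((1 + N.V.card) * (N.C + |N.κ|)) N.K, fun t ht x => ?_⟩
    refine max_le_max ?_ ((N.separated ht).gradient_le x)
    rw [norm_mul, Real.norm_eq_abs, Real.norm_eq_abs]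
    refine mul_le_mul ?_ ((abs_add_le _ _).trans (add_le_add_left (N.g_bound x) _))
      (abs_nonneg _) (by positivity)
    refine (abs_sub _ _).trans ?_
    rw [abs_one]
    gcongr
    refine (Finset.abs_sum_le_sum_abs _ _).trans ?_
    refine (Finset.sum_le_card_nsmul _ _ 1 fun v _ => ?_).trans (by simp)
    rw [abs_of_nonneg N.cut.nonneg]
    exact N.cut.le_one
  · obtain ⟨C', hC', hb⟩ := bounded_of_zero_outside (a := fun t => N.cutOuter t * t)
      (N.cutOuter.continuous.mul continuous_id)
      (l := (N.m / 2 + (2 * N.c + N.h)) / 2 - N.cutOuter.rOut)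
      (r := (N.m / 2 + (2 * N.c + N.h)) / 2 + N.cutOuter.rOut) (fun t ht => by
        rw [N.cutOuter.zero_of_le_dist, zero_mul]
        by_contra hcon
        rw [not_le, Real.dist_eq, abs_lt] at hcon
        exact ht ⟨by linarith [hcon.1], by linarith [hcon.2]⟩)
    refine fibreBounded_of_param N.contDiff_periodize_tubeFun
      (fun a p k => periodize_add_intVec _ a p k) (N.contDiff_param v)
      ⟨max 1 (max N.C (max C' (2 * N.K))), fun t ht x => ?_⟩
    refine max_le_max ?_ (max_le_max (N.g_bound x)
      (max_le_max (hb _) (N.norm_d_le ht (N.mem_V.1 hv) x)))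
    change ‖N.cut (N.f t v x)‖ ≤ 1
    rw [Real.norm_eq_abs, abs_of_nonneg N.cut.nonneg]
    exact N.cut.le_one

/-! #### The local form of the Hamiltonian -/

lemma tubePart_eq_zero {σ : ℝ} {v : Fin n → ℤ} {y : CotQ n} (h : N.cut (N.f σ v y.1) = 0) :
    N.tubePart v (σ, y) = 0 := by
  unfold tubePart periodize
  refine finsum_eq_zero_of_forall_eq_zero fun k => ?_
  simp [tubeFun, param, h]

/-- Near a point of the segment the other tubes are cut off and a single lattice translate
contributes to the periodization. The sheet part is either switched off by `cut = 1` or multiplied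
by a bump locally equal to `e`. -/
lemma ham_eventuallyEq {σ : ℝ} (hσ : σ ∈ Icc (0 : ℝ) 1) {v : Fin n → ℤ} (hv : v ∈ φ.vertexSet)
    {x : Q n} {τ e : ℝ} (hτ : τ ∈ Icc (0 : ℝ) 1) (h₁ : N.m / 2 < N.f σ v x)
    (h₂ : N.f σ v x < N.M)
    (he : N.f σ v x < 2 * N.c + N.h ∨ (τ = e ∧ (e = 0 ∨ e = 1))) :
    ∀ᶠ y in 𝓝 (x, τ • N.d σ v x), N.ham (σ, y) =
      -((1 - N.cut (N.f σ v y.1)) * (N.g y.1 + N.κ) * e +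
        N.cut (N.f σ v y.1) * (N.g y.1 * coordAlong (N.δ / 2) (N.d σ v y.1) y.2 +
          N.B ((coordAlong (N.δ / 2) (N.d σ v y.1) y.2 - 1 / 2) * N.f σ v y.1))) := by
  have hδ := N.δ_pos
  have hfc : Continuous fun y : CotQ n => N.f σ v y.1 :=
    (N.contDiff_f_at σ v).continuous.comp continuous_fst
  have hdc : Continuous fun y : CotQ n => N.d σ v y.1 :=
    (N.contDiff_d_at σ v).continuous.comp continuous_fst
  have hcc : Continuous fun y : CotQ n => coordAlong (N.δ / 2) (N.d σ v y.1) y.2 :=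
    (contDiff_coordAlong (n := n) (N.δ / 2)).continuous.comp (hdc.prodMk continuous_snd)
  have hgc : Continuous fun y : CotQ n => y.2 + gradient (N.pot σ) y.1 :=
    continuous_snd.add ((contDiff_gradient (N.contDiff_pot σ)).continuous.comp continuous_fst)
  have hm := N.m_pos
  have hd : N.δ ≤ ‖N.d σ v x‖ := N.le_norm_d hσ hv (by linarith) h₂
  have hcoord : coordAlong (N.δ / 2) (N.d σ v x) (τ • N.d σ v x) = τ :=
    coordAlong_smul (by linarith) (by linarith) τ
  have e1 : ∀ᶠ y in 𝓝 (x, τ • N.d σ v x), N.m / 2 < N.f σ v y.1 :=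
    hfc.continuousAt.eventually_const_lt h₁
  have e2 : ∀ᶠ y in 𝓝 (x, τ • N.d σ v x), N.f σ v y.1 < N.M :=
    hfc.continuousAt.eventually_lt_const h₂
  have e3 : ∀ᶠ y in 𝓝 (x, τ • N.d σ v x),
      |coordAlong (N.δ / 2) (N.d σ v y.1) y.2 - 1 / 2| < N.θ.rIn := by
    refine ((hcc.sub continuous_const).abs.continuousAt).eventually_lt_const ?_
    change |coordAlong (N.δ / 2) (N.d σ v x) (τ • N.d σ v x) - 1 / 2| < N.θ.rIn
    rw [hcoord]
    refine lt_of_le_of_lt ?_ N.half_lt_θ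
    rw [abs_le]
    constructor <;> linarith [hτ.1, hτ.2]
  have e4 : ∀ᶠ y in 𝓝 (x, τ • N.d σ v x),
      ‖y.2 - coordAlong (N.δ / 2) (N.d σ v y.1) y.2 • N.d σ v y.1‖ < N.η.rIn := by
    refine ((continuous_snd.sub (hcc.smul hdc)).norm.continuousAt).eventually_lt_const ?_
    change ‖τ • N.d σ v x - coordAlong (N.δ / 2) (N.d σ v x) (τ • N.d σ v x) • N.d σ v x‖ < N.η.rIn
    rw [hcoord, sub_self, norm_zero]
    exact N.η.rIn_pos
  have e5 : ∀ᶠ y in 𝓝 (x, τ • N.d σ v x), N.f σ v y.1 < 2 * N.c + N.h ∨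
      latticeBump N.η (y.2 + gradient (N.pot σ) y.1) = e := by
    rcases he with he | ⟨rfl, rfl | rfl⟩
    · exact ((hfc.tendsto (x, τ • N.d σ v x)).eventually_lt_const he).mono fun y hy => Or.inl hy
    · refine Eventually.mono ?_ fun y hy => Or.inr hy
      refine hgc.continuousAt.eventually
        (latticeBump_eventually_eq_zero N.η fun k => N.two_mul_η_rOut_le.trans ?_)
      simp only [zero_smul, zero_add]
      refine (N.separated hσ).outer x (fun w hw => ?_) k
      by_contra hcon
      have hlt : φ.prim (N.pot σ) w x < N.M := by linarith [N.m_le, N.c_lt, N.m_pos]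
      have := (N.separated hσ).disjoint v hv w hw x h₂.le hlt
      subst this
      exact hcon (by change N.m / 4 ≤ N.f σ v x; linarith)
    · refine Eventually.mono ?_ fun y hy => Or.inr hy
      refine hgc.continuousAt.eventually
        (latticeBump_eventually_eq_one N.η N.η_rOut_le v ?_)
      simp only [one_smul, d_eq_sub, sub_add_cancel, sub_self, norm_zero]
      exact N.η.rIn_pos
  filter_upwards [e1, e2, e3, e4, e5] with y y1 y2 y3 y4 y5
  have hother : ∀ w ∈ N.V, w ≠ v → N.cut (N.f σ w y.1) = 0 := by
    intro w hw hne
    refine N.cut_eq_zero_of_le ?_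
    by_contra hcon
    exact hne ((N.separated hσ).disjoint v hv w (N.mem_V.1 hw) y.1 y2.le (not_le.1 hcon)).symm
  have hvV : v ∈ N.V := N.mem_V.2 hv
  have hs : ∑ w ∈ N.V, N.cut (N.f σ w y.1) = N.cut (N.f σ v y.1) :=
    Finset.sum_eq_single v hother fun h => absurd hvV h
  have ht : ∑ w ∈ N.V, N.tubePart w (σ, y) = N.tubePart v (σ, y) :=
    Finset.sum_eq_single v (fun w hw hne => N.tubePart_eq_zero (hother w hw hne))
      fun h => absurd hvV h
  have htube : N.tubePart v (σ, y) = N.cut (N.f σ v y.1) *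
      (N.g y.1 * coordAlong (N.δ / 2) (N.d σ v y.1) y.2 +
          N.B ((coordAlong (N.δ / 2) (N.d σ v y.1) y.2 - 1 / 2) * N.f σ v y.1)) := by
    unfold tubePart param
    rw [periodize_tubeFun N.θ N.η (N.δ / 2) (N.norm_d_le hσ hv y.1) (fun _ l hl k hk =>
      (N.separated hσ).neck v hv y.1 (by change N.m / 4 ≤ N.f σ v y.1; linarith) y2 l hl k hk)
      N.small N.half_lt_θ.le y3.le y4.le]
    exact N.cut_mul_comp (fun t => N.g y.1 * coordAlong (N.δ / 2) (N.d σ v y.1) y.2 +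
      N.B ((coordAlong (N.δ / 2) (N.d σ v y.1) y.2 - 1 / 2) * t)) _
  rw [ham, ht, htube, sheetPart, hs]
  rcases y5 with y5 | y5
  · rw [N.cut_eq_one y1.le y5.le]
    simp
  · rw [y5]

/-- Away from all necks only the sheet part survives, and `e` records which of the two separated
sheets the point lies on. -/
lemma ham_eventuallyEq_of_le {σ : ℝ} (hσ : σ ∈ Icc (0 : ℝ) 1) {x : Q n} {e : ℝ}
    (he : e = 0 ∨ e = 1) (h : ∀ v ∈ φ.vertexSet, N.M ≤ N.f σ v x) :
    ∀ᶠ y in 𝓝 (x, -(e • gradient (N.pot σ) x)), N.ham (σ, y) = -((N.g y.1 + N.κ) * e) := by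
  have hgc : Continuous fun y : CotQ n => y.2 + gradient (N.pot σ) y.1 :=
    continuous_snd.add ((contDiff_gradient (N.contDiff_pot σ)).continuous.comp continuous_fst)
  have e1 : ∀ᶠ y in 𝓝 (x, -(e • gradient (N.pot σ) x)), ∀ v ∈ N.V,
      2 * N.c + 2 * N.h < N.f σ v y.1 := by
    rw [Finset.eventually_all]
    intro v hv
    have hfc : Continuous fun y : CotQ n => N.f σ v y.1 :=
      (N.contDiff_f_at σ v).continuous.comp continuous_fst
    refine hfc.continuousAt.eventually_const_lt ?_
    linarith [h v (N.mem_V.1 hv), N.h_le', N.c_lt]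
  have e2 : ∀ᶠ y in 𝓝 (x, -(e • gradient (N.pot σ) x)),
      latticeBump N.η (y.2 + gradient (N.pot σ) y.1) = e := by
    rcases he with rfl | rfl
    · refine hgc.continuousAt.eventually
        (latticeBump_eventually_eq_zero N.η fun k => N.two_mul_η_rOut_le.trans ?_)
      simp only [zero_smul, zero_add, neg_zero]
      refine (N.separated hσ).outer x (fun w hw => ?_) k
      have := h w hw
      change N.m / 4 ≤ N.f σ w x
      linarith [N.m_le, N.c_lt, N.m_pos]
    · refine hgc.continuousAt.eventually
        (latticeBump_eventually_eq_one N.η N.η_rOut_le 0 ?_)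
      simp only [one_smul, neg_add_cancel, intVec_zero, sub_zero, norm_zero]
      exact N.η.rIn_pos
  filter_upwards [e1, e2] with y y1 y2
  have hz : ∀ v ∈ N.V, N.cut (N.f σ v y.1) = 0 := fun v hv => N.cut_eq_zero (y1 v hv).le
  rw [ham, sheetPart, Finset.sum_eq_zero hz, y2,
    Finset.sum_eq_zero fun v hv => N.tubePart_eq_zero (hz v hv)]
  simp

end NeckMove

end TropLag
end

/-! ### Barrier arguments and the Hamiltonian vector field along the tubes. -/

noncomputable section

namespace TropLag

open Set Metric Filter Topology
open scoped NNReal Pointwise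

variable {n : ℕ}

/-- The derivative of a gradient is the Hessian, which is symmetric; this is the hypothesis of
`hasFDerivAt_coordAlong` for `d = df_v`. -/
lemma inner_fderiv_gradient {F : Q n → ℝ} (hF : ContDiff ℝ ∞ F) (x u w : Q n) :
    inner ℝ (fderiv ℝ (gradient F) x u) w = inner ℝ u (fderiv ℝ (gradient F) x w) := by
  have hd : HasFDerivAt (fderiv ℝ F) (fderiv ℝ (fderiv ℝ F) x) x :=
    ((hF.fderiv_right (m := ∞) (by simp)).differentiable (by simp) x).hasFDerivAt
  have hg : ∀ u w, inner ℝ (fderiv ℝ (gradient F) x u) w = fderiv ℝ (fderiv ℝ F) x u w := by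
    intro u w
    have h := ((InnerProductSpace.toDual ℝ (Q n)).symm.toContinuousLinearEquiv :
      StrongDual ℝ (Q n) ≃L[ℝ] Q n).hasFDerivAt.comp x hd
    have h' : fderiv ℝ (gradient F) x = _ := HasFDerivAt.fderiv h
    rw [h']
    exact InnerProductSpace.toDual_symm_apply
  have hs := (hF.contDiffAt (x := x)).isSymmSndFDerivAt
    (by simpa using (WithTop.coe_le_coe.2 le_top : ((2 : ℕ∞) : WithTop ℕ∞) ≤ ∞))
  rw [hg u w, hs.eq, ← hg w u, real_inner_comm]

lemma eqOn_const_of_deriv_zero {F : ℝ → ℝ}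
    (hF : ∀ t ∈ Icc (0 : ℝ) 1, HasDerivWithinAt F 0 (Icc 0 1) t) {s t : ℝ}
    (hs : s ∈ Icc (0 : ℝ) 1) (ht : t ∈ Icc (0 : ℝ) 1) : F t = F s := by
  have := (convex_Icc (0 : ℝ) 1).norm_image_sub_le_of_norm_hasDerivWithin_le (C := 0) hF
    (fun x _ => by simp) hs ht
  rw [zero_mul, norm_le_zero_iff] at this
  linarith

/-- A function whose derivative vanishes when its value is slightly below `C` stays above `C`. -/
lemma le_of_deriv_zero_below {F F' : ℝ → ℝ}
    (hF : ∀ t ∈ Icc (0 : ℝ) 1, HasDerivWithinAt F (F' t) (Icc 0 1) t) {A C : ℝ} (hAC : A < C)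
    (h : ∀ t ∈ Icc (0 : ℝ) 1, A < F t → F t < C → F' t = 0) {s t : ℝ} (hs : s ∈ Icc (0 : ℝ) 1)
    (hsC : C ≤ F s) (ht : t ∈ Icc (0 : ℝ) 1) : C ≤ F t := by
  have hpos : 0 < C - A := by linarith
  -- Composed with a transition function that is flat outside the window `(A, C)`, the function has
  -- zero derivative everywhere: inside the window by hypothesis, outside by flatness.
  have hG : ∀ t ∈ Icc (0 : ℝ) 1, HasDerivWithinAt
      (fun t => Real.smoothTransition ((C - F t) / (C - A))) 0 (Icc 0 1) t := by
    intro t ht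
    have h1 := ((hF t ht).const_sub C).div_const (C - A)
    have h2 : HasDerivAt Real.smoothTransition
        (deriv Real.smoothTransition ((C - F t) / (C - A))) ((C - F t) / (C - A)) :=
      ((Real.smoothTransition.contDiff (n := 1)).differentiable (by simp) _).hasDerivAt
    refine (h2.comp_hasDerivWithinAt t h1).congr_deriv ?_
    by_cases hz : A < F t ∧ F t < C
    · rw [h t ht hz.1 hz.2]
      simp
    · rw [deriv_smoothTransition_eq_zero, zero_mul]
      rw [not_and_or, not_lt, not_lt] at hz
      rcases hz with hz | hz
      · right
        rw [one_le_div hpos]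
        linarith
      · left
        exact div_nonpos_of_nonpos_of_nonneg (by linarith) hpos.le
  have h3 := eqOn_const_of_deriv_zero hG hs ht
  rw [Real.smoothTransition.zero_of_nonpos (x := (C - F s) / (C - A))
    (div_nonpos_of_nonpos_of_nonneg (by linarith) hpos.le)] at h3
  by_contra hcon
  exact (Real.smoothTransition.pos_of_pos (div_pos (by linarith) hpos)).ne' h3

/-- The one-sided barrier applied to `F` and to `-F`. It propagates an identity known only inside a
window without an open-closed argument. -/
lemma eq_of_deriv_zero_near {F F' : ℝ → ℝ}
    (hF : ∀ t ∈ Icc (0 : ℝ) 1, HasDerivWithinAt F (F' t) (Icc 0 1) t) {A C s t : ℝ}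
    (h : ∀ t ∈ Icc (0 : ℝ) 1, A < F t → F t < C → F' t = 0) (hs : s ∈ Icc (0 : ℝ) 1)
    (hsA : A < F s) (hsC : F s < C) (ht : t ∈ Icc (0 : ℝ) 1) : F t = F s := by
  refine le_antisymm ?_ (le_of_deriv_zero_below hF hsA
    (fun t ht h1 h2 => h t ht h1 (h2.trans hsC)) hs le_rfl ht)
  have := le_of_deriv_zero_below (F := fun t => -F t) (F' := fun t => -F' t)
    (fun t ht => (hF t ht).neg) (neg_lt_neg hsC)
    (fun t ht h1 h2 => by rw [h t ht (by linarith) (by linarith), neg_zero]) hs le_rfl ht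
  linarith

namespace NeckMove

variable {φ : TropicalPolynomial n} (N : NeckMove φ)

/-- The Hamiltonian vector field along the segments of the tube at `v`. -/
lemma hamField_ham {σ : ℝ} (hσ : σ ∈ Icc (0 : ℝ) 1) {v : Fin n → ℤ} (hv : v ∈ φ.vertexSet)
    {x : Q n} {τ e : ℝ} (hτ : τ ∈ Icc (0 : ℝ) 1) (h₁ : N.m / 2 < N.f σ v x)
    (h₂ : N.f σ v x < N.M)
    (he : N.f σ v x < 2 * N.c + N.h ∨ (τ = e ∧ (e = 0 ∨ e = 1) ∧ 2 * N.c ≤ N.f σ v x))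
    {w b s : ℝ} (hw : w = N.cut (N.f σ v x)) (hb : b = deriv N.B ((τ - 1 / 2) * N.f σ v x))
    (hs : s = w * (N.g x + b * N.f σ v x) / ‖N.d σ v x‖ ^ 2) :
    hamField N.ham σ (x, τ • N.d σ v x) = (-s • N.d σ v x,
      τ • gradient N.g x + (w * b * (τ - 1 / 2)) • N.d σ v x -
        (τ * s) • fderiv ℝ (N.d σ v) x (N.d σ v x)) := by
  have hm := N.m_pos
  have hδ := N.δ_pos
  have hd : N.δ ≤ ‖N.d σ v x‖ := N.le_norm_d hσ hv (by linarith) h₂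
  have hdpos : 0 < ‖N.d σ v x‖ := hδ.trans_le hd
  set z : CotQ n := (x, τ • N.d σ v x) with hz
  have hcoord : coordAlong (N.δ / 2) (N.d σ v x) (τ • N.d σ v x) = τ :=
    coordAlong_smul (by linarith) (by linarith) τ
  have hev := N.ham_eventuallyEq hσ hv hτ h₁ h₂ (e := e) (he.imp_right fun h => ⟨h.1, h.2.1⟩)
  -- the derivatives of the constituents
  have Df : HasFDerivAt (fun y : CotQ n => N.f σ v y.1)
      ((innerSL ℝ (N.d σ v x)).comp (ContinuousLinearMap.fst ℝ (Q n) (Q n))) z := by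
    have h : HasFDerivAt (N.f σ v) (innerSL ℝ (N.d σ v x)) x :=
      ((N.contDiff_f_at σ v).differentiable (by simp) x).hasGradientAt.hasFDerivAt
    exact h.comp z hasFDerivAt_fst
  have Dg : HasFDerivAt (fun y : CotQ n => N.g y.1)
      ((innerSL ℝ (gradient N.g x)).comp (ContinuousLinearMap.fst ℝ (Q n) (Q n))) z := by
    have h : HasFDerivAt N.g (innerSL ℝ (gradient N.g x)) x :=
      (N.g_smooth.differentiable (by simp) x).hasGradientAt.hasFDerivAt
    exact h.comp z hasFDerivAt_fst
  have Dc : HasFDerivAt (fun y : CotQ n => coordAlong (N.δ / 2) (N.d σ v y.1) y.2) _ z :=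
    hasFDerivAt_coordAlong ((N.contDiff_d_at σ v).differentiable (by simp) x).hasFDerivAt
      (inner_fderiv_gradient (N.contDiff_f_at σ v) x) (by linarith : 0 < N.δ / 2)
      (by linarith) τ
  have Dw : HasFDerivAt (fun y : CotQ n => N.cut (N.f σ v y.1)) _ z :=
    HasDerivAt.comp_hasFDerivAt (h₂ := N.cut) z (h₂' := deriv N.cut (N.f σ v x))
      ((N.cut.contDiff (n := 1)).differentiable (by simp) (N.f σ v x)).hasDerivAt Df
  have DB : HasFDerivAt (fun y : CotQ n =>
      N.B ((coordAlong (N.δ / 2) (N.d σ v y.1) y.2 - 1 / 2) * N.f σ v y.1)) _ z :=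
    HasDerivAt.comp_hasFDerivAt (h₂ := N.B) z
      (h₂' := deriv N.B ((coordAlong (N.δ / 2) (N.d σ v z.1) z.2 - 1 / 2) * N.f σ v z.1))
      (N.B_smooth.differentiable (by simp) _).hasDerivAt ((Dc.sub_const (1 / 2)).mul Df)
  have D := ((((Dw.const_sub 1).mul (Dg.add_const N.κ)).mul_const e).add
    (Dw.mul ((Dg.mul Dc).add DB))).neg
  -- the two scalar identities
  have key₁ : deriv N.cut (N.f σ v x) * (N.g x * τ + N.B ((τ - 1 / 2) * N.f σ v x) -
      (N.g x + N.κ) * e) = 0 := by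
    -- The derivative of the cut-off multiplies the difference of the tube and the sheet
    -- Hamiltonians. On the neck the cut-off is locally constant; on the sheets the difference is
    -- zero, because `(τ - 1/2) f_v` has passed `-c` or `c`, where `B` is `0` or `κ`.
    rcases he with he | ⟨rfl, he, hc⟩
    · have : N.cut =ᶠ[𝓝 (N.f σ v x)] fun _ => 1 := by
        filter_upwards [Ioo_mem_nhds h₁ he] with t ht
        exact N.cut_eq_one ht.1.le ht.2.le
      rw [this.deriv_eq, deriv_const, zero_mul]
    · rcases he with rfl | rfl
      · rw [N.B_low _ (by linarith)]
        ring
      · rw [N.B_high _ (by linarith)]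
        ring
  have key₂ : (1 - w) * e = (1 - w) * τ := by
    rcases he with he | ⟨rfl, -, -⟩
    · rw [hw, N.cut_eq_one h₁.le he.le]
      ring
    · rfl
  refine (eq_hamField fun W => ?_).symm
  rw [(D.congr_of_eventuallyEq hev).fderiv]
  have hzc : coordAlong (N.δ / 2) (N.d σ v x) z.2 = τ := hcoord
  simp only [show z.1 = x from rfl, hzc, Pi.add_apply, Pi.mul_apply, add_apply, neg_apply, FunLike.coe_smul, Pi.smul_apply, sub_apply,
    ContinuousLinearMap.comp_apply, innerSL_apply_apply, ContinuousLinearMap.coe_fst',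
    ContinuousLinearMap.coe_snd', smul_eq_mul, omega, inner_sub_left, inner_add_left,
    inner_smul_left, inner_neg_left, neg_smul, ← hw, ← hb,
    RCLike.conj_to_real]
  rw [hs, div_eq_mul_inv]
  linear_combination inner ℝ (gradient N.g x) W.1 * key₂ + inner ℝ (N.d σ v x) W.1 * key₁

end NeckMove

end TropLag
end

/-! ### Trajectories through the sheets and the necks. -/

noncomputable section

namespace TropLag

open Set Metric Filter Topology
open scoped NNReal Pointwise

variable {n : ℕ}

lemma deriv_eq_zero_of_Iic {B : ℝ → ℝ} {u k : ℝ} (hB : DifferentiableAt ℝ B u)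
    (h : ∀ y ≤ u, B y = k) : deriv B u = 0 :=
  (uniqueDiffWithinAt_Iic u).eq_deriv _ (hB.hasDerivAt.hasDerivWithinAt (s := Iic u))
    ((hasDerivWithinAt_const u (Iic u) k).congr h (h u le_rfl))

lemma deriv_eq_zero_of_Ici {B : ℝ → ℝ} {u k : ℝ} (hB : DifferentiableAt ℝ B u)
    (h : ∀ y, u ≤ y → B y = k) : deriv B u = 0 :=
  (uniqueDiffWithinAt_Ici u).eq_deriv _ (hB.hasDerivAt.hasDerivWithinAt (s := Ici u))
    ((hasDerivWithinAt_const u (Ici u) k).congr h (h u le_rfl))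

namespace NeckMove

variable {φ : TropicalPolynomial n} (N : NeckMove φ)

/-- The Hamiltonian vector field on the two sheets away from the necks. -/
lemma hamField_ham_of_le {σ : ℝ} (hσ : σ ∈ Icc (0 : ℝ) 1) {x : Q n} {e : ℝ}
    (he : e = 0 ∨ e = 1) (h : ∀ v ∈ φ.vertexSet, N.M ≤ N.f σ v x) :
    hamField N.ham σ (x, -(e • gradient (N.pot σ) x)) = (0, e • gradient N.g x) := by
  have hev := N.ham_eventuallyEq_of_le hσ he h
  have Dg : HasFDerivAt (fun y : CotQ n => N.g y.1)
      ((innerSL ℝ (gradient N.g x)).comp (ContinuousLinearMap.fst ℝ (Q n) (Q n)))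
      (x, -(e • gradient (N.pot σ) x)) := by
    have h : HasFDerivAt N.g (innerSL ℝ (gradient N.g x)) x :=
      (N.g_smooth.differentiable (by simp) x).hasGradientAt.hasFDerivAt
    exact h.comp (x, -(e • gradient (N.pot σ) x)) hasFDerivAt_fst
  refine (eq_hamField fun W => ?_).symm
  rw [((((Dg.add_const N.κ).mul_const e).neg).congr_of_eventuallyEq hev).fderiv]
  simp [omega, inner_smul_left]

/-- The vector field on the base whose integral curves carry the trajectories. -/
def base (β σ : ℝ) (x : Q n) : Q n :=
  -∑ v ∈ N.V, (N.cut (N.f σ v x) * (N.g x + β * N.f σ v x)) •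
    (normSqReg (N.δ / 2) (N.d σ v x))⁻¹ • N.d σ v x

lemma contDiff_base (β : ℝ) : ContDiff ℝ ∞ (Function.uncurry (N.base β)) := by
  refine ContDiff.neg (ContDiff.sum fun v _ => ?_)
  have hinv : ContDiff ℝ ∞ fun q : ℝ × Q n => (normSqReg (N.δ / 2) (N.d q.1 v q.2))⁻¹ :=
    ((contDiff_normSqReg (N.δ / 2)).comp (N.contDiff_d v)).inv fun q => (normSqReg_pos _).ne'
  exact ((N.cut.contDiff.comp (N.contDiff_f v)).mul ((N.g_smooth.comp contDiff_snd).add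
    (contDiff_const.mul (N.contDiff_f v)))).smul (hinv.smul (N.contDiff_d v))

lemma exists_base_le (β : ℝ) : ∃ C, ∀ σ ∈ Icc (0 : ℝ) 1, ∀ x, ‖N.base β σ x‖ ≤ C := by
  obtain ⟨C₁, hC₁⟩ := (isCompact_closedBall (0 : Q n) (2 * N.K)).exists_bound_of_continuousOn
    (f := fun d => (normSqReg (N.δ / 2) d)⁻¹ • d)
    (((contDiff_normSqReg (n := n) (N.δ / 2)).continuous.inv₀
      fun d => (normSqReg_pos d).ne').smul continuous_id).continuousOn
  obtain ⟨C₂, hC₂, hb⟩ := bounded_of_zero_outside (a := fun t => N.cut t * t)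
      (N.cut.continuous.mul continuous_id)
      (l := (N.m / 2 + (2 * N.c + N.h)) / 2 - N.cut.rOut)
      (r := (N.m / 2 + (2 * N.c + N.h)) / 2 + N.cut.rOut) (fun t ht => by
        rw [N.cut.zero_of_le_dist, zero_mul]
        by_contra hcon
        rw [not_le, Real.dist_eq, abs_lt] at hcon
        exact ht ⟨by linarith [hcon.1], by linarith [hcon.2]⟩)
  refine ⟨N.V.card • ((N.C + |β| * C₂) * C₁), fun σ hσ x => ?_⟩
  rw [base, norm_neg]
  refine (norm_sum_le _ _).trans (Finset.sum_le_card_nsmul _ _ _ fun v hv => ?_)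
  rw [norm_smul]
  refine mul_le_mul ?_ (hC₁ _ (by simpa using N.norm_d_le hσ (N.mem_V.1 hv) x)) (norm_nonneg _)
    (add_nonneg ((abs_nonneg _).trans (N.g_bound x)) (by positivity))
  rw [mul_add, ← mul_assoc, mul_comm _ β, mul_assoc]
  refine (norm_add_le _ _).trans (add_le_add ?_ ?_)
  · rw [norm_mul, Real.norm_eq_abs, Real.norm_eq_abs, abs_of_nonneg N.cut.nonneg]
    exact (mul_le_of_le_one_left (abs_nonneg _) N.cut.le_one).trans (N.g_bound x)
  · rw [norm_mul]
    exact mul_le_mul_of_nonneg_left (hb _) (norm_nonneg _)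

lemma base_eq {β σ : ℝ} (hσ : σ ∈ Icc (0 : ℝ) 1) {v : Fin n → ℤ} (hv : v ∈ φ.vertexSet) {x : Q n}
    (h₁ : N.m / 4 ≤ N.f σ v x) (h₂ : N.f σ v x < N.M) :
    N.base β σ x = -(N.cut (N.f σ v x) * (N.g x + β * N.f σ v x) / ‖N.d σ v x‖ ^ 2) •
      N.d σ v x := by
  rw [base, Finset.sum_eq_single v]
  · rw [normSqReg_eq (by linarith [N.δ_pos]) (by linarith [N.δ_pos, N.le_norm_d hσ hv h₁ h₂]),
      smul_smul, ← neg_smul]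
    rfl
  · intro w hw hne
    rw [N.cut_eq_zero_of_le, zero_mul, zero_smul]
    by_contra hcon
    exact hne ((N.separated hσ).disjoint v hv w (N.mem_V.1 hw) x h₂.le (not_le.1 hcon)).symm
  · exact fun h => absurd (N.mem_V.2 hv) h

lemma base_eq_zero {β σ : ℝ} {x : Q n} (h : ∀ v ∈ φ.vertexSet, N.M ≤ N.f σ v x) :
    N.base β σ x = 0 := by
  rw [base, Finset.sum_eq_zero, neg_zero]
  intro v hv
  rw [N.cut_eq_zero_of_le (h v (N.mem_V.1 hv)), zero_mul, zero_smul]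

/-- Together with `hasDerivWithinAt_f` this gives `f_v' = -β f_v` where the cut-off is one: the
motion of the base point cancels the contribution `g` of the moving potential. -/
lemma inner_d_base {β σ : ℝ} (hσ : σ ∈ Icc (0 : ℝ) 1) {v : Fin n → ℤ} (hv : v ∈ φ.vertexSet)
    {x : Q n} (h₁ : N.m / 4 ≤ N.f σ v x) (h₂ : N.f σ v x < N.M) :
    inner ℝ (N.d σ v x) (N.base β σ x) = -(N.cut (N.f σ v x) * (N.g x + β * N.f σ v x)) := by
  have : 0 < ‖N.d σ v x‖ := N.δ_pos.trans_le (N.le_norm_d hσ hv h₁ h₂)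
  rw [N.base_eq hσ hv h₁ h₂, real_inner_smul_right, real_inner_self_eq_norm_sq]
  field_simp

section Curve

variable {β : ℝ} {x : ℝ → Q n}

lemma hasDerivWithinAt_f (hx : IsSolution (N.base β) x) {σ : ℝ} (hσ : σ ∈ Icc (0 : ℝ) 1)
    (v : Fin n → ℤ) :
    HasDerivWithinAt (fun σ => N.f σ v (x σ))
      (N.g (x σ) + inner ℝ (N.d σ v (x σ)) (N.base β σ (x σ))) (Icc 0 1) σ := by
  have h1 : HasFDerivAt (φ.prim N.ψ v) (innerSL ℝ (gradient (φ.prim N.ψ v) (x σ))) (x σ) :=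
    ((φ.contDiff_prim N.ψ_smooth v).differentiable (by simp) _).hasGradientAt.hasFDerivAt
  have h2 : HasFDerivAt N.g (innerSL ℝ (gradient N.g (x σ))) (x σ) :=
    (N.g_smooth.differentiable (by simp) _).hasGradientAt.hasFDerivAt
  have h3 := (h1.comp_hasDerivWithinAt σ (hx σ hσ)).add
    ((hasDerivWithinAt_id σ (Icc (0 : ℝ) 1)).mul (h2.comp_hasDerivWithinAt σ (hx σ hσ)))
  have h4 : (fun σ => N.f σ v (x σ)) = (φ.prim N.ψ v ∘ x) + id * (N.g ∘ x) :=
    funext fun σ => N.f_eq σ v (x σ)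
  rw [h4]
  refine h3.congr_deriv ?_
  rw [d_eq, φ.gradient_prim (N.ψ_smooth.differentiable (by simp))]
  simp only [innerSL_apply_apply, inner_add_left, inner_smul_left, RCLike.conj_to_real,
    Function.comp_apply, id]
  ring

lemma hasDerivWithinAt_d (hx : IsSolution (N.base β) x) {σ : ℝ} (hσ : σ ∈ Icc (0 : ℝ) 1)
    (v : Fin n → ℤ) :
    HasDerivWithinAt (fun σ => N.d σ v (x σ))
      (gradient N.g (x σ) + fderiv ℝ (N.d σ v) (x σ) (N.base β σ (x σ))) (Icc 0 1) σ := by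
  have h1 : HasFDerivAt (gradient N.ψ) (fderiv ℝ (gradient N.ψ) (x σ)) (x σ) :=
    ((contDiff_gradient N.ψ_smooth).differentiable (by simp) _).hasFDerivAt
  have h2 : HasFDerivAt (gradient N.g) (fderiv ℝ (gradient N.g) (x σ)) (x σ) :=
    ((contDiff_gradient N.g_smooth).differentiable (by simp) _).hasFDerivAt
  have h3 := ((h1.comp_hasDerivWithinAt σ (hx σ hσ)).const_sub (intVec v)).add
    ((hasDerivWithinAt_id σ (Icc (0 : ℝ) 1)).smul (h2.comp_hasDerivWithinAt σ (hx σ hσ)))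
  have h5 : fderiv ℝ (N.d σ v) (x σ) =
      -fderiv ℝ (gradient N.ψ) (x σ) + σ • fderiv ℝ (gradient N.g) (x σ) := by
    have h6 : N.d σ v = fun x => intVec v - gradient N.ψ x + σ • gradient N.g x :=
      funext fun x => N.d_eq σ v x
    rw [h6]
    exact ((h1.const_sub (intVec v)).add (h2.const_smul σ)).fderiv
  have h4 : (fun σ => N.d σ v (x σ)) =
      (fun σ => intVec v - (gradient N.ψ ∘ x) σ) + fun σ => id σ • (gradient N.g ∘ x) σ :=
    funext fun σ => N.d_eq σ v (x σ)
  rw [h4, h5]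
  refine h3.congr_deriv ?_
  simp
  abel

end Curve

/-- The trajectories through the two sheets. -/
lemma exists_sheet_trajectory {s : ℝ} (hs : s ∈ Icc (0 : ℝ) 1) {x₀ : Q n}
    (h : ∀ v ∈ φ.vertexSet, 2 * N.c ≤ N.f s v x₀) :
    ∃ x : ℝ → Q n, x s = x₀ ∧
      (∀ σ ∈ Icc (0 : ℝ) 1, ∀ v ∈ φ.vertexSet, 2 * N.c ≤ N.f σ v (x σ)) ∧
      ∀ e : ℝ, e = 0 ∨ e = 1 →
        IsSolution (hamField N.ham) fun σ => (x σ, -(e • gradient (N.pot σ) (x σ))) := by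
  obtain ⟨C, hC⟩ := N.exists_base_le 0
  -- Both sheets follow the same base curve, with `β = 0`, since `B` is constant at either end of
  -- the neck.
  obtain ⟨x, rfl, hx⟩ := exists_isSolution_of_bounded ((N.contDiff_base 0).of_le (by simp)) hC hs x₀
  have hm := N.m_pos
  have hmc := N.m_le
  have hcM := N.c_lt
  have hpos := N.h_pos
  have hstay : ∀ σ ∈ Icc (0 : ℝ) 1, ∀ v ∈ φ.vertexSet, 2 * N.c ≤ N.f σ v (x σ) := by
    intro σ hσ v hv
    -- With `β = 0` the value `f_v` is stationary just below `2c`, so `2c` is a barrier and points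
    -- of the sheets do not enter the necks.
    refine le_of_deriv_zero_below (F := fun σ => N.f σ v (x σ)) (A := N.m / 2)
      (fun σ hσ => N.hasDerivWithinAt_f hx hσ v) (by linarith) (fun t ht h1 h2 => ?_) hs (h v hv) hσ
    rw [N.inner_d_base ht hv (by linarith) (by linarith), N.cut_eq_one h1.le (by linarith)]
    ring
  refine ⟨x, rfl, hstay, fun e he σ hσ => ?_⟩
  have hgrad : ∀ v : Fin n → ℤ, (fun σ => -(e • gradient (N.pot σ) (x σ))) =
      fun σ => e • N.d σ v (x σ) - e • intVec v := by
    intro v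
    funext σ
    rw [d_eq_sub, smul_sub]
    abel
  by_cases hz : ∀ v ∈ φ.vertexSet, N.M ≤ N.f σ v (x σ)
  · rw [N.hamField_ham_of_le hσ he hz]
    have h1 := hx σ hσ
    have h2 := ((N.hasDerivWithinAt_d hx hσ 0).const_smul e).sub_const (e • intVec 0)
    rw [N.base_eq_zero hz] at h1 h2
    rw [map_zero, add_zero] at h2
    have h3 := hgrad 0
    refine h1.prodMk ?_
    rw [h3]
    exact h2
  · push Not at hz
    obtain ⟨v, hv, hvM⟩ := hz
    have hvc := hstay σ hσ v hv
    -- On the upper sheet the momentum `-dψ` is replaced by its lattice translate `df_v`, which is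
    -- the end `τ = 1` of the segment in the tube.
    have hperiod : (x σ, -(e • gradient (N.pot σ) (x σ))) + (0, intVec (if e = 0 then 0 else v)) =
        (x σ, e • N.d σ v (x σ)) := by
      refine Prod.ext (by simp) ?_
      rcases he with rfl | rfl
      · simp
      · simp [d_eq_sub, neg_add_eq_sub]
    rw [← N.fibrePeriodic_ham.hamField σ _ (if e = 0 then 0 else v), hperiod,
      N.hamField_ham hσ hv (e := e) (by rcases he with rfl | rfl <;> simp) (by linarith) hvM
        (Or.inr ⟨rfl, he, hvc⟩) rfl rfl rfl]
    have hb : deriv N.B ((e - 1 / 2) * N.f σ v (x σ)) = 0 := by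
      rcases he with rfl | rfl
      · exact deriv_eq_zero_of_Iic (N.B_smooth.differentiable (by simp) _)
          fun y hy => N.B_low y (by linarith)
      · exact deriv_eq_zero_of_Ici (N.B_smooth.differentiable (by simp) _)
          fun y hy => N.B_high y (by linarith)
    have h1 := hx σ hσ
    have h2 := ((N.hasDerivWithinAt_d hx hσ v).const_smul e).sub_const (e • intVec v)
    rw [N.base_eq hσ hv (by linarith) hvM] at h1 h2
    have h3 := hgrad v
    refine HasDerivWithinAt.prodMk (h1.congr_deriv ?_) ?_
    · rw [hb]
    · rw [h3]
      refine h2.congr_deriv ?_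
      rw [hb, map_smul]
      module

/-- The trajectories through the neck at `v`. -/
lemma exists_neck_trajectory {s : ℝ} (hs : s ∈ Icc (0 : ℝ) 1) {v : Fin n → ℤ}
    (hv : v ∈ φ.vertexSet) {u t₀ : ℝ} {T : ℝ → ℝ} (hT : ∀ σ, T σ = t₀ * Real.exp (-(σ * deriv N.B u)))
    (hTm : ∀ σ ∈ Icc (0 : ℝ) 1, N.m ≤ T σ) (hTc : ∀ σ ∈ Icc (0 : ℝ) 1, T σ ≤ 2 * N.c)
    (hTu : ∀ σ ∈ Icc (0 : ℝ) 1, 2 * |u| ≤ T σ) {x₀ : Q n} (h : N.f s v x₀ = T s) :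
    ∃ x : ℝ → Q n, x s = x₀ ∧ (∀ σ ∈ Icc (0 : ℝ) 1, N.f σ v (x σ) = T σ) ∧
      IsSolution (hamField N.ham) fun σ => (x σ, (1 / 2 + u / T σ) • N.d σ v (x σ)) := by
  set β := deriv N.B u with hβ
  obtain ⟨C, hC⟩ := N.exists_base_le β
  obtain ⟨x, rfl, hx⟩ := exists_isSolution_of_bounded ((N.contDiff_base β).of_le (by simp)) hC hs x₀
  have hm := N.m_pos
  have hmc := N.m_le
  have hcM := N.c_lt
  have hpos := N.h_pos
  have hhM := N.h_le'
  have hexp : ∀ σ, HasDerivAt (fun σ : ℝ => Real.exp (σ * β)) (Real.exp (σ * β) * β) σ := fun σ => by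
    simpa using ((hasDerivAt_id σ).mul_const β).exp
  have hTd : ∀ σ, HasDerivAt T (-β * T σ) σ := by
    intro σ
    have h1 : T = fun σ => t₀ * Real.exp (-(σ * β)) := funext hT
    have h2 := ((((hasDerivAt_id σ).mul_const β).neg).exp).const_mul t₀
    rw [h1]
    refine h2.congr_deriv ?_
    simp
    ring
  have hTexp : ∀ σ, T σ * Real.exp (σ * β) = t₀ := fun σ => by
    rw [hT, mul_assoc, ← Real.exp_add]
    simp
  have hFd : ∀ σ ∈ Icc (0 : ℝ) 1, HasDerivWithinAt (fun σ => N.f σ v (x σ) * Real.exp (σ * β)) _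
      (Icc 0 1) σ := fun σ hσ => (N.hasDerivWithinAt_f hx hσ v).mul (hexp σ).hasDerivWithinAt
  have hconst : ∀ σ ∈ Icc (0 : ℝ) 1, N.f σ v (x σ) = T σ := by
    intro σ hσ
    -- Within `r` of its initial value, the expected invariant `f_v exp(σβ)` keeps `f_v` so close to
    -- `T` that the cut-off is one. There the invariant has zero derivative, so it never leaves the
    -- window.
    obtain ⟨r, hr, hr'⟩ : ∃ r > 0, r * Real.exp |β| ≤ min (N.m / 2) N.h :=
      ⟨min (N.m / 2) N.h / Real.exp |β|, by positivity, by
        rw [div_mul_cancel₀ _ (Real.exp_pos _).ne']⟩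
    have := eq_of_deriv_zero_near hFd (A := t₀ - r) (C := t₀ + r) (fun t ht h1 h2 => ?_) hs
      (by rw [h, hTexp]; linarith) (by rw [h, hTexp]; linarith) hσ
    · rw [h, hTexp, ← hTexp σ] at this
      exact mul_right_cancel₀ (Real.exp_pos _).ne' this
    · have hclose : |N.f t v (x t) - T t| < min (N.m / 2) N.h := by
        have e1 : N.f t v (x t) - T t =
            (N.f t v (x t) * Real.exp (t * β) - t₀) * Real.exp (-(t * β)) := by
          rw [sub_mul, mul_assoc, ← Real.exp_add, hT]
          simp
        rw [e1, abs_mul, abs_of_pos (Real.exp_pos _)]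
        have e2 : Real.exp (-(t * β)) ≤ Real.exp |β| := by
          rw [Real.exp_le_exp]
          refine (neg_le_abs _).trans ?_
          rw [abs_mul, abs_of_nonneg ht.1]
          exact mul_le_of_le_one_left (abs_nonneg _) ht.2
        have e3 : |N.f t v (x t) * Real.exp (t * β) - t₀| < r := by
          rw [abs_lt]
          constructor <;> linarith
        exact (mul_lt_mul e3 e2 (Real.exp_pos _) hr.le).trans_le hr'
      rw [abs_lt] at hclose
      have g1 := hTm t ht
      have g2 := hTc t ht
      have g3 := min_le_left (N.m / 2) N.h
      have g4 := min_le_right (N.m / 2) N.h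
      rw [N.inner_d_base ht hv (by linarith) (by linarith),
        N.cut_eq_one (by linarith) (by linarith)]
      ring
  refine ⟨x, rfl, hconst, fun σ hσ => ?_⟩
  have hf := hconst σ hσ
  have g1 := hTm σ hσ
  have g2 := hTc σ hσ
  have g3 := hTu σ hσ
  have hTpos : 0 < T σ := by linarith
  have hτ : 1 / 2 + u / T σ ∈ Icc (0 : ℝ) 1 := by
    have h1 : |u / T σ| ≤ 1 / 2 := by
      rw [abs_div, abs_of_pos hTpos, div_le_iff₀ hTpos]
      linarith
    rw [abs_le] at h1
    constructor <;> linarith [h1.1, h1.2]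
  have hu : (1 / 2 + u / T σ - 1 / 2) * N.f σ v (x σ) = u := by
    rw [hf]
    field_simp
    ring
  rw [N.hamField_ham hσ hv (e := 0) hτ (by linarith) (by linarith) (Or.inl (by linarith))
    rfl rfl rfl, hu, ← hβ]
  -- This is `τ' = β (τ - 1/2)`; against `f_v' = -β f_v` it expresses the conservation of `u = (τ -
  -- 1/2) f_v`.
  have hτd : HasDerivAt (fun σ => 1 / 2 + u / T σ) (β * (1 / 2 + u / T σ - 1 / 2)) σ := by
    refine (((hasDerivAt_const σ u).div (hTd σ) hTpos.ne').const_add (1 / 2)).congr_deriv ?_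
    field_simp
    ring
  have h1 := hx σ hσ
  have h2 := (hτd.hasDerivWithinAt (s := Icc 0 1)).smul (N.hasDerivWithinAt_d hx hσ v)
  rw [N.base_eq hσ hv (by linarith) (by linarith)] at h1 h2
  refine h1.prodMk (h2.congr_deriv ?_)
  rw [N.cut_eq_one (by linarith) (by linarith), map_smul]
  module

end NeckMove

/-- The two sheets of `ψ` outside the necks, together with necks which are parametrized by
`|u| ≤ c`. -/
def TropicalPolynomial.necked (φ : TropicalPolynomial n) (ψ : Q n → ℝ) (c : ℝ) (t : ℝ → ℝ) :
    Set (X n) :=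
  {z | ∃ x : Q n, (∀ v ∈ φ.vertexSet, 2 * c ≤ φ.prim ψ v x) ∧
    (z = proj (x, 0) ∨ z = proj (x, -gradient ψ x))} ∪
  ⋃ v ∈ φ.vertexSet, {z | ∃ (x : Q n) (u : ℝ), |u| ≤ c ∧ φ.prim ψ v x = t u ∧
    z = proj (x, (1 / 2 + u / t u) • gradient (φ.prim ψ v) x)}

/-- Every neck trajectory keeps its `u` while `f_v` is rescaled by `exp(-σ B'(u))`, so the neck of
shape `t₀` flows to the neck of shape `t₁`, and sheets flow to sheets. Running the trajectories
backwards gives surjectivity. -/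
theorem NeckMove.hamiltonianIsotopic {φ : TropicalPolynomial n} (N : NeckMove φ) {t₀ t₁ : ℝ → ℝ}
    (h : ∀ u, |u| ≤ N.c → t₁ u = t₀ u * Real.exp (-deriv N.B u))
    (hm₀ : ∀ u, |u| ≤ N.c → N.m ≤ t₀ u) (hm₁ : ∀ u, |u| ≤ N.c → N.m ≤ t₁ u)
    (hc₀ : ∀ u, |u| ≤ N.c → t₀ u ≤ 2 * N.c) (hc₁ : ∀ u, |u| ≤ N.c → t₁ u ≤ 2 * N.c)
    (hu₀ : ∀ u, |u| ≤ N.c → 2 * |u| ≤ t₀ u) (hu₁ : ∀ u, |u| ≤ N.c → 2 * |u| ≤ t₁ u) :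
    HamiltonianIsotopic (φ.necked (N.pot 0) N.c t₀) (φ.necked (N.pot 1) N.c t₁) := by
  have hneck : ∀ s ∈ Icc (0 : ℝ) 1, ∀ v ∈ φ.vertexSet, ∀ u, |u| ≤ N.c → ∀ x₀,
      N.f s v x₀ = t₀ u * Real.exp (-(s * deriv N.B u)) → ∃ x : ℝ → Q n, x s = x₀ ∧
      N.f 0 v (x 0) = t₀ u ∧ N.f 1 v (x 1) = t₁ u ∧ IsSolution (hamField N.ham) fun σ =>
        (x σ, (1 / 2 + u / (t₀ u * Real.exp (-(σ * deriv N.B u)))) • N.d σ v (x σ)) := by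
    intro s hs v hv u hu x₀ hx₀
    have hpos : 0 < t₀ u := N.m_pos.trans_le (hm₀ u hu)
    -- The factor is monotone in `σ`, so intermediate values lie between `t₀ u` and `t₁ u` and
    -- inherit the bounds assumed at both ends.
    have hmono : ∀ σ ∈ Icc (0 : ℝ) 1, min (t₀ u) (t₁ u) ≤ t₀ u * Real.exp (-(σ * deriv N.B u)) ∧
        t₀ u * Real.exp (-(σ * deriv N.B u)) ≤ max (t₀ u) (t₁ u) := by
      intro σ hσ
      rw [h u hu]
      rcases le_total 0 (deriv N.B u) with hb | hb
      · have h1 : Real.exp (-(σ * deriv N.B u)) ≤ 1 := by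
          rw [Real.exp_le_one_iff]
          linarith [mul_nonneg hσ.1 hb]
        have h2 : Real.exp (-deriv N.B u) ≤ Real.exp (-(σ * deriv N.B u)) := by
          rw [Real.exp_le_exp]
          nlinarith [hσ.2]
        exact ⟨min_le_of_right_le (by gcongr), le_max_of_le_left (mul_le_of_le_one_right hpos.le h1)⟩
      · have h1 : 1 ≤ Real.exp (-(σ * deriv N.B u)) := by
          rw [Real.one_le_exp_iff]
          nlinarith [hσ.1]
        have h2 : Real.exp (-(σ * deriv N.B u)) ≤ Real.exp (-deriv N.B u) := by
          rw [Real.exp_le_exp]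
          nlinarith [hσ.2]
        exact ⟨min_le_of_left_le (le_mul_of_one_le_right hpos.le h1), le_max_of_le_right (by gcongr)⟩
    obtain ⟨x, hxs, hxf, hx⟩ := N.exists_neck_trajectory hs hv (fun _ => rfl)
      (fun σ hσ => (le_min (hm₀ u hu) (hm₁ u hu)).trans (hmono σ hσ).1)
      (fun σ hσ => (hmono σ hσ).2.trans (max_le (hc₀ u hu) (hc₁ u hu)))
      (fun σ hσ => (le_min (hu₀ u hu) (hu₁ u hu)).trans (hmono σ hσ).1) hx₀
    refine ⟨x, hxs, ?_, ?_, hx⟩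
    · rw [hxf 0 (by simp)]
      simp
    · rw [hxf 1 (by simp), h u hu]
      simp
  refine hamiltonianIsotopic_of_trajectories N.contDiff_ham N.fibrePeriodic_ham N.fibreBounded_ham
    ?_ ?_
  · rintro z (⟨x₀, hx₀, hz⟩ | hz)
    · obtain ⟨x, hx0, hx, hsol⟩ := N.exists_sheet_trajectory (s := 0) (by simp) hx₀
      rcases hz with rfl | rfl
      · refine ⟨_, hsol 0 (Or.inl rfl), by simp [hx0], Or.inl ⟨x 1, hx 1 (by simp), Or.inl ?_⟩⟩
        simp
      · refine ⟨_, hsol 1 (Or.inr rfl), by simp [hx0], Or.inl ⟨x 1, hx 1 (by simp), Or.inr ?_⟩⟩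
        simp
    · simp only [mem_iUnion] at hz
      obtain ⟨v, hv, x₀, u, hu, hfu, rfl⟩ := hz
      obtain ⟨x, hx0, hf0, hf1, hsol⟩ := hneck 0 (by simp) v hv u hu x₀ (by
        rw [zero_mul, neg_zero, Real.exp_zero, mul_one]
        exact hfu)
      refine ⟨_, hsol, by simp [hx0, d], Or.inr ?_⟩
      simp only [mem_iUnion]
      refine ⟨v, hv, x 1, u, hu, hf1, ?_⟩
      rw [h u hu, one_mul]
      rfl
  · rintro z (⟨x₀, hx₀, hz⟩ | hz)
    · obtain ⟨x, hx0, hx, hsol⟩ := N.exists_sheet_trajectory (s := 1) (by simp) hx₀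
      rcases hz with rfl | rfl
      · refine ⟨_, hsol 0 (Or.inl rfl), by simp [hx0], Or.inl ⟨x 0, hx 0 (by simp), Or.inl ?_⟩⟩
        simp
      · refine ⟨_, hsol 1 (Or.inr rfl), by simp [hx0], Or.inl ⟨x 0, hx 0 (by simp), Or.inr ?_⟩⟩
        simp
    · simp only [mem_iUnion] at hz
      obtain ⟨v, hv, x₀, u, hu, hfu, rfl⟩ := hz
      obtain ⟨x, hx0, hf0, hf1, hsol⟩ := hneck 1 (by simp) v hv u hu x₀ (by
        rw [one_mul, ← h u hu]
        exact hfu)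
      refine ⟨_, hsol, ?_, Or.inr ?_⟩
      · rw [h u hu]
        simp [hx0, d]
      · simp only [mem_iUnion]
        refine ⟨v, hv, x 0, u, hu, hf0, ?_⟩
        simp [d]

end TropLag
end

noncomputable section

namespace TropLag

open Set Metric Filter Topology
open scoped NNReal Pointwise

/-! ### Cutting off the branches of a surgery profile -/

lemma hasDerivAt_integral {G : ℝ → ℝ} (hG : Continuous G) (a t : ℝ) :
    HasDerivAt (fun t => ∫ x in a..t, G x) (G t) t :=
  intervalIntegral.integral_hasDerivAt_right (hG.intervalIntegrable _ _)
    hG.aestronglyMeasurable.stronglyMeasurableAtFilter hG.continuousAt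

lemma contDiff_integral {G : ℝ → ℝ} (hG : ContDiff ℝ ∞ G) (a : ℝ) :
    ContDiff ℝ ∞ fun t => ∫ x in a..t, G x := by
  rw [contDiff_infty_iff_deriv]
  refine ⟨fun t => (hasDerivAt_integral hG.continuous a t).differentiableAt, ?_⟩
  rwa [show deriv (fun t => ∫ x in a..t, G x) = G from
    funext fun t => (hasDerivAt_integral hG.continuous a t).deriv]

/-- The properties of the derivatives `s'` and `1 - r'` of a surgery profile. -/
structure IsBranch (c : ℝ) (F : ℝ → ℝ) : Prop where
  smooth : ContDiffOn ℝ ∞ F (Ioi c)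
  anti : AntitoneOn F (Ici c)
  zero : ∀ t, 2 * c ≤ t → F t = 0
  lt : ∀ t, c < t → F t < 1 / 2

/-- A branch which vanishes near `2 c`. The function `F` is controlled by the differential
inequality which makes `(F t - 1/2) t` strictly decreasing. -/
structure IsCutBranch (c l' : ℝ) (F : ℝ → ℝ) : Prop where
  zero : ∀ t, l' ≤ t → F t = 0
  nonneg : ∀ t, c < t → 0 ≤ F t
  lt : ∀ t, c < t → F t < 1 / 2
  deriv : ∀ t, c < t → ∃ D, HasDerivAt F D t ∧ D * t + F t < 1 / 2

namespace IsBranch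

variable {c : ℝ} {F : ℝ → ℝ}

lemma nonneg (hF : IsBranch c F) {t : ℝ} (ht : c ≤ t) : 0 ≤ F t := by
  rw [← hF.zero (max t (2 * c)) (le_max_right _ _)]
  exact hF.anti ht (ht.trans (le_max_left _ _)) (le_max_left _ _)

lemma hasDerivAt (hF : IsBranch c F) {t : ℝ} (ht : c < t) :
    ∃ D, HasDerivAt F D t ∧ D ≤ 0 := by
  have hd : HasDerivAt F (deriv F t) t :=
    ((hF.smooth.contDiffAt (Ioi_mem_nhds ht)).differentiableAt (by simp)).hasDerivAt
  refine ⟨_, hd, ?_⟩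
  have h1 := hd.hasDerivWithinAt (s := Ici c)
  rw [← h1.derivWithin ((uniqueDiffOn_Ici c) t ht.le)]
  exact hF.anti.derivWithin_nonpos

lemma exists_le (hF : IsBranch c F) (hc : 0 < c) {κ : ℝ} (hκ : 0 < κ) :
    ∃ l, c < l ∧ l < 2 * c ∧ F l ≤ κ := by
  have h1 : ContinuousAt F (2 * c) :=
    (hF.smooth.continuousOn).continuousAt (Ioi_mem_nhds (by linarith))
  have h2 : ∀ᶠ t in 𝓝 (2 * c), F t < κ := by
    refine h1.eventually_lt_const ?_
    rwa [hF.zero _ le_rfl]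
  have h3 : ∀ᶠ t in 𝓝[<] (2 * c), F t < κ := h2.filter_mono nhdsWithin_le_nhds
  obtain ⟨l, hl, hl'⟩ := (h3.and (Ioo_mem_nhdsLT (by linarith : c < 2 * c))).exists
  exact ⟨l, hl'.1, hl'.2, hl.le⟩

/-- The part `G = F (1 - χ)` near `2c` is removed and its integral `μ` is put back as `μ E'`, spread
over `(l, l₁)`. The correction `μ E' - G` has total integral zero, so its primitive `a` vanishes
outside the collar. A short scale `h` makes `μ` small enough to preserve the differential
inequality. -/
lemma exists_cut (hF : IsBranch c F) {κ l : ℝ} (hκ : 0 < κ) (hκ' : κ ≤ 1 / 4)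
    (hcl : c < l) (hl : l < 2 * c) (hFl : F l ≤ κ / 2) :
    ∃ (a : ℝ → ℝ) (l' : ℝ), l' < 2 * c ∧ ContDiff ℝ ∞ a ∧
      (∀ t ∉ Ioo l (2 * c), a t = 0) ∧ (∀ t ∉ Ioo l (2 * c), deriv a t = 0) ∧
      (∀ t ∈ Ioo l (2 * c), |F t| ≤ κ) ∧ (∀ t ∈ Ioo l (2 * c), |F t + deriv a t| ≤ κ) ∧
      IsCutBranch c l' fun t => F t + deriv a t := by
  -- a smooth step `E` from `0` to `1` inside `(l, 2 c)`
  obtain ⟨l₁, hl₁, hl₁'⟩ : ∃ l₁, l < l₁ ∧ l₁ < 2 * c := exists_between hl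
  set E : ℝ → ℝ := fun t => Real.smoothTransition ((t - l) / (l₁ - l)) with hE
  have hpos : 0 < l₁ - l := by linarith
  have hEs : ContDiff ℝ ∞ E := Real.smoothTransition.contDiff.comp (by fun_prop)
  have hE0 : ∀ t ≤ l, E t = 0 := fun t ht => Real.smoothTransition.zero_of_nonpos
    (div_nonpos_of_nonpos_of_nonneg (by linarith) hpos.le)
  have hE1 : ∀ t, l₁ ≤ t → E t = 1 := fun t ht => Real.smoothTransition.one_of_one_le
    ((one_le_div hpos).2 (by linarith))
  have hEm : Monotone E := fun x y h => Real.smoothTransition.monotone (by gcongr)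
  have hE's : ContDiff ℝ ∞ (deriv E) := (contDiff_infty_iff_deriv.1 hEs).2
  have hE''s : ContDiff ℝ ∞ (deriv (deriv E)) := (contDiff_infty_iff_deriv.1 hE's).2
  have hEd := hEs.differentiable (by simp)
  have hE'd := hE's.differentiable (by simp)
  have hE'0 : ∀ t ≤ l, deriv E t = 0 := fun t ht =>
    deriv_eq_zero_of_Iic (hEd t) fun y hy => hE0 y (hy.trans ht)
  have hE'1 : ∀ t, l₁ ≤ t → deriv E t = 0 := fun t ht =>
    deriv_eq_zero_of_Ici (hEd t) fun y hy => hE1 y (ht.trans hy)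
  have hE''0 : ∀ t ≤ l, deriv (deriv E) t = 0 := fun t ht =>
    deriv_eq_zero_of_Iic (hE'd t) fun y hy => hE'0 y (hy.trans ht)
  have hE''1 : ∀ t, l₁ ≤ t → deriv (deriv E) t = 0 := fun t ht =>
    deriv_eq_zero_of_Ici (hE'd t) fun y hy => hE'1 y (ht.trans hy)
  have hE'nn : ∀ t, 0 ≤ deriv E t := fun t => hEm.deriv_nonneg
  obtain ⟨C, hC, hCb⟩ := bounded_of_zero_outside (a := fun t => (deriv E t,
      deriv (deriv E) t * t + deriv E t)) (l := l) (r := l₁)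
    (hE's.continuous.prodMk ((hE''s.continuous.mul continuous_id).add hE's.continuous))
    (fun t ht => by
      rcases le_or_gt t l with h | h
      · simp [hE'0 t h, hE''0 t h]
      · have : l₁ ≤ t := by
          by_contra hcon
          exact ht ⟨h, not_le.1 hcon⟩
        simp [hE'1 t this, hE''1 t this])
  have hCb1 : ∀ t, |deriv E t| ≤ C := fun t => (norm_fst_le _).trans (hCb t)
  have hCb2 : ∀ t, |deriv (deriv E) t * t + deriv E t| ≤ C := fun t =>
    (norm_snd_le _).trans (hCb t)
  -- the scale `h` of the cut-off
  obtain ⟨h, hh, hhl, hhC⟩ : ∃ h > 0, l < 2 * c - h ∧ h * C ≤ κ / 2 := by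
    refine ⟨min ((2 * c - l) / 2) (κ / 2 / (C + 1)), by
      have : 0 < 2 * c - l := by linarith
      positivity, ?_, ?_⟩
    · linarith [min_le_left ((2 * c - l) / 2) (κ / 2 / (C + 1))]
    · calc min ((2 * c - l) / 2) (κ / 2 / (C + 1)) * C ≤ κ / 2 / (C + 1) * (C + 1) :=
            mul_le_mul (min_le_right _ _) (by linarith) hC (by positivity)
        _ = κ / 2 := div_mul_cancel₀ _ (by positivity)
  set χ : ℝ → ℝ := fun t => Real.smoothTransition ((2 * c - h / 2 - t) / (h / 2)) with hχ
  have hχs : ContDiff ℝ ∞ χ := Real.smoothTransition.contDiff.comp (by fun_prop)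
  have hχ1 : ∀ t ≤ 2 * c - h, χ t = 1 := fun t ht => Real.smoothTransition.one_of_one_le
    ((one_le_div (by positivity)).2 (by linarith))
  have hχ0 : ∀ t, 2 * c - h / 2 ≤ t → χ t = 0 := fun t ht => Real.smoothTransition.zero_of_nonpos
    (div_nonpos_of_nonpos_of_nonneg (by linarith) (by positivity))
  have hχa : Antitone χ := fun x y h => Real.smoothTransition.monotone (by gcongr)
  have hχnn : ∀ t, 0 ≤ χ t := fun t => Real.smoothTransition.nonneg _
  have hχle : ∀ t, χ t ≤ 1 := fun t => Real.smoothTransition.le_one _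
  set G : ℝ → ℝ := fun t => F t * (1 - χ t) with hG
  have hG0 : ∀ t ≤ 2 * c - h, G t = 0 := fun t ht => by simp [hG, hχ1 t ht]
  have hG1 : ∀ t, 2 * c ≤ t → G t = 0 := fun t ht => by simp [hG, hF.zero t ht]
  have hGs : ContDiff ℝ ∞ G := by
    rw [contDiff_iff_contDiffAt]
    intro t
    rcases lt_or_ge c t with ht | ht
    · exact (hF.smooth.contDiffAt (Ioi_mem_nhds ht)).mul (contDiffAt_const.sub hχs.contDiffAt)
    · refine (contDiffAt_const (c := (0 : ℝ))).congr_of_eventuallyEq ?_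
      filter_upwards [Iio_mem_nhds (show t < 2 * c - h by linarith)] with y hy
      exact hG0 y (le_of_lt hy)
  have hFle : ∀ t, l ≤ t → F t ≤ κ / 2 := fun t ht =>
    (hF.anti hcl.le (hcl.le.trans ht) ht).trans hFl
  have hFnn : ∀ t, c ≤ t → 0 ≤ F t := fun t ht => hF.nonneg ht
  set I : ℝ → ℝ := fun t => ∫ x in l..t, G x with hI
  have hId : ∀ t, HasDerivAt I (G t) t := fun t => hasDerivAt_integral hGs.continuous l t
  set μ : ℝ := I (2 * c) with hμ
  have hμnn : 0 ≤ μ := intervalIntegral.integral_nonneg hl.le fun t ht =>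
    mul_nonneg (hFnn t (by linarith [ht.1])) (by linarith [hχle t])
  have hI0 : ∀ t ≤ 2 * c - h, I t = 0 := by
    intro t ht
    rw [hI]
    simp only
    rw [intervalIntegral.integral_congr (g := fun _ => 0), intervalIntegral.integral_zero]
    intro y hy
    exact hG0 y (hy.2.trans (max_le hhl.le ht))
  have hI1 : ∀ t, 2 * c ≤ t → I t = μ := by
    intro t ht
    have := intervalIntegral.integral_add_adjacent_intervals
      (hGs.continuous.intervalIntegrable l (2 * c))
      (hGs.continuous.intervalIntegrable (μ := MeasureTheory.volume) (2 * c) t)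
    rw [intervalIntegral.integral_congr (a := 2 * c) (g := fun _ => 0),
      intervalIntegral.integral_zero, add_zero] at this
    · exact this.symm
    · intro y hy
      rw [uIcc_of_le ht] at hy
      exact hG1 y hy.1
  have hμle : μ ≤ h := by
    have h1 : ∫ x in (2 * c - h)..(2 * c), G x = μ := by
      have := intervalIntegral.integral_add_adjacent_intervals
        (hGs.continuous.intervalIntegrable l (2 * c - h))
        (hGs.continuous.intervalIntegrable (μ := MeasureTheory.volume) (2 * c - h) (2 * c))
      have h2 := hI0 _ le_rfl
      simp only [hI] at h2
      rw [h2, zero_add] at this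
      exact this
    have h2 := intervalIntegral.norm_integral_le_of_norm_le_const (a := 2 * c - h) (b := 2 * c)
      (f := G) (C := 1) (fun x hx => by
        rw [uIoc_of_le (by linarith)] at hx
        have h3 := hFle x (by linarith [hx.1])
        have h4 := hFnn x (by linarith [hx.1])
        rw [Real.norm_eq_abs, abs_of_nonneg (mul_nonneg h4 (by linarith [hχle x]))]
        nlinarith [hχnn x, hχle x])
    rw [h1, Real.norm_eq_abs, one_mul, abs_of_pos (by linarith : 0 < 2 * c - (2 * c - h))] at h2
    linarith [le_abs_self μ]
  have hμE : ∀ t, μ * deriv E t ≤ κ / 2 := fun t =>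
    (mul_le_mul hμle ((le_abs_self _).trans (hCb1 t)) (hE'nn t) hh.le).trans hhC
  set a : ℝ → ℝ := fun t => μ * E t - I t with ha
  have had : ∀ t, deriv a t = μ * deriv E t - G t := fun t =>
    (((hEd t).hasDerivAt.const_mul μ).sub (hId t)).deriv
  have hF' : (fun t => F t + deriv a t) = fun t => F t * χ t + μ * deriv E t := by
    funext t
    rw [had, hG]
    ring
  have hout : ∀ t ∉ Ioo l (2 * c), t ≤ l ∨ 2 * c ≤ t := fun t ht => by
    by_contra hcon
    push Not at hcon
    exact ht hcon
  refine ⟨a, max l₁ (2 * c - h / 2), max_lt hl₁' (by linarith), ?_, ?_, ?_, ?_, ?_, ?_⟩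
  · exact (contDiff_const.mul hEs).sub (contDiff_integral hGs l)
  · intro t ht
    rcases hout t ht with h | h
    · simp only [ha, hE0 t h, hI0 t (by linarith)]
      ring
    · simp only [ha, hE1 t (by linarith), hI1 t h]
      ring
  · intro t ht
    rw [had]
    rcases hout t ht with h | h
    · rw [hE'0 t h, hG0 t (by linarith)]
      ring
    · rw [hE'1 t (by linarith), hG1 t h]
      ring
  · intro t ht
    rw [abs_of_nonneg (hFnn t (by linarith [ht.1]))]
    linarith [hFle t ht.1.le]
  · intro t ht
    have h1 := hFle t ht.1.le
    have h2 := hFnn t (by linarith [ht.1])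
    have h3 := hμE t
    have h4 := mul_nonneg hμnn (hE'nn t)
    have h5 := mul_le_of_le_one_right h2 (hχle t)
    have h6 := mul_nonneg h2 (hχnn t)
    have h7 := congrFun hF' t
    rw [h7, abs_le]
    constructor <;> linarith
  · rw [hF']
    have hlt : ∀ t, c < t → F t * χ t + μ * deriv E t < 1 / 2 := by
      intro t ht
      have h2 := hFnn t ht.le
      have h5 := mul_le_of_le_one_right h2 (hχle t)
      rcases le_or_gt t l with h | h
      · rw [hE'0 t h]
        linarith [hF.lt t ht]
      · linarith [hFle t h.le, hμE t]
    refine ⟨fun t ht => ?_, fun t ht => ?_, hlt, fun t ht => ?_⟩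
    · rw [hχ0 t ((le_max_right _ _).trans ht), hE'1 t ((le_max_left _ _).trans ht)]
      ring
    · exact add_nonneg (mul_nonneg (hFnn t ht.le) (hχnn t)) (mul_nonneg hμnn (hE'nn t))
    · obtain ⟨D, hD, hD0⟩ := hF.hasDerivAt ht
      have hχd := (hχs.differentiable (by simp) t).hasDerivAt
      refine ⟨_, (hD.mul hχd).add ((hE'd t).hasDerivAt.const_mul μ), ?_⟩
      have h1 : deriv χ t ≤ 0 := hχa.deriv_nonpos
      have h2 := hFnn t ht.le
      have h3 : D * χ t * t ≤ 0 := mul_nonpos_of_nonpos_of_nonneg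
        (mul_nonpos_of_nonpos_of_nonneg hD0 (hχnn t)) (by linarith)
      have h4 : F t * deriv χ t * t ≤ 0 := mul_nonpos_of_nonpos_of_nonneg
        (mul_nonpos_of_nonneg_of_nonpos h2 h1) (by linarith)
      have h5 := mul_le_of_le_one_right h2 (hχle t)
      rcases le_or_gt t l with h | h
      · rw [hE'0 t h, hE''0 t h]
        nlinarith [hF.lt t ht]
      · have h6 : μ * (deriv (deriv E) t * t + deriv E t) ≤ κ / 2 :=
          (mul_le_mul_of_nonneg_left ((le_abs_self _).trans (hCb2 t)) hμnn).trans
            ((mul_le_mul_of_nonneg_right hμle hC).trans hhC)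
        nlinarith [hFle t h.le]

end IsBranch

end TropLag
end

noncomputable section

namespace TropLag

open Set Metric Filter Topology
open scoped NNReal Pointwise

/-! ### Parametrizing the necks -/

/-- The function `t` describes a neck: it is smooth, bounded below by `m`, and equal to `2 |u|`
for `|u| ≥ c₀`. -/
structure IsNeckShape (c₀ m : ℝ) (t : ℝ → ℝ) : Prop where
  smooth : ContDiff ℝ ∞ t
  pos : 0 < m
  le : ∀ u, m ≤ t u
  two_mul_abs_le : ∀ u, 2 * |u| ≤ t u
  eq : ∀ u, c₀ ≤ |u| → t u = 2 * |u|
  le_of_abs_le : ∀ u, |u| ≤ c₀ → t u ≤ 2 * c₀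

/-- The curve `(t u, 1/2 + u / t u)` is the union of the graphs of `S` and `R`. -/
structure Parametrizes (c c₀ : ℝ) (S R t : ℝ → ℝ) : Prop where
  low : ∀ u ≤ 0, S (t u) = 1 / 2 + u / t u
  up : ∀ u, 0 ≤ u → R (t u) = 1 / 2 + u / t u
  exists_low : ∀ y, c ≤ y → ∃ u ≤ 0, t u = y
  exists_up : ∀ y, c ≤ y → ∃ u, 0 ≤ u ∧ t u = y
  low_zero : ∀ y, 2 * c₀ ≤ y → S y = 0
  up_one : ∀ y, 2 * c₀ ≤ y → R y = 1

namespace SurgeryProfile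

variable (P : SurgeryProfile)

/-- The derivative of `r`. -/
def R (t : ℝ) : ℝ := derivWithin P.r (Ici P.c) t

/-- The derivative of `s`. -/
def S (t : ℝ) : ℝ := derivWithin P.s (Ici P.c) t

/-- At `t = b` the functions agree only to the right; as `f` is differentiable there, the right
derivative determines the derivative. -/
lemma derivWithin_Ici_of_eq {f g : ℝ → ℝ} {c b : ℝ} (hc : c < b) (hf : ContDiffOn ℝ ∞ f (Ioi c))
    (hfg : ∀ t, b ≤ t → f t = g t) {g' t : ℝ} (hg : HasDerivAt g g' t) (ht : b ≤ t) :
    derivWithin f (Ici c) t = g' := by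
  have hct : c < t := hc.trans_le ht
  have hd : HasDerivAt f (deriv f t) t :=
    ((hf.contDiffAt (Ioi_mem_nhds hct)).differentiableAt (by simp)).hasDerivAt
  rw [hd.hasDerivWithinAt.derivWithin ((uniqueDiffOn_Ici c) t hct.le)]
  refine (uniqueDiffWithinAt_Ici t).eq_deriv _ (hd.hasDerivWithinAt (s := Ici t)) ?_
  exact (hg.hasDerivWithinAt (s := Ici t)).congr (fun y hy => hfg y (ht.trans hy)) (hfg t ht)

lemma contDiffOn_derivWithin {f : ℝ → ℝ} {c : ℝ} (hf : ContDiffOn ℝ ∞ f (Ioi c)) :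
    ContDiffOn ℝ ∞ (derivWithin f (Ici c)) (Ioi c) := by
  refine (hf.deriv_of_isOpen isOpen_Ioi (m := ∞) (by simp)).congr fun t ht => ?_
  exact derivWithin_of_mem_nhds (Ici_mem_nhds ht)

lemma differentiableOn_Ici {f : ℝ → ℝ} {c a : ℝ} (hf : ContDiffOn ℝ ∞ f (Ioi c))
    (h : HasDerivWithinAt f a (Ici c) c) : DifferentiableOn ℝ f (Ici c) := by
  intro t ht
  rcases eq_or_lt_of_le (show c ≤ t from ht) with rfl | ht
  · exact h.differentiableWithinAt
  · exact ((hf.contDiffAt (Ioi_mem_nhds ht)).differentiableAt (by simp)).differentiableWithinAt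

lemma R_c : P.R P.c = 1 / 2 := P.r_deriv.derivWithin (uniqueDiffWithinAt_Ici _)

lemma S_c : P.S P.c = 1 / 2 := P.s_deriv.derivWithin (uniqueDiffWithinAt_Ici _)

lemma monotoneOn_R : MonotoneOn P.R (Ici P.c) :=
  P.r_convex.monotoneOn_derivWithin (differentiableOn_Ici P.r_smooth P.r_deriv)

lemma antitoneOn_S : AntitoneOn P.S (Ici P.c) :=
  P.s_concave.antitoneOn_derivWithin (differentiableOn_Ici P.s_smooth P.s_deriv)

lemma half_le_R {t : ℝ} (ht : P.c ≤ t) : 1 / 2 ≤ P.R t :=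
  P.R_c ▸ P.monotoneOn_R (mem_Ici.2 le_rfl) ht ht

/-- A smooth parametrization `(T, Θ)` of the concatenated curve. -/
structure IsCurve (T Θ : ℝ → ℝ) : Prop where
  T_smooth : ContDiff ℝ ∞ T
  Θ_smooth : ContDiff ℝ ∞ Θ
  T_zero : T 0 = P.c
  Θ_zero : Θ 0 = 1 / 2
  lt_T : ∀ τ, τ ≠ 0 → P.c < T τ
  up : ∀ τ, 0 ≤ τ → Θ τ = P.R (T τ)
  low : ∀ τ ≤ 0, Θ τ = P.S (T τ)
  exists_up : ∀ t, P.c ≤ t → ∃ τ, 0 ≤ τ ∧ T τ = t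
  exists_low : ∀ t, P.c ≤ t → ∃ τ ≤ 0, T τ = t
  deriv_ne : ∀ τ, deriv T τ = 0 → deriv Θ τ ≠ 0

/-- Both half-curves contain `(c, 1/2)`, and injectivity of `γ` places this common point at
parameter `0`. It also makes `0` the only parameter where the first coordinate is `c`. -/
lemma exists_isCurve : ∃ T Θ, P.IsCurve T Θ := by
  obtain ⟨γ, hγ, hinj, hne, hup, hlow⟩ := P.smooth_curve
  have hup1 : ∀ τ, 0 ≤ τ → P.c ≤ (γ τ).1 ∧ (γ τ).2 = P.R (γ τ).1 := by
    intro τ hτ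
    have : γ τ ∈ γ '' Ici 0 := ⟨τ, hτ, rfl⟩
    rw [hup] at this
    obtain ⟨t, ht, h⟩ := this
    rw [← h]
    exact ⟨ht, rfl⟩
  have hlow1 : ∀ τ ≤ 0, P.c ≤ (γ τ).1 ∧ (γ τ).2 = P.S (γ τ).1 := by
    intro τ hτ
    have : γ τ ∈ γ '' Iic 0 := ⟨τ, hτ, rfl⟩
    rw [hlow] at this
    obtain ⟨t, ht, h⟩ := this
    rw [← h]
    exact ⟨ht, rfl⟩
  have hup2 : ∀ t, P.c ≤ t → ∃ τ, 0 ≤ τ ∧ γ τ = (t, P.R t) := by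
    intro t ht
    have : (t, P.R t) ∈ γ '' Ici 0 := by
      rw [hup]
      exact ⟨t, ht, rfl⟩
    exact this
  have hlow2 : ∀ t, P.c ≤ t → ∃ τ ≤ 0, γ τ = (t, P.S t) := by
    intro t ht
    have : (t, P.S t) ∈ γ '' Iic 0 := by
      rw [hlow]
      exact ⟨t, ht, rfl⟩
    exact this
  have hzero : γ 0 = (P.c, 1 / 2) := by
    obtain ⟨τ, hτ, h1⟩ := hup2 P.c le_rfl
    obtain ⟨τ', hτ', h2⟩ := hlow2 P.c le_rfl
    rw [P.R_c] at h1
    rw [P.S_c] at h2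
    have : τ = τ' := hinj (h1.trans h2.symm)
    have : τ = 0 := by linarith
    rw [← this, h1]
  refine ⟨fun τ => (γ τ).1, fun τ => (γ τ).2, hγ.fst, hγ.snd, by simp [hzero], by simp [hzero],
    ?_, fun τ hτ => (hup1 τ hτ).2, fun τ hτ => (hlow1 τ hτ).2, ?_, ?_, ?_⟩
  · intro τ hτ
    have hle : P.c ≤ (γ τ).1 := (le_total 0 τ).elim (fun h => (hup1 τ h).1) fun h => (hlow1 τ h).1
    refine lt_of_le_of_ne hle fun hc => hτ (hinj ?_)
    rw [hzero]
    refine Prod.ext hc.symm ?_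
    rcases le_total 0 τ with h | h
    · rw [(hup1 τ h).2, ← hc, P.R_c]
    · rw [(hlow1 τ h).2, ← hc, P.S_c]
  · intro t ht
    obtain ⟨τ, hτ, h⟩ := hup2 t ht
    exact ⟨τ, hτ, by simp [h]⟩
  · intro t ht
    obtain ⟨τ, hτ, h⟩ := hlow2 t ht
    exact ⟨τ, hτ, by simp [h]⟩
  · intro τ h1 h2
    refine hne τ ?_
    have hd := (hγ.differentiable (by simp) τ).hasDerivAt
    have e1 : deriv (fun τ => (γ τ).1) τ = (deriv γ τ).1 :=
      ((ContinuousLinearMap.fst ℝ ℝ ℝ).hasFDerivAt.comp_hasDerivAt τ hd).deriv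
    have e2 : deriv (fun τ => (γ τ).2) τ = (deriv γ τ).2 :=
      ((ContinuousLinearMap.snd ℝ ℝ ℝ).hasFDerivAt.comp_hasDerivAt τ hd).deriv
    exact Prod.ext (e1 ▸ h1) (e2 ▸ h2)

variable {P}

namespace IsCurve

variable {T Θ : ℝ → ℝ}

lemma c_le_T (h : P.IsCurve T Θ) (τ : ℝ) : P.c ≤ T τ := by
  by_cases hτ : τ = 0
  · rw [hτ, h.T_zero]
  · exact (h.lt_T τ hτ).le

lemma deriv_T_zero (h : P.IsCurve T Θ) : deriv T 0 = 0 := by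
  refine IsLocalMin.deriv_eq_zero (Eventually.of_forall fun τ => ?_)
  rw [h.T_zero]
  exact h.c_le_T τ

/-- The curve is vertical at its leftmost point, so regularity leaves a nonzero second component; it
is positive because `R ≥ 1/2` on the upper half. -/
lemma deriv_Θ_zero_pos (h : P.IsCurve T Θ) : 0 < deriv Θ 0 := by
  refine lt_of_le_of_ne ?_ (h.deriv_ne 0 h.deriv_T_zero).symm
  have hd := (h.Θ_smooth.differentiable (by simp) 0).hasDerivAt
  by_contra hneg
  rw [not_le] at hneg
  have h1 : ∀ᶠ τ in 𝓝[>] (0 : ℝ), slope Θ 0 τ < 0 :=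
    ((hasDerivWithinAt_iff_tendsto_slope' (by simp)).1 
      (hd.hasDerivWithinAt (s := Ioi 0))).eventually_lt_const hneg
  obtain ⟨τ, hτ, hτ0⟩ := (h1.and self_mem_nhdsWithin).exists
  rw [slope_def_field, div_neg_iff] at hτ
  have h2 : 1 / 2 ≤ Θ τ := by
    rw [h.up τ (le_of_lt hτ0)]
    exact P.half_le_R (h.c_le_T τ)
  have h3 : (0 : ℝ) < τ := hτ0
  rw [h.Θ_zero] at hτ
  rcases hτ with hτ | hτ <;> linarith

/-- Monotonicity alone would allow `R = 1/2` near `c`; the positive vertical speed at `τ = 0` gives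
points with `R > 1/2` arbitrarily close to `c`. -/
lemma half_lt_R (h : P.IsCurve T Θ) {t : ℝ} (ht : P.c < t) : 1 / 2 < P.R t := by
  have hd := (h.Θ_smooth.differentiable (by simp) 0).hasDerivAt
  have h1 : ∀ᶠ τ in 𝓝[>] (0 : ℝ), 0 < slope Θ 0 τ :=
    ((hasDerivWithinAt_iff_tendsto_slope' (by simp)).1
      (hd.hasDerivWithinAt (s := Ioi 0))).eventually_const_lt h.deriv_Θ_zero_pos
  have h2 : ∀ᶠ τ in 𝓝[>] (0 : ℝ), T τ < t := by
    refine (h.T_smooth.continuous.continuousAt.eventually_lt_const ?_).filter_mono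
      nhdsWithin_le_nhds
    rwa [h.T_zero]
  obtain ⟨τ, ⟨hs, hT⟩, hτ⟩ := ((h1.and h2).and self_mem_nhdsWithin).exists
  have hτ' : (0 : ℝ) < τ := hτ
  rw [slope_def_field, sub_zero, div_pos_iff_of_pos_right hτ', h.Θ_zero, h.up τ hτ'.le] at hs
  have := P.monotoneOn_R (h.c_le_T τ) (mem_Ici.2 ht.le) hT.le
  linarith

lemma S_lt_half (h : P.IsCurve T Θ) {t : ℝ} (ht : P.c < t) : P.S t < 1 / 2 := by
  have hd := (h.Θ_smooth.differentiable (by simp) 0).hasDerivAt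
  have h1 : ∀ᶠ τ in 𝓝[<] (0 : ℝ), 0 < slope Θ 0 τ :=
    ((hasDerivWithinAt_iff_tendsto_slope' (by simp)).1
      (hd.hasDerivWithinAt (s := Iio 0))).eventually_const_lt h.deriv_Θ_zero_pos
  have h2 : ∀ᶠ τ in 𝓝[<] (0 : ℝ), T τ < t := by
    refine (h.T_smooth.continuous.continuousAt.eventually_lt_const ?_).filter_mono
      nhdsWithin_le_nhds
    rwa [h.T_zero]
  obtain ⟨τ, ⟨hs, hT⟩, hτ⟩ := ((h1.and h2).and self_mem_nhdsWithin).exists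
  have hτ' : τ < (0 : ℝ) := hτ
  rw [slope_def_field, sub_zero, div_pos_iff, h.Θ_zero, h.low τ hτ'.le] at hs
  have := P.antitoneOn_S (h.c_le_T τ) (mem_Ici.2 ht.le) hT.le
  rcases hs with hs | hs <;> linarith

lemma isBranch_S (h : P.IsCurve T Θ) : IsBranch P.c P.S where
  smooth := contDiffOn_derivWithin P.s_smooth
  anti := P.antitoneOn_S
  zero t ht := derivWithin_Ici_of_eq (by linarith [P.c_pos] : P.c < 2 * P.c) P.s_smooth P.s_eq
    (hasDerivAt_const t 0) ht
  lt t ht := h.S_lt_half ht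

lemma isBranch_R (h : P.IsCurve T Θ) : IsBranch P.c fun t => 1 - P.R t where
  smooth := contDiffOn_const.sub (contDiffOn_derivWithin P.r_smooth)
  anti x hx y hy hxy := sub_le_sub_left (P.monotoneOn_R hx hy hxy) 1
  zero t ht := by
    rw [sub_eq_zero]
    exact (derivWithin_Ici_of_eq (by linarith [P.c_pos] : P.c < 2 * P.c) P.r_smooth P.r_eq
      (hasDerivAt_id t) ht).symm
  lt t ht := by linarith [h.half_lt_R ht]

end IsCurve

end SurgeryProfile

end TropLag
end

/-! ### The neck coordinate `u`. -/

noncomputable section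

namespace TropLag

open Set Metric Filter Topology
open scoped NNReal Pointwise

namespace SurgeryProfile.IsCurve

variable {P : SurgeryProfile} {T Θ : ℝ → ℝ}

/-- Along the flattened curve `U = (θ - 1/2) t` is a diffeomorphism of the line, and the shape is `T
∘ U⁻¹`. At `τ = 0` its derivative is `c` times the vertical speed; elsewhere it is `T'` times a
factor that the inequality in `IsCutBranch` keeps nonzero. Far out `θ` is `0` or `1`, so `U = ∓ T /
2`, which gives `t = 2|u|`. -/
theorem exists_neckShape (h : P.IsCurve T Θ) {a₀ a₁ : ℝ → ℝ} {l c₀ : ℝ} (hl : P.c < l)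
    (hc₀ : P.c < 2 * c₀) (h₀ : ContDiff ℝ ∞ a₀) (h₁ : ContDiff ℝ ∞ a₁)
    (d₀ : ∀ t ≤ l, deriv a₀ t = 0) (d₁ : ∀ t ≤ l, deriv a₁ t = 0)
    (b₀ : IsCutBranch P.c (2 * c₀) fun t => P.S t + deriv a₀ t)
    (b₁ : IsCutBranch P.c (2 * c₀) fun t => 1 - P.R t + deriv a₁ t) :
    ∃ t, IsNeckShape c₀ P.c t ∧
      Parametrizes P.c c₀ (fun t => P.S t + deriv a₀ t) (fun t => P.R t - deriv a₁ t) t := by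
  have hcpos := P.c_pos
  have hTd : ∀ τ, HasDerivAt T (deriv T τ) τ := fun τ =>
    (h.T_smooth.differentiable (by simp) τ).hasDerivAt
  have hΘd : ∀ τ, HasDerivAt Θ (deriv Θ τ) τ := fun τ =>
    (h.Θ_smooth.differentiable (by simp) τ).hasDerivAt
  have h₀' : ContDiff ℝ ∞ (deriv a₀) := (contDiff_infty_iff_deriv.1 h₀).2
  have h₁' : ContDiff ℝ ∞ (deriv a₁) := (contDiff_infty_iff_deriv.1 h₁).2
  set Θ' : ℝ → ℝ := fun τ => Θ τ + if τ ≤ 0 then deriv a₀ (T τ) else -deriv a₁ (T τ) with hΘ'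
  have hlow : ∀ τ ≤ 0, Θ' τ = P.S (T τ) + deriv a₀ (T τ) := fun τ hτ => by
    simp only [hΘ', if_pos hτ, h.low τ hτ]
  have hup : ∀ τ, 0 ≤ τ → Θ' τ = P.R (T τ) - deriv a₁ (T τ) := by
    intro τ hτ
    rcases hτ.eq_or_lt with rfl | hτ
    · rw [hlow 0 le_rfl, ← h.low 0 le_rfl, h.up 0 le_rfl, h.T_zero, d₀ _ hl.le, d₁ _ hl.le]
      ring
    · simp only [hΘ', if_neg (not_le.2 hτ), h.up τ hτ.le]
      ring
  have hnear : Θ' =ᶠ[𝓝 0] Θ := by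
    have h2 : ∀ᶠ τ in 𝓝 (0 : ℝ), T τ < l := by
      refine h.T_smooth.continuous.continuousAt.eventually_lt_const ?_
      rwa [h.T_zero]
    filter_upwards [h2] with τ hτ
    simp [hΘ', d₀ _ hτ.le, d₁ _ hτ.le]
  have hΘ's : ContDiff ℝ ∞ Θ' := by
    rw [contDiff_iff_contDiffAt]
    intro τ
    rcases lt_trichotomy τ 0 with hτ | rfl | hτ
    · refine ((h.Θ_smooth.add (h₀'.comp h.T_smooth)).contDiffAt).congr_of_eventuallyEq ?_
      filter_upwards [Iio_mem_nhds hτ] with y hy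
      simp only [hΘ', if_pos (mem_Iio.1 hy).le]
      rfl
    · exact h.Θ_smooth.contDiffAt.congr_of_eventuallyEq hnear
    · refine ((h.Θ_smooth.add (h₁'.comp h.T_smooth).neg).contDiffAt).congr_of_eventuallyEq ?_
      filter_upwards [Ioi_mem_nhds hτ] with y hy
      simp only [hΘ', if_neg (not_le.2 (mem_Ioi.1 hy))]
      rfl
  set U : ℝ → ℝ := fun τ => (Θ' τ - 1 / 2) * T τ with hU
  have hUs : ContDiff ℝ ∞ U := (hΘ's.sub contDiff_const).mul h.T_smooth
  have hUd : ∀ τ, HasDerivAt U (deriv U τ) τ := fun τ =>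
    (hUs.differentiable (by simp) τ).hasDerivAt
  -- the derivative of `U`
  have hU0 : 0 < deriv U 0 := by
    have h1 : HasDerivAt U _ 0 := ((((hΘd 0).congr_of_eventuallyEq hnear).sub_const (1 / 2)).mul (hTd 0))
    rw [h1.deriv, h.deriv_T_zero, h.T_zero, mul_zero, add_zero]
    exact mul_pos h.deriv_Θ_zero_pos hcpos
  -- Away from `τ = 0` the second coordinate is a differentiable function of the first, so `T' = 0`
  -- would make the whole velocity vanish.
  have hT' : ∀ τ, τ ≠ 0 → deriv T τ ≠ 0 := by
    intro τ hτ hz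
    refine h.deriv_ne τ hz ?_
    rcases lt_or_gt_of_ne hτ with hτ' | hτ'
    · obtain ⟨D, hD, -⟩ := h.isBranch_S.hasDerivAt (h.lt_T τ hτ)
      have h1 : Θ =ᶠ[𝓝 τ] P.S ∘ T := by
        filter_upwards [Iio_mem_nhds hτ'] with y hy
        exact h.low y (le_of_lt hy)
      rw [h1.deriv_eq, (hD.comp τ (hTd τ)).deriv, hz, mul_zero]
    · obtain ⟨D, hD, -⟩ := h.isBranch_R.hasDerivAt (h.lt_T τ hτ)
      have h1 : Θ =ᶠ[𝓝 τ] fun y => 1 - ((fun t => 1 - P.R t) ∘ T) y := by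
        filter_upwards [Ioi_mem_nhds hτ'] with y hy
        rw [h.up y (le_of_lt hy)]
        simp
      rw [h1.deriv_eq, ((hD.comp τ (hTd τ)).const_sub 1).deriv, hz, mul_zero, neg_zero]
  have hUne : ∀ τ, deriv U τ ≠ 0 := by
    intro τ
    rcases lt_trichotomy τ 0 with hτ | rfl | hτ
    · obtain ⟨D, hD, hlt⟩ := b₀.deriv _ (h.lt_T τ hτ.ne)
      have h1 := (((hD.comp τ (hTd τ)).sub_const (1 / 2)).mul (hTd τ))
      have h2 : U =ᶠ[𝓝 τ]
          ((fun y => ((fun t => P.S t + deriv a₀ t) ∘ T) y - 1 / 2) * T) := by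
        filter_upwards [Iio_mem_nhds hτ] with y hy
        simp only [hU, hlow y (le_of_lt hy)]
        rfl
      rw [h2.deriv_eq, h1.deriv]
      have h3 := hT' τ hτ.ne
      have h4 : D * T τ + (P.S (T τ) + deriv a₀ (T τ)) - 1 / 2 ≠ 0 := by linarith
      have := mul_ne_zero h4 h3
      simp only [Function.comp_apply]
      intro hz
      exact this (by linear_combination hz)
    · exact hU0.ne'
    · obtain ⟨D, hD, hlt⟩ := b₁.deriv _ (h.lt_T τ hτ.ne')
      have h1 := (((hD.comp τ (hTd τ)).const_sub (1 / 2)).mul (hTd τ))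
      have h2 : U =ᶠ[𝓝 τ]
          ((fun y => 1 / 2 - ((fun t => 1 - P.R t + deriv a₁ t) ∘ T) y) * T) := by
        filter_upwards [Ioi_mem_nhds hτ] with y hy
        simp only [hU, hup y (le_of_lt hy), Pi.mul_apply, Function.comp_apply]
        ring
      rw [h2.deriv_eq, h1.deriv]
      have h3 := hT' τ hτ.ne'
      have h4 : D * T τ + (1 - P.R (T τ) + deriv a₁ (T τ)) - 1 / 2 ≠ 0 := by linarith
      have := mul_ne_zero h4 h3
      simp only [Function.comp_apply]
      intro hz
      exact this (by linear_combination -hz)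
  have hUpos : ∀ τ, 0 < deriv U τ := by
    -- By Darboux a derivative without zeros has constant sign, and the sign is known at `0`.
    rcases hasDerivWithinAt_forall_lt_or_forall_gt_of_forall_ne convex_univ
      (fun τ _ => (hUd τ).hasDerivWithinAt) (m := 0) (fun τ _ => hUne τ) with hlt | hgt
    · exact absurd (hlt 0 (mem_univ _)) (not_lt.2 hU0.le)
    · exact fun τ => hgt τ (mem_univ _)
  have hmono : StrictMono U := strictMono_of_deriv_pos hUpos
  have hU00 : U 0 = 0 := by
    have h1 : Θ' 0 = 1 / 2 := hnear.self_of_nhds.trans h.Θ_zero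
    simp only [hU, h1, sub_self, zero_mul]
  -- the values of `U` far out
  have hUlow : ∀ τ ≤ 0, 2 * c₀ ≤ T τ → U τ = -(T τ / 2) := by
    intro τ hτ hT
    simp only [hU, hlow τ hτ, b₀.zero _ hT]
    ring
  have hUup : ∀ τ, 0 ≤ τ → 2 * c₀ ≤ T τ → U τ = T τ / 2 := by
    intro τ hτ hT
    have := b₁.zero _ hT
    simp only [hU, hup τ hτ]
    linear_combination -T τ * this
  have hsurj : Function.Surjective U := by
    intro y
    have hy := abs_nonneg y
    refine mem_range_of_exists_le_of_exists_ge hUs.continuous ?_ ?_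
    · obtain ⟨τ, hτ, hT⟩ := h.exists_low (2 * c₀ + 2 * |y|) (by linarith)
      refine ⟨τ, ?_⟩
      rw [hUlow τ hτ (by linarith), hT]
      linarith [neg_abs_le y]
    · obtain ⟨τ, hτ, hT⟩ := h.exists_up (2 * c₀ + 2 * |y|) (by linarith)
      refine ⟨τ, ?_⟩
      rw [hUup τ hτ (by linarith), hT]
      linarith [le_abs_self y]
  let e : ℝ ≃o ℝ := hmono.orderIsoOfSurjective U hsurj
  have he : ∀ τ, e τ = U τ := fun τ => rfl
  have hes : ContDiff ℝ ∞ e.symm := e.toHomeomorph.contDiff_symm_deriv hUne hUd hUs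
  have hUe : ∀ u, U (e.symm u) = u := fun u => e.apply_symm_apply u
  have heU : ∀ τ, e.symm (U τ) = τ := fun τ => e.symm_apply_apply τ
  have hsign : ∀ u, 0 ≤ u ↔ 0 ≤ e.symm u := by
    intro u
    have h0 : e.symm 0 = 0 := by rw [← hU00, heU, hU00]
    rw [← e.symm.le_iff_le, h0]
  have hsign' : ∀ u, u ≤ 0 ↔ e.symm u ≤ 0 := by
    intro u
    have h0 : e.symm 0 = 0 := by rw [← hU00, heU, hU00]
    rw [← e.symm.le_iff_le, h0]
  have hTpos : ∀ τ, 0 < T τ := fun τ => hcpos.trans_le (h.c_le_T τ)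
  have hΘ'u : ∀ u, Θ' (e.symm u) = 1 / 2 + u / T (e.symm u) := by
    intro u
    have h1 := hUe u
    have h2 := (hTpos (e.symm u)).ne'
    simp only [hU] at h1
    rw [eq_comm, ← sub_eq_iff_eq_add', eq_comm] at *
    field_simp
    linarith
  have hUabs : ∀ τ, |U τ| ≤ T τ / 2 := by
    intro τ
    have hT := hTpos τ
    by_cases hτ0 : τ = 0
    · rw [hτ0, hU00, abs_zero]
      exact (half_pos (hTpos 0)).le
    have hc := h.lt_T τ hτ0
    rcases le_total τ 0 with hτ | hτ
    · have g1 := b₀.nonneg _ hc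
      have g2 := b₀.lt _ hc
      rw [abs_le]
      simp only [hU, hlow τ hτ]
      constructor <;> nlinarith
    · have g1 := b₁.nonneg _ hc
      have g2 := b₁.lt _ hc
      rw [abs_le]
      simp only [hU, hup τ hτ]
      constructor <;> nlinarith
  refine ⟨fun u => T (e.symm u), ⟨h.T_smooth.comp hes, hcpos, fun u => h.c_le_T _, ?_, ?_, ?_⟩,
    ⟨?_, ?_, ?_, ?_, b₀.zero, ?_⟩⟩
  · intro u
    have := hUabs (e.symm u)
    rw [hUe] at this
    linarith
  · intro u hu
    have h1 := hUabs (e.symm u)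
    rw [hUe] at h1
    have h2 : 2 * c₀ ≤ T (e.symm u) := by linarith
    rcases le_total u 0 with hu0 | hu0
    · have := hUlow _ ((hsign' u).1 hu0) h2
      rw [hUe] at this
      rw [abs_of_nonpos hu0]
      linarith
    · have := hUup _ ((hsign u).1 hu0) h2
      rw [hUe] at this
      rw [abs_of_nonneg hu0]
      linarith
  · intro u hu
    by_contra hcon
    rw [not_le] at hcon
    rcases le_total u 0 with hu0 | hu0
    · have := hUlow _ ((hsign' u).1 hu0) hcon.le
      rw [hUe] at this
      rw [abs_of_nonpos hu0] at hu
      linarith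
    · have := hUup _ ((hsign u).1 hu0) hcon.le
      rw [hUe] at this
      rw [abs_of_nonneg hu0] at hu
      linarith
  · intro u hu
    rw [← hΘ'u, hlow _ ((hsign' u).1 hu)]
  · intro u hu
    rw [← hΘ'u, hup _ ((hsign u).1 hu)]
  · intro y hy
    obtain ⟨τ, hτ, hT⟩ := h.exists_low y hy
    refine ⟨U τ, ?_, ?_⟩
    · rw [hsign', heU]
      exact hτ
    · simp only [heU, hT]
  · intro y hy
    obtain ⟨τ, hτ, hT⟩ := h.exists_up y hy
    refine ⟨U τ, ?_, ?_⟩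
    · rw [hsign, heU]
      exact hτ
    · simp only [heU, hT]
  · intro y hy
    have := b₁.zero y hy
    linarith

end SurgeryProfile.IsCurve

end TropLag
end

/-! ### Isotopies between Lagrangians with parametrized necks. -/

noncomputable section

namespace TropLag

open Set Metric Filter Topology
open scoped NNReal Pointwise

variable {n : ℕ}

namespace IsNeckShape

variable {c₀ m : ℝ} {t : ℝ → ℝ}

lemma mono (h : IsNeckShape c₀ m t) {c₁ : ℝ} (hc : c₀ ≤ c₁) : IsNeckShape c₁ m t where
  smooth := h.smooth
  pos := h.pos
  le := h.le
  two_mul_abs_le := h.two_mul_abs_le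
  eq u hu := h.eq u (hc.trans hu)
  le_of_abs_le u hu := by
    rcases le_total |u| c₀ with h' | h'
    · linarith [h.le_of_abs_le u h']
    · linarith [h.eq u h']

lemma mono_left (h : IsNeckShape c₀ m t) {m' : ℝ} (hm' : 0 < m') (hm : m' ≤ m) :
    IsNeckShape c₀ m' t where
  smooth := h.smooth
  pos := hm'
  le u := hm.trans (h.le u)
  two_mul_abs_le := h.two_mul_abs_le
  eq := h.eq
  le_of_abs_le := h.le_of_abs_le

/-- The ends `t = 2|u|` are invariant under simultaneous rescaling of `t` and `u`, so a neck can be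
shrunk to any size. -/
lemma scale (h : IsNeckShape c₀ m t) {a : ℝ} (ha : 0 < a) :
    IsNeckShape (a * c₀) (a * m) fun u => a * t (u / a) where
  smooth := contDiff_const.mul (h.smooth.comp (by fun_prop))
  pos := mul_pos ha h.pos
  le u := mul_le_mul_of_nonneg_left (h.le _) ha.le
  two_mul_abs_le u := by
    have := mul_le_mul_of_nonneg_left (h.two_mul_abs_le (u / a)) ha.le
    rwa [abs_div, abs_of_pos ha, mul_left_comm, mul_div_cancel₀ _ ha.ne'] at this
  eq u hu := by
    rw [h.eq, abs_div, abs_of_pos ha, mul_left_comm, mul_div_cancel₀ _ ha.ne']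
    rw [abs_div, abs_of_pos ha, le_div_iff₀ ha]
    linarith
  le_of_abs_le u hu := by
    have := mul_le_mul_of_nonneg_left (h.le_of_abs_le (u / a) (by
      rw [abs_div, abs_of_pos ha, div_le_iff₀ ha]
      linarith)) ha.le
    linarith

lemma zero_le (h : IsNeckShape c₀ m t) : 0 ≤ c₀ := by
  by_contra hc
  rw [not_le] at hc
  have := h.eq 0 (by rw [abs_zero]; exact hc.le)
  rw [abs_zero, mul_zero] at this
  linarith [h.le 0, h.pos]

lemma m_le (h : IsNeckShape c₀ m t) : m ≤ 2 * c₀ :=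
  (h.le 0).trans (h.le_of_abs_le 0 (by rw [abs_zero]; exact h.zero_le))

end IsNeckShape

namespace TropicalPolynomial

variable {φ : TropicalPolynomial n}

/-- The upper sheet over a point is the end of the segment spanned by `df_v`. -/
lemma proj_gradient_prim {ψ : Q n → ℝ} (hψ : ContDiff ℝ ∞ ψ) (v : Fin n → ℤ) (x : Q n) :
    proj (x, gradient (φ.prim ψ v) x) = proj (x, -gradient ψ x) := by
  rw [φ.gradient_prim (hψ.differentiable (by simp)), ← proj_add_intVec (x, -gradient ψ x) v]
  congr 1
  refine Prod.ext (by simp) ?_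
  simp [sub_eq_neg_add]

/-- For `2 c₀ ≤ f_v ≤ 2c` the flattened profile has `S = 0` and `R = 1`, so this part of the neck
already belongs to the two sheets; the rest is reparametrized by `u`. -/
lemma sheets_eq_necked {ψ : Q n → ℝ} (hψ : ContDiff ℝ ∞ ψ) {c c₀ m K δ : ℝ}
    (hsep : φ.Separated ψ m (2 * c) K δ) (hc : c < 2 * c₀) (hc' : c₀ < c) {S R t : ℝ → ℝ}
    (ht : IsNeckShape c₀ c t) (hp : Parametrizes c c₀ S R t) :
    φ.sheets ψ c S R = φ.necked ψ c₀ t := by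
  have hother : ∀ v ∈ φ.vertexSet, ∀ x, φ.prim ψ v x ≤ 2 * c → 2 * c₀ ≤ φ.prim ψ v x →
      ∀ w ∈ φ.vertexSet, 2 * c₀ ≤ φ.prim ψ w x := by
    intro v hv x h1 h2 w hw
    by_contra hcon
    rw [not_le] at hcon
    have := hsep.disjoint v hv w hw x h1 (by linarith)
    subst this
    linarith
  ext z
  constructor
  · rintro (⟨x, hx, hz⟩ | hz)
    · exact Or.inl ⟨x, fun v hv => by linarith [hx v hv], hz⟩
    · simp only [mem_iUnion] at hz
      obtain ⟨v, hv, x, h1, h2, hz⟩ := hz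
      rcases le_or_gt (2 * c₀) (φ.prim ψ v x) with h3 | h3
      · refine Or.inl ⟨x, hother v hv x h2 h3, ?_⟩
        rw [hp.low_zero _ h3, hp.up_one _ h3, zero_smul, one_smul, proj_gradient_prim hψ] at hz
        exact hz.symm
      · refine Or.inr ?_
        simp only [mem_iUnion]
        rcases hz with rfl | rfl
        · obtain ⟨u, hu, htu⟩ := hp.exists_up _ h1
          refine ⟨v, hv, x, u, by linarith [ht.two_mul_abs_le u], htu.symm, ?_⟩
          rw [← hp.up u hu, htu]
        · obtain ⟨u, hu, htu⟩ := hp.exists_low _ h1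
          refine ⟨v, hv, x, u, by linarith [ht.two_mul_abs_le u], htu.symm, ?_⟩
          rw [← hp.low u hu, htu]
  · rintro (⟨x, hx, hz⟩ | hz)
    · by_cases hall : ∀ v ∈ φ.vertexSet, 2 * c ≤ φ.prim ψ v x
      · exact Or.inl ⟨x, hall, hz⟩
      · push Not at hall
        obtain ⟨v, hv, hlt⟩ := hall
        have h3 := hx v hv
        refine Or.inr ?_
        simp only [mem_iUnion]
        refine ⟨v, hv, x, by linarith, hlt.le, ?_⟩
        rw [hp.low_zero _ h3, hp.up_one _ h3, zero_smul, one_smul, proj_gradient_prim hψ]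
        exact hz.symm
    · simp only [mem_iUnion] at hz
      obtain ⟨v, hv, x, u, hu, hf, rfl⟩ := hz
      refine Or.inr ?_
      simp only [mem_iUnion]
      refine ⟨v, hv, x, hf ▸ ht.le u, by linarith [ht.le_of_abs_le u hu], ?_⟩
      rw [hf]
      rcases le_total 0 u with h0 | h0
      · left
        rw [hp.up u h0]
      · right
        rw [hp.low u h0]

/-- For `|u| ≥ c₀` the shape `2|u|` gives coefficient `0` or `1`, so this part of the neck lies on
the sheets and the boundary between neck and sheet can be moved. -/
lemma necked_eq_of_le {ψ : Q n → ℝ} (hψ : ContDiff ℝ ∞ ψ) {c₀ c₁ m m' M K δ : ℝ}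
    (hsep : φ.Separated ψ m' M K δ) (hc : c₀ ≤ c₁) (hM : 2 * c₁ < M) {t : ℝ → ℝ}
    (ht : IsNeckShape c₀ m t) : φ.necked ψ c₀ t = φ.necked ψ c₁ t := by
  have hpos : 0 < c₀ := by linarith [ht.pos, ht.m_le]
  ext z
  constructor
  · rintro (⟨x, hx, hz⟩ | hz)
    · by_cases hall : ∀ v ∈ φ.vertexSet, 2 * c₁ ≤ φ.prim ψ v x
      · exact Or.inl ⟨x, hall, hz⟩
      · push Not at hall
        obtain ⟨v, hv, hlt⟩ := hall
        have h3 := hx v hv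
        have h4 : 0 < φ.prim ψ v x := by linarith
        refine Or.inr ?_
        simp only [mem_iUnion]
        rcases hz with rfl | rfl
        · have e1 : t (-(φ.prim ψ v x / 2)) = φ.prim ψ v x := by
            rw [ht.eq, abs_neg, abs_of_pos (by linarith)]
            · ring
            · rw [abs_neg, abs_of_pos (by linarith)]
              linarith
          refine ⟨v, hv, x, -(φ.prim ψ v x / 2), ?_, e1.symm, ?_⟩
          · rw [abs_neg, abs_of_pos (by linarith)]
            linarith
          · rw [e1, show 1 / 2 + -(φ.prim ψ v x / 2) / φ.prim ψ v x = 0 by field_simp; ring,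
              zero_smul]
        · have e1 : t (φ.prim ψ v x / 2) = φ.prim ψ v x := by
            rw [ht.eq, abs_of_pos (by linarith)]
            · ring
            · rw [abs_of_pos (by linarith)]
              linarith
          refine ⟨v, hv, x, φ.prim ψ v x / 2, ?_, e1.symm, ?_⟩
          · rw [abs_of_pos (by linarith)]
            linarith
          · rw [e1, show 1 / 2 + φ.prim ψ v x / 2 / φ.prim ψ v x = 1 by field_simp; ring,
              one_smul, proj_gradient_prim hψ]
    · simp only [mem_iUnion] at hz
      obtain ⟨v, hv, x, u, hu, hz⟩ := hz
      refine Or.inr ?_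
      simp only [mem_iUnion]
      exact ⟨v, hv, x, u, hu.trans hc, hz⟩
  · rintro (⟨x, hx, hz⟩ | hz)
    · exact Or.inl ⟨x, fun v hv => by linarith [hx v hv], hz⟩
    · simp only [mem_iUnion] at hz
      obtain ⟨v, hv, x, u, hu, hf, rfl⟩ := hz
      rcases le_or_gt |u| c₀ with h1 | h1
      · refine Or.inr ?_
        simp only [mem_iUnion]
        exact ⟨v, hv, x, u, h1, hf, rfl⟩
      · have htu := ht.eq u h1.le
        refine Or.inl ⟨x, fun w hw => ?_, ?_⟩
        · by_contra hcon
          have := hsep.disjoint v hv w hw x (by linarith) (by linarith)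
          subst this
          linarith
        · rw [htu]
          rcases le_total 0 u with h0 | h0
          · right
            rw [abs_of_nonneg h0] at h1 ⊢
            rw [show 1 / 2 + u / (2 * u) = 1 by
              have : u ≠ 0 := by linarith
              field_simp
              ring, one_smul, proj_gradient_prim hψ]
          · left
            rw [abs_of_nonpos h0] at h1 ⊢
            rw [show 1 / 2 + u / (2 * -u) = 0 by
              have : u ≠ 0 := by linarith
              field_simp
              ring, zero_smul]

/-- Changing the shape of the necks. -/
theorem hamiltonianIsotopic_necked_shape {ψ : Q n → ℝ} (hψ : ContDiff ℝ ∞ ψ) {c₀ m M K δ : ℝ}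
    (hδ : 0 < δ) (hsep : φ.Separated ψ (m / 4) M K δ) (hM : 2 * c₀ < M) {t₀ t₁ : ℝ → ℝ}
    (h₀ : IsNeckShape c₀ m t₀) (h₁ : IsNeckShape c₀ m t₁) :
    HamiltonianIsotopic (φ.necked ψ c₀ t₀) (φ.necked ψ c₀ t₁) := by
  have hp₀ : ∀ u, 0 < t₀ u := fun u => h₀.pos.trans_le (h₀.le u)
  have hp₁ : ∀ u, 0 < t₁ u := fun u => h₁.pos.trans_le (h₁.le u)
  -- The required `B'` is `log (t₀ / t₁)`. It vanishes for `|u| ≥ c₀`, where both shapes are `2|u|`,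
  -- so its primitive is constant at both ends, as `NeckMove` demands.
  set b : ℝ → ℝ := fun u => Real.log (t₀ u) - Real.log (t₁ u) with hb
  have hbs : ContDiff ℝ ∞ b := (h₀.smooth.log fun u => (hp₀ u).ne').sub
    (h₁.smooth.log fun u => (hp₁ u).ne')
  have hb0 : ∀ u, c₀ ≤ |u| → b u = 0 := fun u hu => by
    simp only [hb, h₀.eq u hu, h₁.eq u hu, sub_self]
  have hc := h₀.zero_le
  set B : ℝ → ℝ := fun u => ∫ x in (-c₀)..u, b x with hB
  have hBd : ∀ u, deriv B u = b u := fun u => (hasDerivAt_integral hbs.continuous _ u).deriv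
  let N : NeckMove φ :=
    { ψ := ψ
      g := fun _ => 0
      B := B
      κ := B c₀
      c := c₀
      m := m
      M := M
      K := K
      δ := δ
      C := 0
      ψ_smooth := hψ
      g_smooth := contDiff_const
      B_smooth := contDiff_integral hbs _
      g_bound := fun x => by simp
      B_low := fun u hu => by
        simp only [hB]
        rw [intervalIntegral.integral_congr (g := fun _ => 0), intervalIntegral.integral_zero]
        intro y hy
        rw [uIcc_of_ge hu] at hy
        refine hb0 y ?_
        rw [abs_of_nonpos (by linarith [hy.2])]
        linarith [hy.2]
      B_high := fun u hu => by
        have := intervalIntegral.integral_add_adjacent_intervals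
          (hbs.continuous.intervalIntegrable (μ := MeasureTheory.volume) (-c₀) c₀)
          (hbs.continuous.intervalIntegrable c₀ u)
        rw [intervalIntegral.integral_congr (a := c₀) (g := fun _ => 0),
          intervalIntegral.integral_zero, add_zero] at this
        · exact this.symm
        · intro y hy
          rw [uIcc_of_le hu] at hy
          exact hb0 y (hy.1.trans (le_abs_self y))
      m_pos := h₀.pos
      m_le := h₀.m_le
      c_lt := hM
      δ_pos := hδ
      sep := fun σ _ => by simpa using hsep }
  have := N.hamiltonianIsotopic (t₀ := t₀) (t₁ := t₁) (fun u _ => by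
    change t₁ u = t₀ u * Real.exp (-deriv B u)
    rw [hBd, hb]
    simp only
    rw [neg_sub, Real.exp_sub, Real.exp_log (hp₁ u), Real.exp_log (hp₀ u),
      mul_div_cancel₀ _ (hp₀ u).ne']) (fun u _ => h₀.le u) (fun u _ => h₁.le u)
    h₀.le_of_abs_le h₁.le_of_abs_le (fun u _ => h₀.two_mul_abs_le u) fun u _ => h₁.two_mul_abs_le u
  have e : ∀ σ, N.pot σ = ψ := fun σ => funext fun x => by
    change ψ x - σ * 0 = ψ x
    ring
  rwa [e, e] at this

/-- Changing the potential. -/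
theorem hamiltonianIsotopic_necked_potential {ψ₁ ψ₂ : Q n → ℝ} (hψ₁ : ContDiff ℝ ∞ ψ₁)
    (hψ₂ : ContDiff ℝ ∞ ψ₂) {C : ℝ} (hC : ∀ x, |ψ₁ x - ψ₂ x| ≤ C) {c₀ m M K δ : ℝ} (hδ : 0 < δ)
    (hsep : ∀ σ ∈ Icc (0 : ℝ) 1,
      φ.Separated (fun x => (1 - σ) * ψ₁ x + σ * ψ₂ x) (m / 4) M K δ)
    (hM : 2 * c₀ < M) {t : ℝ → ℝ} (h : IsNeckShape c₀ m t) :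
    HamiltonianIsotopic (φ.necked ψ₁ c₀ t) (φ.necked ψ₂ c₀ t) := by
  -- With `B = 0` the shape is unchanged, and `ψ₁ - σ (ψ₁ - ψ₂)` is the linear interpolation of the
  -- potentials.
  let N : NeckMove φ :=
    { ψ := ψ₁
      g := fun x => ψ₁ x - ψ₂ x
      B := fun _ => 0
      κ := 0
      c := c₀
      m := m
      M := M
      K := K
      δ := δ
      C := C
      ψ_smooth := hψ₁
      g_smooth := hψ₁.sub hψ₂
      B_smooth := contDiff_const
      g_bound := hC
      B_low := fun _ _ => rfl
      B_high := fun _ _ => rfl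
      m_pos := h.pos
      m_le := h.m_le
      c_lt := hM
      δ_pos := hδ
      sep := fun σ hσ => by
        convert hsep σ hσ using 2
        ring }
  have := N.hamiltonianIsotopic (t₀ := t) (t₁ := t) (fun u _ => by
      change t u = t u * Real.exp (-deriv (fun _ => 0) u)
      simp) (fun u _ => h.le u) (fun u _ => h.le u)
    h.le_of_abs_le h.le_of_abs_le (fun u _ => h.two_mul_abs_le u) fun u _ => h.two_mul_abs_le u
  have e0 : N.pot 0 = ψ₁ := funext fun x => by
    change ψ₁ x - 0 * (ψ₁ x - ψ₂ x) = ψ₁ x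
    ring
  have e1 : N.pot 1 = ψ₂ := funext fun x => by
    change ψ₁ x - 1 * (ψ₁ x - ψ₂ x) = ψ₂ x
    ring
  rwa [e0, e1] at this

lemma contDiff_smoothing {ε : ℝ} (ρ : SmoothingKernel n ε) : ContDiff ℝ ∞ (φ.smoothing ρ) := by
  rw [smoothing_eq_mollify]
  exact φ.contDiff_mollify ρ.isMollifier

lemma lagrangian_eq_sheets {ε : ℝ} (D : SurgeryData φ ε) :
    φ.lagrangian D = φ.sheets (φ.smoothing D.kernel) D.profile.c D.profile.S D.profile.R := by
  have hneg : ∀ x, gradient (fun y => -φ.smoothing D.kernel y) x =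
      -gradient (φ.smoothing D.kernel) x := by
    intro x
    have h1 := (((φ.contDiff_smoothing D.kernel).differentiable (by simp) x).hasGradientAt).hasFDerivAt
    have h2 : HasGradientAt (fun y => -φ.smoothing D.kernel y)
        (-gradient (φ.smoothing D.kernel) x) x := by
      rw [hasGradientAt_iff_hasFDerivAt, map_neg]
      exact h1.neg
    exact h2.gradient
  unfold lagrangian sheets section_
  simp only [hneg, gradient_fun_const]
  rfl

/-- The ends of the necks of a tropical Lagrangian can be flattened. -/
theorem exists_necked {ε : ℝ} (D : SurgeryData φ ε)
    (hsep : ∀ m > 0, ∃ K, ∃ δ > 0,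
      φ.Separated (φ.smoothing D.kernel) m (2 * D.profile.c) K δ) :
    ∃ c₀ t, D.profile.c < 2 * c₀ ∧ c₀ < D.profile.c ∧ IsNeckShape c₀ D.profile.c t ∧
      HamiltonianIsotopic (φ.lagrangian D) (φ.necked (φ.smoothing D.kernel) c₀ t) := by
  set P := D.profile with hP
  have hψ := φ.contDiff_smoothing D.kernel
  have hc := P.c_pos
  obtain ⟨T, Θ, hcurve⟩ := P.exists_isCurve
  obtain ⟨K, δ, hδ, hs⟩ := hsep P.c hc
  have hK : 0 ≤ K := (norm_nonneg _).trans (hs.gradient_le 0)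
  -- Gradients of primitives are bounded by `2K`, so branches within `κ` of `0` and `1` stay inside
  -- the bumps around the sheets.
  obtain ⟨κ, hκ, hκ4, hκK⟩ : ∃ κ > 0, κ ≤ 1 / 4 ∧ κ * (2 * K) < min (1 / 4) (δ / 16) := by
    have hρ : 0 < min (1 / 4) (δ / 16) := by positivity
    refine ⟨min (1 / 4) (min (1 / 4) (δ / 16) / (2 * K + 1)), by positivity, min_le_left _ _, ?_⟩
    calc min (1 / 4) (min (1 / 4) (δ / 16) / (2 * K + 1)) * (2 * K)
        ≤ min (1 / 4) (δ / 16) / (2 * K + 1) * (2 * K) := by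
          gcongr
          exact min_le_right _ _
      _ < min (1 / 4) (δ / 16) / (2 * K + 1) * (2 * K + 1) := by
          have : 0 < min (1 / 4) (δ / 16) / (2 * K + 1) := by positivity
          nlinarith
      _ = _ := div_mul_cancel₀ _ (by positivity)
  obtain ⟨l₀, hcl₀, hl₀, hSl⟩ := hcurve.isBranch_S.exists_le hc (half_pos hκ)
  obtain ⟨l₁, hcl₁, hl₁, hRl⟩ := hcurve.isBranch_R.exists_le hc (half_pos hκ)
  set l := max l₀ l₁ with hl
  have hcl : P.c < l := hcl₀.trans_le (le_max_left _ _)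
  have hl2 : l < 2 * P.c := max_lt hl₀ hl₁
  obtain ⟨a₀, l₀', hl₀', s₀, z₀, d₀, f₀, g₀, b₀⟩ := hcurve.isBranch_S.exists_cut hκ hκ4 hcl hl2
    ((hcurve.isBranch_S.anti hcl₀.le hcl.le (le_max_left _ _)).trans hSl)
  obtain ⟨a₁, l₁', hl₁', s₁, z₁, d₁, f₁, g₁, b₁⟩ := hcurve.isBranch_R.exists_cut hκ hκ4 hcl hl2
    ((hcurve.isBranch_R.anti hcl₁.le hcl.le (le_max_right _ _)).trans hRl)
  -- `2 c₀` lies beyond the points where both branches have been flattened and still strictly below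
  -- `2c`; the gap is the room for later cut-offs.
  obtain ⟨c₀, hc₀, hc₀', hl₀c, hl₁c⟩ : ∃ c₀, P.c < 2 * c₀ ∧ c₀ < P.c ∧ l₀' ≤ 2 * c₀ ∧
      l₁' ≤ 2 * c₀ := by
    refine ⟨max l (max l₀' l₁') / 2, ?_, ?_, ?_, ?_⟩
    · linarith [le_max_left l (max l₀' l₁')]
    · have : max l (max l₀' l₁') < 2 * P.c := max_lt hl2 (max_lt hl₀' hl₁')
      linarith
    · linarith [le_max_right l (max l₀' l₁'), le_max_left l₀' l₁']
    · linarith [le_max_right l (max l₀' l₁'), le_max_right l₀' l₁']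
  obtain ⟨t, ht, hpar⟩ := hcurve.exists_neckShape hcl hc₀ s₀ s₁
    (fun y hy => d₀ y fun h => absurd h.1 (not_lt.2 hy))
    (fun y hy => d₁ y fun h => absurd h.1 (not_lt.2 hy))
    ⟨fun y hy => b₀.zero y (hl₀c.trans hy), b₀.nonneg, b₀.lt, b₀.deriv⟩
    ⟨fun y hy => b₁.zero y (hl₁c.trans hy), b₁.nonneg, b₁.lt, b₁.deriv⟩
  refine ⟨c₀, t, hc₀, hc₀', ht, ?_⟩
  have hneg : ∀ y, deriv (fun y => -a₁ y) y = -deriv a₁ y := fun y => deriv.fun_neg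
  have := hamiltonianIsotopic_sheets hψ hδ hs s₀ s₁.neg hcl.le (S := P.S) (R := P.R) z₀
    (fun y hy => by rw [z₁ y hy, neg_zero]) d₀
    (fun y hy => by rw [hneg, d₁ y hy, neg_zero]) hκK f₀ g₀ f₁ (fun y hy => by
      rw [hneg]
      convert g₁ y hy using 2
      ring)
  rw [lagrangian_eq_sheets, ← sheets_eq_necked hψ hs hc₀ hc₀' ht hpar]
  convert this using 3
  rw [hneg]
  ring

end TropicalPolynomial

end TropLag
end

/-! ### The chain of isotopies between two tropical Lagrangians. -/

noncomputable section

namespace TropLag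

open Set Metric Filter Topology
open scoped NNReal Pointwise

variable {n : ℕ}

namespace TropicalPolynomial

variable {φ : TropicalPolynomial n}

/-- Interpolated smoothings are separated only below a smaller threshold, so the necks are first
shrunk, each with its own smoothing, to one common small shape. Only then is the potential changed,
and the second half of the chain is run backwards. -/
theorem hamiltonianIsotopic_lagrangian {ε₁ ε₂ : ℝ} (D₁ : SurgeryData φ ε₁) (D₂ : SurgeryData φ ε₂)
    (hs₁ : ∀ m > 0, ∃ K, ∃ δ > 0,
      φ.Separated (φ.smoothing D₁.kernel) m (2 * D₁.profile.c) K δ)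
    (hs₂ : ∀ m > 0, ∃ K, ∃ δ > 0,
      φ.Separated (φ.smoothing D₂.kernel) m (2 * D₂.profile.c) K δ)
    (hs : ∀ m > 0, ∃ K, ∃ δ > 0, ∀ σ ∈ Icc (0 : ℝ) 1,
      φ.Separated (fun x => (1 - σ) * φ.smoothing D₁.kernel x + σ * φ.smoothing D₂.kernel x) m
        (min D₁.profile.c D₂.profile.c / 2) K δ) :
    HamiltonianIsotopic (φ.lagrangian D₁) (φ.lagrangian D₂) := by
  obtain ⟨c₁, t₁, hc₁, hc₁', ht₁, iso₁⟩ := exists_necked D₁ hs₁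
  obtain ⟨c₂, t₂, hc₂, hc₂', ht₂, iso₂⟩ := exists_necked D₂ hs₂
  have hψ₁ := φ.contDiff_smoothing D₁.kernel
  have hψ₂ := φ.contDiff_smoothing D₂.kernel
  have p₁ := D₁.profile.c_pos
  have p₂ := D₂.profile.c_pos
  -- a common neck, small enough for both smoothings
  obtain ⟨a, ha, ha₁, ha₂, haM⟩ : ∃ a > 0, a * c₁ ≤ c₁ ∧ a * c₁ ≤ c₂ ∧
      2 * (a * c₁) < min D₁.profile.c D₂.profile.c / 2 := by
    have hmin : 0 < min D₁.profile.c D₂.profile.c := lt_min p₁ p₂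
    have hle₁ := min_le_left D₁.profile.c D₂.profile.c
    have hle₂ := min_le_right D₁.profile.c D₂.profile.c
    have hpos : 0 < c₁ := by linarith
    -- Then `a c₁` is an eighth of the smaller profile constant: at most `c₁` and `c₂`, with `2 (a
    -- c₁)` below the threshold of the interpolated potentials.
    refine ⟨min D₁.profile.c D₂.profile.c / (8 * c₁), by positivity, ?_⟩
    have : min D₁.profile.c D₂.profile.c / (8 * c₁) * c₁ =
        min D₁.profile.c D₂.profile.c / 8 := by
      field_simp
    rw [this]
    refine ⟨?_, ?_, ?_⟩ <;> linarith
  have ht := ht₁.scale ha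
  set t : ℝ → ℝ := fun u => a * t₁ (u / a)
  have e₁ : HamiltonianIsotopic (φ.necked (φ.smoothing D₁.kernel) c₁ t₁)
      (φ.necked (φ.smoothing D₁.kernel) (a * c₁) t) := by
    have hm : 0 < min D₁.profile.c (a * D₁.profile.c) := lt_min p₁ (mul_pos ha p₁)
    obtain ⟨K, δ, hδ, hsep⟩ := hs₁ (min D₁.profile.c (a * D₁.profile.c) / 4) (by linarith)
    rw [necked_eq_of_le hψ₁ hsep ha₁ (by linarith) ht]
    exact hamiltonianIsotopic_necked_shape hψ₁ hδ hsep (by linarith)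
      (ht₁.mono_left hm (min_le_left _ _)) ((ht.mono ha₁).mono_left hm (min_le_right _ _))
  have e₂ : HamiltonianIsotopic (φ.necked (φ.smoothing D₂.kernel) c₂ t₂)
      (φ.necked (φ.smoothing D₂.kernel) (a * c₁) t) := by
    have hm : 0 < min D₂.profile.c (a * D₁.profile.c) := lt_min p₂ (mul_pos ha p₁)
    obtain ⟨K, δ, hδ, hsep⟩ := hs₂ (min D₂.profile.c (a * D₁.profile.c) / 4) (by linarith)
    rw [necked_eq_of_le hψ₂ hsep ha₂ (by linarith) ht]
    exact hamiltonianIsotopic_necked_shape hψ₂ hδ hsep (by linarith)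
      (ht₂.mono_left hm (min_le_left _ _)) ((ht.mono ha₂).mono_left hm (min_le_right _ _))
  have e : HamiltonianIsotopic (φ.necked (φ.smoothing D₁.kernel) (a * c₁) t)
      (φ.necked (φ.smoothing D₂.kernel) (a * c₁) t) := by
    obtain ⟨K, δ, hδ, hsep⟩ := hs (a * D₁.profile.c / 4) (by linarith [mul_pos ha p₁])
    -- The difference of the potentials is bounded on the whole base because both smoothings are
    -- uniformly close to `φ`; this keeps the base velocity bounded.
    refine hamiltonianIsotopic_necked_potential hψ₁ hψ₂ (C := φ.slope * ε₁ + φ.slope * ε₂)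
      (fun x => ?_) hδ hsep haM ht
    have b₁ := φ.abs_mollify_sub_eval_le D₁.kernel.isMollifier x
    have b₂ := φ.abs_mollify_sub_eval_le D₂.kernel.isMollifier x
    rw [abs_sub_comm] at b₂
    exact (abs_sub_le _ (φ.eval x) _).trans (add_le_add b₁ b₂)
  exact iso₁.trans (e₁.trans (e.trans (e₂.symm.trans iso₂.symm)))

end TropicalPolynomial

end TropLag
end

theorem proposition3p10 (n : ℕ) (φ : TropLag.TropicalPolynomial n)
    (hφ : φ.HasNoSelfIntersections) :
    ∃ ε₀ : ℝ, 0 < ε₀ ∧ ∀ ε₁ ε₂ : ℝ, 0 < ε₁ → ε₁ < ε₀ → 0 < ε₂ → ε₂ < ε₀ →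
      ∀ (D₁ : TropLag.SurgeryData φ ε₁) (D₂ : TropLag.SurgeryData φ ε₂),
        TropLag.HamiltonianIsotopic (φ.lagrangian D₁) (φ.lagrangian D₂) := by
  obtain ⟨ε₀, hε₀, h⟩ := φ.exists_separated hφ
  exact ⟨ε₀, hε₀, fun ε₁ ε₂ h1 h1' h2 h2' D₁ D₂ =>
    have hs := h ε₁ ε₂ h1 h1' h2 h2' D₁ D₂
    TropLag.TropicalPolynomial.hamiltonianIsotopic_lagrangian D₁ D₂ hs.1 hs.2.1 hs.2.2⟩
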